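/- **Theorem (existence of traveling waves for regular $\Gamma$).** All functions are real-valued, $\mathbb N=\{1,2,\dots\}$, $\mathbb T=\mathbb R/2\pi\mathbb Z$, and $H^{-1}(\mathbb R)$ is the dual space of $H^1(\mathbb R)$. Let $\Gamma\in L^\infty(\mathbb R)$ and assume: * (L0) $V_0\in L^\infty(\mathbb R)$, and $V_1:H^1(\mathbb R)\to H^{-1}(\mathbb R)$ is linear and bounded. For $k\in\mathbb N$, $\lambda\in\mathbb R$ put $L^k_\lambda\phi=-\phi''+k^2(1-\lambda V_0-V_1)\phi$ with domain $D(L^k_\lambda)=\{\phi\in H^1(\mathbb R): -\phi''+k^2(1-\lambda V_0-V_1)\phi\in L^2(\mathbb R)\}$. * (L1) For all $k\in\mathbb N$ and $\lambda\in\mathbb R$ the operator $L^k_\lambda:D(L^k_\lambda)\subset L^2(\mathbb R)\to L^2(\mathbb R)$ is self-adjoint. * (L2) There are $k_*\in\mathbb N$, $\lambda_*\in\mathbb R$ and an open interval $I\ni\lambda_*$ such that zero is an isolated simple eigenvalue of $L^{k_*}_{\lambda_*}$, and $0\in\rho(L^k_\lambda)$ for all $(k,\lambda)\in\mathbb N\times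 I$ with $(k,\lambda)\ne(k_*,\lambda_*)$. * (L3) There are $C$ and $K$ such that for all $k\ge K$, $\lambda\in I$ and $\phi\in D(L^k_\lambda)$, with $f=L^k_\lambda\phi$, $$\|\phi\|_{L^2}\le \frac{C}{k^2}\|f\|_{L^2},\qquad \|\phi'\|_{L^2}\le\frac Ck\|f\|_{L^2}.$$ Let $\phi^*$ span $\ker L^{k_*}_{\lambda_*}$ and assume the transversality condition $\int_{\mathbb R}V_0(\phi^*)^2\,dy\neq0$. Let $Z=H^2(\mathbb T;L^2(\mathbb R))\cap H^1(\mathbb T;H^1(\mathbb R))$. A function $\Phi\in Z$ is called a weak solution of $$-\Phi_{yy}-(1-\lambda V_0(y)-V_1(y))\Phi_{xx}+\Gamma(y)(\Phi^3)_{xx}=0\qquad(\ast)$$ if $\Phi^3$ and its weak derivative $(\Phi^3)_{xx}$ lie in $L^2(\mathbb T\times\mathbb R)$ and for all $\Psi\in H^1(\mathbb T;H^1(\mathbb R))$ $$\int_{\mathbb T}\int_{\mathbb R}\Phi_y\Psi_y-(1-\lambda V_0)\Phi_{xx}\Psi\,dy\,dx-\int_{\mathbb T}\langle V_1\Phi_x(x,\cdot),\Psi_x(x,\cdot)\rangle\,dx+\int_{\mathbb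 T}\int_{\mathbb R}\Gamma(\Phi^3)_{xx}\Psi\,dy\,dx=0 .$$ Then there exist $\varepsilon_0>0$ and a $C^\infty$ curve $(-\varepsilon_0,\varepsilon_0)\ni\varepsilon\mapsto(\Phi(\varepsilon),\lambda(\varepsilon))\in Z\times I$ such that, for every $|\varepsilon|<\varepsilon_0$, $\Phi(\varepsilon)$ is a weak solution of $(\ast)$ with $\lambda=\lambda(\varepsilon)$ of the form $\Phi(\varepsilon)(x,y)=\sum_{k\in\mathbb N}\phi_k(y)\sin(kx)$ (convergent in $Z$, with $\phi_k$ depending on $\varepsilon$), $\Phi(\varepsilon)\neq0$ for $\varepsilon\ne0$, and $$\Phi(0)=0,\qquad D_\varepsilon\Phi(0)(x,y)=\phi^*(y)\sin(k_*x),$$ $$\lambda(0)=\lambda_*,\qquad\dot\lambda(0)=0,\qquad\ddot\lambda(0)=-\frac32\,\frac{\int_{\mathbb R}\Gamma(y)\phi^*(y)^4\,dy}{\int_{\mathbb R}V_0(y)\phi^*(y)^2\,dy}.$$ -/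

import Mathlib

open MeasureTheory Set
open scoped ContDiff ENNReal InnerProductSpace

noncomputable section

namespace TravelingWave

/-! ### Function spaces on the line -/

/-- `L²(ℝ)`, real-valued. -/
abbrev L2R : Type := Lp ℝ 2 (volume : Measure ℝ)

/-- `L^∞(ℝ)`, real-valued. -/
abbrev LinfR : Type := Lp ℝ ∞ (volume : Measure ℝ)

theorem integral_mul_eq_inner {g : ℝ → ℝ} (hg : MemLp g 2 (volume : Measure ℝ)) (u : L2R) :
    ∫ y, u y * g y = ⟪hg.toLp g, u⟫_ℝ := by
  rw [L2.inner_def]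
  refine integral_congr_ae ?_
  filter_upwards [hg.coeFn_toLp] with y hy
  simp [hy]

/-- `v` is the weak derivative of `u` on the line. -/
def IsWeakDerivR (u v : L2R) : Prop :=
  ∀ η : ℝ → ℝ, ContDiff ℝ ∞ η → HasCompactSupport η →
    ∫ y, u y * deriv η y = -∫ y, v y * η y

theorem memLp_test {η : ℝ → ℝ} (h1 : ContDiff ℝ ∞ η) (h2 : HasCompactSupport η) :
    MemLp η 2 (volume : Measure ℝ) :=
  h1.continuous.memLp_of_hasCompactSupport h2

theorem memLp_deriv_test {η : ℝ → ℝ} (h1 : ContDiff ℝ ∞ η) (h2 : HasCompactSupport η) :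
    MemLp (deriv η) 2 (volume : Measure ℝ) :=
  (h1.continuous_deriv (by simp)).memLp_of_hasCompactSupport h2.deriv

theorem isWeakDerivR_iff (u v : L2R) : IsWeakDerivR u v ↔
    ∀ (η : ℝ → ℝ) (h1 : ContDiff ℝ ∞ η) (h2 : HasCompactSupport η),
      ⟪(memLp_deriv_test h1 h2).toLp _, u⟫_ℝ = -⟪(memLp_test h1 h2).toLp _, v⟫_ℝ := by
  unfold IsWeakDerivR
  refine forall_congr' fun η => forall_congr' fun h1 => forall_congr' fun h2 => ?_
  rw [integral_mul_eq_inner (memLp_deriv_test h1 h2), integral_mul_eq_inner (memLp_test h1 h2)]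

/-- `H¹(ℝ)`: the pairs `(φ, φ')` in `L²(ℝ) × L²(ℝ)` with `φ'` the weak derivative of `φ`, with
norm `(‖φ‖² + ‖φ'‖²)^{1/2}`. -/
def H1R : Submodule ℝ (WithLp 2 (L2R × L2R)) where
  carrier := {p | IsWeakDerivR p.fst p.snd}
  zero_mem' := by
    simp only [mem_ofPred_eq, isWeakDerivR_iff, WithLp.zero_fst, WithLp.zero_snd]
    intro η h1 h2
    simp
  add_mem' := by
    intro p q hp hq
    simp only [mem_ofPred_eq, isWeakDerivR_iff, WithLp.add_fst, WithLp.add_snd] at *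
    intro η h1 h2
    rw [inner_add_right, inner_add_right, hp η h1 h2, hq η h1 h2]
    ring
  smul_mem' := by
    intro c p hp
    simp only [mem_ofPred_eq, isWeakDerivR_iff, WithLp.smul_fst, WithLp.smul_snd] at *
    intro η h1 h2
    rw [inner_smul_right, inner_smul_right, hp η h1 h2]
    ring

instance : NormedAddCommGroup H1R := inferInstance

instance : SeminormedAddCommGroup H1R := inferInstance

instance : NormedSpace ℝ H1R := inferInstance

theorem isClosed_H1R : IsClosed (H1R : Set (WithLp 2 (L2R × L2R))) := by
  have : (H1R : Set (WithLp 2 (L2R × L2R))) =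
      ⋂ (η : ℝ → ℝ) (h1 : ContDiff ℝ ∞ η) (h2 : HasCompactSupport η),
        {p | ⟪(memLp_deriv_test h1 h2).toLp _, p.fst⟫_ℝ =
          -⟪(memLp_test h1 h2).toLp _, p.snd⟫_ℝ} := by
    ext p
    simp only [mem_iInter, mem_ofPred_eq]
    exact isWeakDerivR_iff _ _
  rw [this]
  refine isClosed_iInter fun η => isClosed_iInter fun h1 => isClosed_iInter fun h2 => ?_
  refine isClosed_eq ?_ ?_
  · exact continuous_const.inner (WithLp.fstL 2 ℝ L2R L2R).continuous
  · exact (continuous_const.inner (WithLp.sndL 2 ℝ L2R L2R).continuous).neg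

instance : CompleteSpace H1R := isClosed_H1R.completeSpace_coe

/-- The embedding `H¹(ℝ) → L²(ℝ)`, `φ ↦ φ`. -/
def h1Val : H1R →L[ℝ] L2R := (WithLp.fstL 2 ℝ L2R L2R).comp H1R.subtypeL

/-- The derivative `H¹(ℝ) → L²(ℝ)`, `φ ↦ φ'`. -/
def h1Der : H1R →L[ℝ] L2R := (WithLp.sndL 2 ℝ L2R L2R).comp H1R.subtypeL

/-- `H⁻¹(ℝ)`, the dual space of `H¹(ℝ)`. -/
abbrev Hm1R : Type := StrongDual ℝ H1R

/-! ### The Schrödinger operators `L^k_λ = -d²/dy² + k² (1 - λ V₀ - V₁)` -/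

/-- The dual pairing of `-φ'' + k² (1 - λ V₀ - V₁) φ ∈ H⁻¹(ℝ)` with `ψ ∈ H¹(ℝ)`, for `φ ∈ H¹(ℝ)`. -/
def schrodingerForm (V0 : LinfR) (V1 : H1R →L[ℝ] Hm1R) (k : ℕ) (lam : ℝ) (φ ψ : H1R) : ℝ :=
  ⟪h1Der φ, h1Der ψ⟫_ℝ
    + (k : ℝ) ^ 2 * (⟪h1Val φ, h1Val ψ⟫_ℝ - lam * ⟪(V0 • h1Val φ : L2R), h1Val ψ⟫_ℝ - V1 φ ψ)

/-- The graph of `L^k_λ`: all `(φ, f)` with `φ ∈ H¹(ℝ)`, `f ∈ L²(ℝ)` and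
`-φ'' + k² (1 - λ V₀ - V₁) φ = f` in `H⁻¹(ℝ)`. -/
def schrodingerGraph (V0 : LinfR) (V1 : H1R →L[ℝ] Hm1R) (k : ℕ) (lam : ℝ) :
    Submodule ℝ (L2R × L2R) where
  carrier := {p | ∃ φ : H1R, h1Val φ = p.1 ∧ ∀ ψ : H1R, schrodingerForm V0 V1 k lam φ ψ =
    ⟪p.2, h1Val ψ⟫_ℝ}
  zero_mem' := ⟨0, by simp, fun ψ => by simp [schrodingerForm]⟩
  add_mem' := by
    rintro p q ⟨φ, h1, h2⟩ ⟨φ', h1', h2'⟩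
    refine ⟨φ + φ', by simp [h1, h1'], fun ψ => ?_⟩
    rw [Prod.snd_add, inner_add_left, ← h2, ← h2']
    have : (V0 • (h1Val φ + h1Val φ') : L2R) = (V0 • h1Val φ : L2R) + (V0 • h1Val φ' : L2R) :=
      Lp.add_smul V0 _ _
    simp only [schrodingerForm, map_add, this, inner_add_left, add_apply]
    ring
  smul_mem' := by
    rintro c p ⟨φ, h1, h2⟩
    refine ⟨c • φ, by simp [h1], fun ψ => ?_⟩
    rw [Prod.smul_snd, real_inner_smul_left, ← h2]
    have : (V0 • (c • h1Val φ) : L2R) = c • (V0 • h1Val φ : L2R) :=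
      (Lp.smul_comm c V0 (h1Val φ)).symm
    simp only [schrodingerForm, map_smul, this, real_inner_smul_left, smul_apply,
      smul_eq_mul]
    ring

/-- An `L²` function orthogonal to all test functions is zero. -/
theorem eq_zero_of_forall_test (f : L2R)
    (h : ∀ η : ℝ → ℝ, ContDiff ℝ ∞ η → HasCompactSupport η → ∫ y, f y * η y = 0) : f = 0 := by
  rw [Lp.eq_zero_iff_ae_eq_zero]
  refine ae_eq_zero_of_integral_contDiff_smul_eq_zero
    ((Lp.memLp f).locallyIntegrable (by norm_num)) fun g hg hg' => ?_
  rw [← h g hg hg']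
  exact integral_congr_ae (Filter.Eventually.of_forall fun y => by simp [mul_comm])

/-- A test function as an element of `H¹(ℝ)`. -/
theorem exists_h1_test {η : ℝ → ℝ} (h1 : ContDiff ℝ ∞ η) (h2 : HasCompactSupport η) :
    ∃ ψ : H1R, h1Val ψ = (memLp_test h1 h2).toLp η := by
  refine ⟨⟨WithLp.toLp 2 ((memLp_test h1 h2).toLp η, (memLp_deriv_test h1 h2).toLp _), ?_⟩, rfl⟩
  intro ζ k1 k2
  change ∫ y, ((memLp_test h1 h2).toLp η : L2R) y * deriv ζ y =
    -∫ y, ((memLp_deriv_test h1 h2).toLp (deriv η) : L2R) y * ζ y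
  have e1 : ∫ y, ((memLp_test h1 h2).toLp η : L2R) y * deriv ζ y = ∫ y, η y * deriv ζ y := by
    refine integral_congr_ae ?_
    filter_upwards [(memLp_test h1 h2).coeFn_toLp] with y hy
    rw [hy]
  have e2 : ∫ y, ((memLp_deriv_test h1 h2).toLp (deriv η) : L2R) y * ζ y =
      ∫ y, deriv η y * ζ y := by
    refine integral_congr_ae ?_
    filter_upwards [(memLp_deriv_test h1 h2).coeFn_toLp] with y hy
    rw [hy]
  rw [e1, e2]
  refine integral_mul_deriv_eq_deriv_mul_of_integrable
    (fun x _ => (h1.differentiable (by simp) x).hasDerivAt)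
    (fun x _ => (k1.differentiable (by simp) x).hasDerivAt) ?_ ?_ ?_
  · exact (memLp_test h1 h2).integrable_mul (memLp_deriv_test k1 k2)
  · exact (memLp_deriv_test h1 h2).integrable_mul (memLp_test k1 k2)
  · exact (memLp_test h1 h2).integrable_mul (memLp_test k1 k2)

theorem schrodingerGraph_single_valued (V0 : LinfR) (V1 : H1R →L[ℝ] Hm1R) (k : ℕ) (lam : ℝ)
    (p : L2R × L2R) (hp : p ∈ schrodingerGraph V0 V1 k lam) (h0 : p.1 = 0) : p.2 = 0 := by
  obtain ⟨φ, h1, h2⟩ := hp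
  rw [h0] at h1
  have hd : h1Der φ = 0 := by
    refine eq_zero_of_forall_test _ fun η k1 k2 => ?_
    have h := φ.2 η k1 k2
    change ∫ y, (h1Val φ) y * deriv η y = -∫ y, (h1Der φ) y * η y at h
    rw [integral_mul_eq_inner (memLp_deriv_test k1 k2), h1, inner_zero_right] at h
    linarith
  have hφ : φ = 0 := by
    apply Subtype.ext
    apply WithLp.ofLp_injective
    exact Prod.ext h1 hd
  refine eq_zero_of_forall_test _ fun η k1 k2 => ?_
  obtain ⟨ψ, hψ⟩ := exists_h1_test k1 k2
  have h := h2 ψ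
  rw [hφ, hψ] at h
  rw [integral_mul_eq_inner (memLp_test k1 k2), real_inner_comm, ← h]
  simp [schrodingerForm]

/-- The operator `L^k_λ : D(L^k_λ) ⊂ L²(ℝ) → L²(ℝ)`, with the natural domain
`D(L^k_λ) = {φ ∈ H¹(ℝ) | -φ'' + k² (1 - λ V₀ - V₁) φ ∈ L²(ℝ)}`. -/
def schrodinger (V0 : LinfR) (V1 : H1R →L[ℝ] Hm1R) (k : ℕ) (lam : ℝ) : L2R →ₗ.[ℝ] L2R :=
  (schrodingerGraph V0 V1 k lam).toLinearPMap

theorem graph_schrodinger (V0 : LinfR) (V1 : H1R →L[ℝ] Hm1R) (k : ℕ) (lam : ℝ) :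
    (schrodinger V0 V1 k lam).graph = schrodingerGraph V0 V1 k lam :=
  Submodule.toLinearPMap_graph_eq _ (schrodingerGraph_single_valued V0 V1 k lam)

/-- `mu ∈ ρ(L)`: the map `mu - L : D(L) → L²(ℝ)` has a bounded inverse. (Only real `mu` matter
below, where `L` is self-adjoint; for a real operator and real `mu` this is the same as for the
complexified operator.) -/
def MemResolventSet (L : L2R →ₗ.[ℝ] L2R) (mu : ℝ) : Prop :=
  ∃ R : L2R →L[ℝ] L2R,
    (∀ f : L2R, ∃ h : R f ∈ L.domain, mu • R f - L ⟨R f, h⟩ = f) ∧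
    ∀ u : L.domain, R (mu • (u : L2R) - L u) = u

/-- The kernel of `L`, as a subspace of `L²(ℝ)`. -/
def kernel (L : L2R →ₗ.[ℝ] L2R) : Submodule ℝ L2R := (LinearMap.ker L.toFun).map L.domain.subtype

/-- Zero is an isolated simple eigenvalue of the self-adjoint operator `L`: the kernel is
one-dimensional and a punctured neighbourhood of zero belongs to the resolvent set. -/
def ZeroIsIsolatedSimpleEigenvalue (L : L2R →ₗ.[ℝ] L2R) : Prop :=
  Module.finrank ℝ (kernel L) = 1 ∧
    ∃ δ > 0, ∀ mu : ℝ, 0 < |mu| → |mu| < δ → MemResolventSet L mu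

/-! ### Periodic function spaces -/

/-- Lebesgue measure on the torus `𝕋 = ℝ / 2πℤ`, represented by the fundamental domain
`(0, 2π]`. -/
def muT : Measure ℝ := (volume : Measure ℝ).restrict (Ioc 0 (2 * Real.pi))

instance : IsFiniteMeasure muT := by
  unfold muT; infer_instance

section Periodic

variable (E : Type*) [NormedAddCommGroup E] [NormedSpace ℝ E]

/-- `L²(𝕋; E)`. -/
abbrev L2T : Type _ := Lp E 2 muT

variable {E}

/-- `v` is the weak derivative of `u` on the torus: test functions are the smooth `2π`-periodic
functions. -/
def IsWeakDerivT (u v : L2T E) : Prop :=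
  ∀ η : ℝ → ℝ, ContDiff ℝ ∞ η → Function.Periodic η (2 * Real.pi) →
    ∫ x, deriv η x • u x ∂muT = -∫ x, η x • v x ∂muT

/-- `w` is the second weak derivative of `u` on the torus. -/
def IsWeakDeriv2T (u w : L2T E) : Prop :=
  ∀ η : ℝ → ℝ, ContDiff ℝ ∞ η → Function.Periodic η (2 * Real.pi) →
    ∫ x, iteratedDeriv 2 η x • u x ∂muT = ∫ x, η x • w x ∂muT

theorem integrable_smul_of_continuous {g : ℝ → ℝ} (hg : Continuous g) (u : L2T E) :
    Integrable (fun x => g x • u x) muT := by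
  obtain ⟨C, hC⟩ := (isCompact_Icc (a := (0 : ℝ)) (b := 2 * Real.pi)).exists_bound_of_continuousOn
    hg.continuousOn
  refine ((Lp.memLp u).integrable (by norm_num)).bdd_smul C hg.aestronglyMeasurable ?_
  unfold muT
  filter_upwards [ae_restrict_mem measurableSet_Ioc] with x hx
  exact hC x (Ioc_subset_Icc_self hx)

theorem integral_smul_add {g : ℝ → ℝ} (hg : Continuous g) (u v : L2T E) :
    ∫ x, g x • (u + v) x ∂muT = ∫ x, g x • u x ∂muT + ∫ x, g x • v x ∂muT := by
  rw [← integral_add (integrable_smul_of_continuous hg u) (integrable_smul_of_continuous hg v)]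
  refine integral_congr_ae ?_
  filter_upwards [Lp.coeFn_add u v] with x hx
  simp only [hx, Pi.add_apply, smul_add]

theorem integral_smul_smul (g : ℝ → ℝ) (c : ℝ) (u : L2T E) :
    ∫ x, g x • (c • u) x ∂muT = c • ∫ x, g x • u x ∂muT := by
  rw [← integral_smul]
  refine integral_congr_ae ?_
  filter_upwards [Lp.coeFn_smul c u] with x hx
  simp only [hx, Pi.smul_apply]
  rw [smul_comm]

theorem integral_smul_zero (g : ℝ → ℝ) : ∫ x, g x • (0 : L2T E) x ∂muT = 0 := by
  simpa using integral_smul_smul g 0 (0 : L2T E)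

theorem IsWeakDerivT.zero : IsWeakDerivT (0 : L2T E) 0 := fun η _ _ => by
  rw [integral_smul_zero, integral_smul_zero, neg_zero]

theorem IsWeakDerivT.add {u v u' v' : L2T E} (h : IsWeakDerivT u v) (h' : IsWeakDerivT u' v') :
    IsWeakDerivT (u + u') (v + v') := fun η h1 h2 => by
  rw [integral_smul_add (h1.continuous_deriv (by simp)), integral_smul_add h1.continuous,
    h η h1 h2, h' η h1 h2, neg_add]

theorem IsWeakDerivT.smul {u v : L2T E} (c : ℝ) (h : IsWeakDerivT u v) :
    IsWeakDerivT (c • u) (c • v) := fun η h1 h2 => by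
  rw [integral_smul_smul, integral_smul_smul, h η h1 h2, smul_neg]

end Periodic

/-- `H¹(𝕋; H¹(ℝ))`: the pairs `(Ψ, Ψ_x)`. -/
def TestSpace : Submodule ℝ (L2T H1R × L2T H1R) where
  carrier := {p | IsWeakDerivT p.1 p.2}
  zero_mem' := IsWeakDerivT.zero
  add_mem' := fun h h' => h.add h'
  smul_mem' := fun c _ h => h.smul c

/-- The embedding `L²(𝕋; H¹(ℝ)) → L²(𝕋; L²(ℝ))`. -/
def l2tVal : L2T H1R →L[ℝ] L2T L2R := h1Val.compLpL 2 muT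

/-- `H²(𝕋; L²(ℝ)) ∩ H¹(𝕋; H¹(ℝ))`: the triples `(Φ, Φ_x, Φ_xx)` with `Φ, Φ_x ∈ L²(𝕋; H¹(ℝ))` and
`Φ_xx ∈ L²(𝕋; L²(ℝ))`, normed by the maximum of the three norms. -/
def WaveSpace : Submodule ℝ (L2T H1R × L2T H1R × L2T L2R) where
  carrier := {p | IsWeakDerivT p.1 p.2.1 ∧ IsWeakDerivT (l2tVal p.2.1) p.2.2}
  zero_mem' := ⟨IsWeakDerivT.zero, by simpa using IsWeakDerivT.zero⟩
  add_mem' := fun h h' => ⟨h.1.add h'.1, by simpa using h.2.add h'.2⟩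
  smul_mem' := fun c _ h => ⟨h.1.smul c, by simpa using h.2.smul c⟩

/-- The function `x ↦ Φ(x, ·) ∈ H¹(ℝ)`. -/
def waveVal (Φ : WaveSpace) : L2T H1R := Φ.1.1

/-- The function `x ↦ Φ_x(x, ·) ∈ H¹(ℝ)`. -/
def waveDx (Φ : WaveSpace) : L2T H1R := Φ.1.2.1

/-- The function `x ↦ Φ_xx(x, ·) ∈ L²(ℝ)`. -/
def waveDxx (Φ : WaveSpace) : L2T L2R := Φ.1.2.2

/-! ### Weak solutions and sine series -/

/-- `Φ` is a weak solution of `-Φ_yy - (1 - λ V₀ - V₁) Φ_xx + Γ (Φ³)_xx = 0`. Here `c` is `Φ³` and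
`g` is its second weak `x`-derivative, both in `L²(𝕋; L²(ℝ))`. -/
def IsWeakSolution (Γ V0 : LinfR) (V1 : H1R →L[ℝ] Hm1R) (lam : ℝ) (Φ : WaveSpace) : Prop :=
  ∃ c g : L2T L2R,
    (∀ᵐ x ∂muT, ∀ᵐ y : ℝ, c x y = (h1Val (waveVal Φ x) y) ^ 3) ∧
    IsWeakDeriv2T c g ∧
    ∀ Ψ Ψx : L2T H1R, (Ψ, Ψx) ∈ TestSpace →
      (∫ x, (⟪h1Der (waveVal Φ x), h1Der (Ψ x)⟫_ℝ
          - ⟪waveDxx Φ x - lam • (V0 • waveDxx Φ x : L2R), h1Val (Ψ x)⟫_ℝ) ∂muT)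
        - (∫ x, V1 (waveDx Φ x) (Ψx x) ∂muT)
        + (∫ x, ⟪(Γ • g x : L2R), h1Val (Ψ x)⟫_ℝ ∂muT) = 0

/-- `Φ(x, y) = φ(y) sin(kx)`. -/
def IsSineMode (k : ℕ) (φ : L2R) (Φ : WaveSpace) : Prop :=
  ∀ᵐ x ∂muT, h1Val (waveVal Φ x) = Real.sin (k * x) • φ

/-- `Φ(x, y) = ∑_{k ≥ 1} φ_k(y) sin(kx)`, with convergence in the space of `Φ`. -/
def IsSineSeries (Φ : WaveSpace) : Prop :=
  ∃ (φ : ℕ → L2R) (m : ℕ → WaveSpace), (∀ k, IsSineMode (k + 1) (φ k) (m k)) ∧ HasSum m Φ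

end TravelingWave
end

/-!
The travelling waves bifurcate from the zero solution at `λ_*` through a one-dimensional kernel, by
a Lyapunov–Schmidt reduction in which every object is expanded in sines in `x`.

On the mode `sin(kx) φ(y)` the linear part of the equation is the operator `L^k_λ`. At `λ = λ_*`
it is invertible for `k ≠ k_*`, and a self-adjoint operator with zero as an isolated eigenvalue has
as its range the orthogonal complement of its kernel (`exists_apply_eq_of_isolated`, proved without
the spectral theorem, from bounds on real resolvents only), so that `L^{k_*}_{λ_*}` is invertible up
to `φ^*`. By the closed graph theorem the inverses are bounded into `H¹(ℝ)`, and the resolvent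
estimates say precisely that they gain, for large `k`, the factors `1/k²` in `L²(ℝ)` and `1/k` in
`H¹(ℝ)`. Hence the mode-by-mode inverse is one bounded operator `S` from `L²(𝕋; L²(ℝ))` to the
closed span `SineWaves` of the modes, and `S f` solves the linearized equation weakly whenever `f`
is a sine series orthogonal to `sin(k_* x) φ^*(y)` (`exists_solution_operator`). Only `λ = λ_*`
enters here; the dependence on `λ` is treated as a perturbation.

The nonlinearity is bounded and cubic: `H¹` is embedded in `L^∞`, both on the line and on the torus,
so `Φ ↦ (Φ³)_xx = 3 Φ² Φ_xx + 6 Φ Φ_x²` is a continuous homogeneous polynomial from `SineWaves` to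
`L²(𝕋; L²(ℝ))`, hence analytic (`contDiff_cubeDxx`), and its values are sine series again
(`cubeDxx_mem_sinL2`).

With `Φ = ε (e + w)`, `e = sin(k_* x) φ^*(y)`, `λ = λ_* - ε² q` and `u = e + w`, the equation
becomes `w = ε² S (q V₀ u_xx - Γ (u³)_xx)` together with the orthogonality of the bracket to `e`.
The latter is a linear equation for `q`, solvable near `w = 0` by transversality, and what remains
is a fixed point equation with the small parameter `τ = ε²`, to which the implicit function theorem
applies (`exists_lyapunov_schmidt_curve`). The curvature is `-2 q(0)`, where `q(0)` is
the quotient of the pairings of `e` with `Γ (e³)_xx` and with `V₀ e_xx`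
(`bifurcation_coefficient`); the factor `3/4` in it is the coefficient of `sin` in `sin³`.
-/

/-! ### A fixed-point curve -/

/-- The implicit function theorem for `w = τ N(w)` at `(τ, w) = (0, 0)`, where the derivative in `w`
is the identity. -/
theorem exists_analytic_fixedPoint_curve {E : Type*} [NormedAddCommGroup E] [NormedSpace ℝ E]
    [CompleteSpace E] {N : E → E} (hN : ContDiffAt ℝ ω N 0) :
    ∃ (δ : ℝ) (w : ℝ → E), 0 < δ ∧ ContDiffOn ℝ ω w (Ioo (-δ) δ) ∧ w 0 = 0 ∧
      ∀ τ ∈ Ioo (-δ) δ, w τ = τ • N (w τ) := by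
  set F : ℝ × E → E := fun p => p.2 - p.1 • N p.2 with hF
  have hN' : ContDiffAt ℝ ω (fun p : ℝ × E => N p.2) (0, 0) :=
    ContDiffAt.comp (x := ((0, 0) : ℝ × E)) (g := N) (f := Prod.snd) hN contDiffAt_snd
  have cdf : ContDiffAt ℝ ω F (0, 0) :=
    contDiffAt_snd.sub (contDiffAt_fst.smul hN')
  have hd : HasFDerivAt F (ContinuousLinearMap.snd ℝ ℝ E -
      ((0 : ℝ) • fderiv ℝ (fun p : ℝ × E => N p.2) (0, 0) +
        (ContinuousLinearMap.fst ℝ ℝ E).smulRight (N 0))) (0, 0) :=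
    hasFDerivAt_snd.sub
      (HasFDerivAt.smul (hasFDerivAt_fst) ((hN'.differentiableAt (by simp)).hasFDerivAt))
  have hinv : (fderiv ℝ F (0, 0) ∘L .inr ℝ ℝ E).IsInvertible := by
    refine ⟨ContinuousLinearEquiv.refl ℝ E, ?_⟩
    rw [hd.fderiv]
    ext v
    simp
  have h0 : (ω : WithTop ℕ∞) ≠ 0 := by simp
  have h1 := cdf.eventually_apply_implicitFunction h0 hinv
  have h2 := cdf.contDiffAt_implicitFunction h0 hinv
  have h3 := cdf.implicitFunction_apply_self h0 hinv
  set w := cdf.implicitFunction h0 hinv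
  obtain ⟨s, hs, hws⟩ := h2.contDiffOn le_rfl (by simp)
  obtain ⟨δ, hδ, hb⟩ := Metric.eventually_nhds_iff.1 (h1.and (Filter.eventually_mem_set.2 hs))
  have key : ∀ τ ∈ Ioo (-δ) δ, dist τ (0 : ℝ) < δ := fun τ hτ => by
    simpa [abs_lt] using hτ
  refine ⟨δ, w, hδ, fun τ hτ => ?_, h3, fun τ hτ => ?_⟩
  · exact (hws.mono fun τ hτ => (hb (key τ hτ)).2) τ hτ
  · have := (hb (key τ hτ)).1
    simp only [hF, zero_smul, sub_zero] at this
    exact sub_eq_zero.1 this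

/-! ### The range of a self-adjoint operator with a spectral gap around zero -/

section SpectralGap

variable {H : Type*} [NormedAddCommGroup H] [InnerProductSpace ℝ H]

/-- If `1 - s T` is bounded below for all real `0 < |s| < r`, then a symmetric `T` has norm at most
`1/r`: for `s = 1/‖T‖` the bounds for `s` and `-s` make `1 - s² T²` bounded below, which prevents
`‖T x‖` from coming close to `‖T‖ ‖x‖`. -/
theorem norm_apply_le_of_symmetric {T : H →L[ℝ] H} (hT : ∀ x y, ⟪T x, y⟫_ℝ = ⟪x, T y⟫_ℝ)
    {r : ℝ} (hr : 0 < r)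
    (h : ∀ s : ℝ, 0 < |s| → |s| < r → ∃ κ > 0, ∀ x, κ * ‖x‖ ≤ ‖x - s • T x‖) (x : H) :
    r * ‖T x‖ ≤ ‖x‖ := by
  by_contra! hx
  have hx0 : 0 < ‖x‖ := by
    rw [norm_pos_iff]
    rintro rfl
    simp at hx
  have hle := T.le_opNorm x
  have hc : 1 < r * ‖T‖ := by
    by_contra! hcon
    nlinarith
  have hc0 : 0 < ‖T‖ := by
    by_contra! hcon
    nlinarith
  set s := ‖T‖⁻¹ with hs
  have hs0 : 0 < s := by positivity
  have hsr : s < r := by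
    rw [hs, inv_lt_iff_one_lt_mul₀ hc0]
    linarith
  obtain ⟨κ₁, hκ₁, hb₁⟩ := h s (by rwa [abs_of_pos hs0]) (by rwa [abs_of_pos hs0])
  obtain ⟨κ₂, hκ₂, hb₂⟩ := h (-s) (by rwa [abs_neg, abs_of_pos hs0])
    (by rwa [abs_neg, abs_of_pos hs0])
  have hsT : s * ‖T‖ = 1 := inv_mul_cancel₀ hc0.ne'
  set κ := κ₁ * κ₂
  have hκ : 0 < κ := mul_pos hκ₁ hκ₂
  have key : ∀ y, s ^ 2 * ‖T y‖ ^ 2 ≤ (1 - κ ^ 2) * ‖y‖ ^ 2 := by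
    intro y
    have e1 : κ * ‖y‖ ≤ ‖y - (s ^ 2) • T (T y)‖ := by
      have a1 := hb₂ y
      have a2 := hb₁ (y - (-s) • T y)
      have a3 : (y - (-s) • T y) - s • T (y - (-s) • T y) = y - (s ^ 2) • T (T y) := by
        simp only [map_sub, map_smul]
        module
      rw [a3] at a2
      calc κ * ‖y‖ = κ₁ * (κ₂ * ‖y‖) := by ring
        _ ≤ κ₁ * ‖y - (-s) • T y‖ := by gcongr
        _ ≤ _ := a2
    have e2 : ‖y - (s ^ 2) • T (T y)‖ ^ 2 =
        ‖y‖ ^ 2 - 2 * (s ^ 2 * ‖T y‖ ^ 2) + s ^ 4 * ‖T (T y)‖ ^ 2 := by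
      rw [norm_sub_sq_real, real_inner_smul_right, ← hT, real_inner_self_eq_norm_sq, norm_smul]
      simp only [norm_pow, Real.norm_eq_abs, mul_pow, sq_abs]
      ring
    have e3 : s ^ 4 * ‖T (T y)‖ ^ 2 ≤ s ^ 2 * ‖T y‖ ^ 2 := by
      have b1 : s * ‖T (T y)‖ ≤ ‖T y‖ := by
        calc s * ‖T (T y)‖ ≤ s * (‖T‖ * ‖T y‖) := by gcongr; exact T.le_opNorm _
          _ = ‖T y‖ := by rw [← mul_assoc, hsT, one_mul]
      have b2 : (s * ‖T (T y)‖) ^ 2 ≤ ‖T y‖ ^ 2 := by gcongr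
      nlinarith [sq_nonneg s]
    have e4 : (κ * ‖y‖) ^ 2 ≤ ‖y - (s ^ 2) • T (T y)‖ ^ 2 := by gcongr
    nlinarith
  have hκ1 : 0 ≤ 1 - κ ^ 2 := by
    have := key x
    have h2 : 0 ≤ s ^ 2 * ‖T x‖ ^ 2 := by positivity
    by_contra! hcon
    nlinarith [pow_pos hx0 2]
  have hbound : ‖T‖ ≤ ‖T‖ * √(1 - κ ^ 2) := by
    refine T.opNorm_le_bound (by positivity) fun y => ?_
    have h1 : ‖T y‖ ^ 2 ≤ (‖T‖ * √(1 - κ ^ 2) * ‖y‖) ^ 2 := by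
      rw [mul_pow, mul_pow, Real.sq_sqrt hκ1]
      calc ‖T y‖ ^ 2 = (s * ‖T‖) ^ 2 * ‖T y‖ ^ 2 := by rw [hsT]; ring
        _ = ‖T‖ ^ 2 * (s ^ 2 * ‖T y‖ ^ 2) := by ring
        _ ≤ ‖T‖ ^ 2 * ((1 - κ ^ 2) * ‖y‖ ^ 2) := mul_le_mul_of_nonneg_left (key y) (by positivity)
        _ = _ := by ring
    exact (sq_le_sq₀ (norm_nonneg _) (by positivity)).1 h1
  have hlt : √(1 - κ ^ 2) < 1 := by
    rw [Real.sqrt_lt' one_pos]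
    nlinarith [pow_pos hκ 2]
  nlinarith

variable [CompleteSpace H] {A : H →ₗ.[ℝ] H}

theorem LinearPMap.inner_apply_comm (hA : IsSelfAdjoint A) (u v : A.domain) :
    ⟪A u, (v : H)⟫_ℝ = ⟪(u : H), A v⟫_ℝ := by
  have h := LinearPMap.adjoint_isFormalAdjoint hA.dense_domain
  rw [LinearPMap.isSelfAdjoint_def.1 hA] at h
  exact h u v

/-- If `A` has no spectrum in `(-δ, 0) ∪ (0, δ)` then `δ |A| ≤ A²` in the sense of quadratic forms.
This is the estimate `(δ/2) ‖u‖ ≤ ‖(m - A) u‖` at `m = ±δ/2`, the midpoints of the two gaps. -/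
theorem mul_abs_inner_apply_le (hA : IsSelfAdjoint A) {δ : ℝ} (hδ : 0 < δ)
    (hres : ∀ mu : ℝ, 0 < |mu| → |mu| < δ → ∃ R : H →L[ℝ] H,
      (∀ f : H, ∃ h : R f ∈ A.domain, mu • R f - A ⟨R f, h⟩ = f) ∧
      ∀ u : A.domain, R (mu • (u : H) - A u) = u) (u : A.domain) :
    δ * |⟪(u : H), A u⟫_ℝ| ≤ ‖A u‖ ^ 2 := by
  have gap : ∀ m : ℝ, |m| = δ / 2 → 2 * m * ⟪(u : H), A u⟫_ℝ ≤ ‖A u‖ ^ 2 := by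
    intro m hm
    have hm0 : 0 < |m| := by rw [hm]; positivity
    obtain ⟨T, hT1, hT2⟩ := hres m hm0 (by rw [hm]; linarith)
    have hsym : ∀ x y, ⟪T x, y⟫_ℝ = ⟪x, T y⟫_ℝ := by
      intro x y
      obtain ⟨hx, ex⟩ := hT1 x
      obtain ⟨hy, ey⟩ := hT1 y
      have := LinearPMap.inner_apply_comm hA ⟨T x, hx⟩ ⟨T y, hy⟩
      simp only at this
      calc ⟪T x, y⟫_ℝ = ⟪T x, m • T y - A ⟨T y, hy⟩⟫_ℝ := by rw [ey]
        _ = ⟪m • T x - A ⟨T x, hx⟩, T y⟫_ℝ := by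
          rw [inner_sub_right, inner_sub_left, this, real_inner_smul_left, real_inner_smul_right]
        _ = _ := by rw [ex]
    have hb := norm_apply_le_of_symmetric hsym hm0 (fun s hs hsm => by
      have hms : 0 < |m - s| := by
        rw [abs_pos, sub_ne_zero]
        rintro rfl
        exact lt_irrefl _ hsm
      have hms' : |m - s| < δ := by
        calc |m - s| ≤ |m| + |s| := abs_sub _ _
          _ < δ := by linarith
      obtain ⟨R, -, hR⟩ := hres (m - s) hms hms'
      refine ⟨(1 + |s| * ‖R‖)⁻¹, by positivity, fun x => ?_⟩
      obtain ⟨hx, ex⟩ := hT1 x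
      have e1 : R (x - s • T x) = T x := by
        refine Eq.trans ?_ (hR ⟨T x, hx⟩)
        congr 1
        nth_rewrite 1 [← ex]
        simp only
        module
      have e2 : ‖T x‖ ≤ ‖R‖ * ‖x - s • T x‖ := by
        rw [← e1]
        nth_rewrite 2 [e1]
        exact R.le_opNorm _
      have e3 : ‖x‖ ≤ ‖x - s • T x‖ + |s| * ‖T x‖ := by
        have := norm_add_le (x - s • T x) (s • T x)
        rwa [sub_add_cancel, norm_smul, Real.norm_eq_abs] at this
      rw [inv_mul_le_iff₀ (by positivity)]
      nlinarith [abs_nonneg s, mul_le_mul_of_nonneg_left e2 (abs_nonneg s)]) (m • (u : H) - A u)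
    rw [hT2 u] at hb
    have h2 : (|m| * ‖(u : H)‖) ^ 2 ≤ ‖m • (u : H) - A u‖ ^ 2 := by gcongr
    rw [norm_sub_sq_real, norm_smul, real_inner_smul_left, Real.norm_eq_abs] at h2
    linarith
  have g1 := gap (δ / 2) (abs_of_pos (by positivity))
  have g2 := gap (-(δ / 2)) (by rw [abs_neg]; exact abs_of_pos (by positivity))
  rcases abs_cases ⟪(u : H), A u⟫_ℝ with ⟨h, _⟩ | ⟨h, _⟩ <;> rw [h] <;> linarith

/-- The polarized form of `δ |⟪u, A u⟫| ≤ ‖A u‖²`. -/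
theorem mul_inner_apply_le (hA : IsSelfAdjoint A) {δ : ℝ} (hδ : 0 < δ)
    (hq : ∀ u : A.domain, δ * |⟪(u : H), A u⟫_ℝ| ≤ ‖A u‖ ^ 2) (u v : A.domain) :
    δ * ⟪A u, (v : H)⟫_ℝ ≤ ‖A u‖ * ‖A v‖ := by
  have pol : ∀ u v : A.domain, 2 * (δ * ⟪A u, (v : H)⟫_ℝ) ≤ ‖A u‖ ^ 2 + ‖A v‖ ^ 2 := by
    intro u v
    have h1 := hq (u + v)
    have h2 := hq (u - v)
    have s1 := LinearPMap.inner_apply_comm hA u v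
    rw [A.map_add] at h1
    rw [A.map_sub] at h2
    simp only [Submodule.coe_add, Submodule.coe_sub, inner_add_left, inner_add_right,
      inner_sub_left, inner_sub_right] at h1 h2
    have h3 := parallelogram_law_with_norm ℝ (A u) (A v)
    have h1' := le_abs_self (⟪(u : H), A u⟫_ℝ + ⟪(v : H), A u⟫_ℝ +
      (⟪(u : H), A v⟫_ℝ + ⟪(v : H), A v⟫_ℝ))
    have h2' := neg_abs_le (⟪(u : H), A u⟫_ℝ - ⟪(v : H), A u⟫_ℝ -
      (⟪(u : H), A v⟫_ℝ - ⟪(v : H), A v⟫_ℝ))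
    rw [real_inner_comm (A u) (v : H)] at h1 h1' h2 h2'
    rw [← s1] at h1 h1' h2 h2'
    nlinarith
  rcases eq_or_lt_of_le (norm_nonneg (A u)) with h0 | hu
  · rw [← h0, norm_eq_zero.1 h0.symm]; simp
  rcases eq_or_lt_of_le (norm_nonneg (A v)) with h0 | hv
  · rw [LinearPMap.inner_apply_comm hA, ← h0, norm_eq_zero.1 h0.symm]; simp
  have h := pol (‖A v‖ • u) (‖A u‖ • v)
  rw [A.map_smul, A.map_smul] at h
  simp only [Submodule.coe_smul, real_inner_smul_left, real_inner_smul_right, norm_smul,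
    norm_norm] at h
  have hpos : 0 < ‖A u‖ * ‖A v‖ := mul_pos hu hv
  by_contra! hcon
  nlinarith

theorem mem_closure_range (hA : IsSelfAdjoint A) {f : H}
    (hf : ∀ u : A.domain, A u = 0 → ⟪(u : H), f⟫_ℝ = 0) :
    f ∈ closure (LinearMap.range A.toFun : Set H) := by
  rw [← Submodule.topologicalClosure_coe, ← Submodule.orthogonal_orthogonal_eq_closure,
    SetLike.mem_coe, Submodule.mem_orthogonal]
  intro z hz
  rw [Submodule.mem_orthogonal'] at hz
  have hz' : ∀ x : A.domain, ⟪z, A x⟫_ℝ = 0 := fun x => hz _ ⟨x, rfl⟩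
  have hzd : z ∈ A.adjoint.domain :=
    LinearPMap.mem_adjoint_domain_of_exists z ⟨0, fun x => by rw [hz', inner_zero_left]⟩
  have hz0 : A.adjoint ⟨z, hzd⟩ = 0 :=
    LinearPMap.adjoint_apply_eq hA.dense_domain ⟨z, hzd⟩ fun x => by
      rw [hz', inner_zero_left]
  have hgr : (z, (0 : H)) ∈ A.graph := by
    rw [← LinearPMap.isSelfAdjoint_def.1 hA, LinearPMap.mem_graph_iff]
    exact ⟨⟨z, hzd⟩, rfl, hz0⟩
  obtain ⟨y, hy1, hy2⟩ := (LinearPMap.mem_graph_iff _).1 hgr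
  simp only at hy1 hy2
  rw [← hy1]
  exact hf y hy2

/-- If zero is isolated in the spectrum of the self-adjoint operator `A` and `ker A` is spanned by
`φ`, then the range of `A` is the orthogonal complement of `φ`. -/
theorem exists_apply_eq_of_isolated (hA : IsSelfAdjoint A) {δ : ℝ} (hδ : 0 < δ)
    (hres : ∀ mu : ℝ, 0 < |mu| → |mu| < δ → ∃ R : H →L[ℝ] H,
      (∀ f : H, ∃ h : R f ∈ A.domain, mu • R f - A ⟨R f, h⟩ = f) ∧
      ∀ u : A.domain, R (mu • (u : H) - A u) = u)
    (φ : A.domain) (hφ : A φ = 0) (hker : ∀ u : A.domain, A u = 0 → ∃ c : ℝ, (u : H) = c • φ)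
    {f : H} (hf : ⟪(φ : H), f⟫_ℝ = 0) :
    ∃ u : A.domain, A u = f ∧ ⟪(φ : H), u⟫_ℝ = 0 := by
  have horth : ∀ {g : H}, ⟪(φ : H), g⟫_ℝ = 0 → ∀ u : A.domain, A u = 0 → ⟪(u : H), g⟫_ℝ = 0 := by
    intro g hg u hu
    obtain ⟨c, hc⟩ := hker u hu
    rw [hc, real_inner_smul_left, hg, mul_zero]
  have hq := mul_abs_inner_apply_le hA hδ hres
  -- on the orthogonal complement of the kernel, `A` is bounded below
  have below : ∀ v : A.domain, ⟪(φ : H), (v : H)⟫_ℝ = 0 → δ * ‖(v : H)‖ ≤ ‖A v‖ := by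
    intro v hv
    have hmem := mem_closure_range hA (horth hv)
    have hcl : closure (LinearMap.range A.toFun : Set H) ⊆
        {z | δ * ⟪z, (v : H)⟫_ℝ ≤ ‖z‖ * ‖A v‖} := by
      refine closure_minimal ?_ ?_
      · rintro _ ⟨u, rfl⟩
        exact mul_inner_apply_le hA hδ hq u v
      · exact isClosed_le (by fun_prop) (by fun_prop)
    have := hcl hmem
    simp only [mem_ofPred_eq, real_inner_self_eq_norm_sq] at this
    rcases eq_or_lt_of_le (norm_nonneg (v : H)) with h0 | h0
    · rw [← h0, mul_zero]; exact norm_nonneg _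
    · by_contra! hcon
      nlinarith
  -- approximate `f` by `A u n` with `u n` orthogonal to `φ`; then `u n` is a Cauchy sequence
  obtain ⟨z, hz, hzf⟩ := mem_closure_iff_seq_limit.1 (mem_closure_range hA (horth hf))
  have hz' : ∀ n, ∃ u : A.domain, A u = z n ∧ ⟪(φ : H), (u : H)⟫_ℝ = 0 := by
    intro n
    obtain ⟨u, hu⟩ := hz n
    refine ⟨u - (⟪(φ : H), (u : H)⟫_ℝ / ⟪(φ : H), (φ : H)⟫_ℝ) • φ, ?_, ?_⟩
    · rw [A.map_sub, A.map_smul, hφ, smul_zero, sub_zero]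
      exact hu
    · simp only [Submodule.coe_sub, Submodule.coe_smul, inner_sub_right, real_inner_smul_right]
      by_cases h0 : (φ : H) = 0
      · simp [h0]
      · rw [div_mul_cancel₀ _ (inner_self_ne_zero.2 h0), sub_self]
  choose u hu1 hu2 using hz'
  have hcau : CauchySeq fun n => (u n : H) := by
    have hzc := hzf.cauchySeq
    rw [Metric.cauchySeq_iff'] at hzc ⊢
    intro ε hε
    obtain ⟨n, hn⟩ := hzc (δ * ε) (by positivity)
    refine ⟨n, fun m hm => ?_⟩
    have h1 := hn m hm
    have h2 := below (u m - u n) (by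
      simp only [Submodule.coe_sub, inner_sub_right, hu2, sub_zero])
    rw [A.map_sub, hu1, hu1, Submodule.coe_sub] at h2
    rw [dist_eq_norm] at h1 ⊢
    by_contra! hcon
    nlinarith
  obtain ⟨u₀, hu₀⟩ := cauchySeq_tendsto_of_complete hcau
  have hclosed : _root_.IsClosed (A.graph : Set (H × H)) := hA.isClosed
  have hmem : (u₀, f) ∈ A.graph := by
    refine hclosed.mem_of_tendsto (hu₀.prodMk_nhds hzf) (Filter.Eventually.of_forall fun n => ?_)
    rw [SetLike.mem_coe, LinearPMap.mem_graph_iff]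
    exact ⟨u n, rfl, hu1 n⟩
  obtain ⟨y, hy1, hy2⟩ := (LinearPMap.mem_graph_iff _).1 hmem
  simp only at hy1 hy2
  refine ⟨y, hy2, ?_⟩
  rw [hy1]
  refine tendsto_nhds_unique (tendsto_const_nhds.inner hu₀) ?_
  simp only [hu2]
  exact tendsto_const_nhds

end SpectralGap

noncomputable section
namespace TravelingWave

/-! ### The embedding of `H¹(ℝ)` into `L^∞(ℝ)` and pointwise products -/

theorem h1_integral_mul_deriv (φ : H1R) {η : ℝ → ℝ} (h1 : ContDiff ℝ ∞ η)
    (h2 : HasCompactSupport η) :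
    ∫ y, h1Val φ y * deriv η y = -∫ y, h1Der φ y * η y := φ.2 η h1 h2

/-- Pairing with a function which is bounded by `M` and lives on an interval of length two. The
constant is not the sharp `√2 M`. -/
theorem abs_integral_mul_le (u : L2R) {g : ℝ → ℝ} {x₀ M : ℝ} (hg : MemLp g 2 (volume : Measure ℝ))
    (hM : ∀ y, |g y| ≤ M) (hsupp : ∀ y, y ∉ Icc (x₀ - 1) (x₀ + 1) → g y = 0) :
    |∫ y, u y * g y| ≤ 2 * M * ‖u‖ := by
  have hM0 : 0 ≤ M := (abs_nonneg _).trans (hM 0)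
  rw [integral_mul_eq_inner hg]
  have hn : ‖hg.toLp g‖ ≤ 2 * M := by
    have h1 : ‖hg.toLp g‖ ^ 2 ≤ (2 * M) ^ 2 := by
      rw [← real_inner_self_eq_norm_sq, ← integral_mul_eq_inner hg]
      calc ∫ y, (hg.toLp g) y * g y = ∫ y, g y * g y := by
            refine integral_congr_ae ?_
            filter_upwards [hg.coeFn_toLp] with y hy
            rw [hy]
        _ ≤ ∫ y, (Icc (x₀ - 1) (x₀ + 1)).indicator (fun _ => M ^ 2) y := by
            refine integral_mono (hg.integrable_mul hg) ?_ ?_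
            · exact (integrable_indicator_iff measurableSet_Icc).2
                (continuous_const.integrableOn_Icc)
            · intro y
              by_cases hy : y ∈ Icc (x₀ - 1) (x₀ + 1)
              · rw [indicator_of_mem hy]
                simp only
                nlinarith [sq_abs (g y), hM y, abs_nonneg (g y)]
              · rw [indicator_of_notMem hy]
                simp [hsupp y hy]
        _ = 2 * M ^ 2 := by
            rw [integral_indicator measurableSet_Icc, setIntegral_const]
            simp [Measure.real]
            left; norm_num
        _ ≤ (2 * M) ^ 2 := by nlinarith [sq_nonneg M]
    exact (sq_le_sq₀ (norm_nonneg _) (by positivity)).1 h1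
  calc |⟪hg.toLp g, u⟫_ℝ| ≤ ‖hg.toLp g‖ * ‖u‖ := abs_real_inner_le_norm _ _
    _ ≤ _ := by gcongr

/-- Two weighted averages of an `H¹` function over the same unit ball differ by at most a multiple
of the norm of its derivative, because the difference of the weights has a compactly supported
primitive. -/
theorem abs_average_sub_average_le (φ : H1R) {a b : ℝ → ℝ} {x₀ : ℝ}
    (ha : ContDiff ℝ ∞ a) (hb : ContDiff ℝ ∞ b) (ha0 : ∀ y, 0 ≤ a y) (hb0 : ∀ y, 0 ≤ b y)
    (ha1 : ∫ y, a y = 1) (hb1 : ∫ y, b y = 1)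
    (hsa : ∀ y, y ∉ Icc (x₀ - 1) (x₀ + 1) → a y = 0)
    (hsb : ∀ y, y ∉ Icc (x₀ - 1) (x₀ + 1) → b y = 0) :
    |∫ y, h1Val φ y * (a y - b y)| ≤ 4 * ‖h1Der φ‖ := by
  have hab : ContDiff ℝ ∞ (fun y => a y - b y) := ha.sub hb
  set η : ℝ → ℝ := fun y => ∫ t in (x₀ - 1)..y, (a t - b t) with hη
  have hd : ∀ y, HasDerivAt η (a y - b y) y := fun y =>
    (hab.continuous.integral_hasStrictDerivAt (x₀ - 1) y).hasDerivAt
  have hderiv : deriv η = fun y => a y - b y := funext fun y => (hd y).deriv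
  have hsm : ContDiff ℝ ∞ η := by
    rw [contDiff_infty_iff_deriv]
    exact ⟨fun y => (hd y).differentiableAt, hderiv ▸ hab⟩
  have hca : HasCompactSupport a := HasCompactSupport.intro isCompact_Icc hsa
  have hcb : HasCompactSupport b := HasCompactSupport.intro isCompact_Icc hsb
  have hia : Integrable a := ha.continuous.integrable_of_hasCompactSupport hca
  have hib : Integrable b := hb.continuous.integrable_of_hasCompactSupport hcb
  have hη0 : ∀ y, y ∉ Icc (x₀ - 1) (x₀ + 1) → η y = 0 := by
    intro y hy
    rw [mem_Icc, not_and_or, not_le, not_le] at hy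
    rcases hy with hy | hy
    · refine (intervalIntegral.integral_congr_uIoo (g := fun _ => (0 : ℝ)) ?_).trans (by simp)
      intro t ht
      have : t ∉ Icc (x₀ - 1) (x₀ + 1) := by
        rw [uIoo_of_ge hy.le] at ht
        exact fun h => absurd h.1 (not_le.2 ht.2)
      simp [hsa t this, hsb t this]
    · have h1 : ∫ t, (a t - b t) = 0 := by
        rw [integral_sub hia hib, ha1, hb1, sub_self]
      have h2 : η y = ∫ t, (a t - b t) := by
        simp only [hη]
        rw [intervalIntegral.integral_of_le (by linarith), setIntegral_eq_integral_of_ae_compl_eq_zero]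
        have hz : ∀ᵐ t : ℝ, t ≠ x₀ - 1 := by simp [ae_iff, measure_singleton]
        filter_upwards [hz] with t htz ht
        have : t ∉ Icc (x₀ - 1) (x₀ + 1) := by
          intro h
          exact ht ⟨lt_of_le_of_ne h.1 (Ne.symm htz), h.2.trans hy.le⟩
        simp [hsa t this, hsb t this]
      rw [h2, h1]
  have hηM : ∀ y, |η y| ≤ 2 := by
    intro y
    by_cases hy : y ∈ Icc (x₀ - 1) (x₀ + 1)
    swap
    · simp [hη0 y hy]
    calc |η y| ≤ ∫ t in (x₀ - 1)..y, (a t + b t) := by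
          refine (intervalIntegral.abs_integral_le_integral_abs hy.1).trans ?_
          refine intervalIntegral.integral_mono_on hy.1 ?_ ?_ fun t _ => ?_
          · exact (hab.continuous.abs).intervalIntegrable _ _
          · exact (ha.continuous.add hb.continuous).intervalIntegrable _ _
          · rw [abs_le]
            constructor <;> linarith [ha0 t, hb0 t]
      _ ≤ ∫ t, (a t + b t) := by
          rw [intervalIntegral.integral_of_le hy.1]
          exact setIntegral_le_integral (hia.add hib)
            (Filter.Eventually.of_forall fun t => add_nonneg (ha0 t) (hb0 t))
      _ = 2 := by rw [integral_add hia hib, ha1, hb1]; norm_num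
  have hcη : HasCompactSupport η := HasCompactSupport.intro isCompact_Icc hη0
  have h := h1_integral_mul_deriv φ hsm hcη
  rw [hderiv] at h
  rw [h, abs_neg]
  have := abs_integral_mul_le (h1Der φ) (memLp_test hsm hcη) hηM hη0
  linarith

theorem norm_h1Val_le (φ : H1R) : ‖h1Val φ‖ ≤ ‖φ‖ := by
  have := WithLp.prod_norm_sq_eq_of_L2 (φ : WithLp 2 (L2R × L2R))
  refine (sq_le_sq₀ (norm_nonneg _) (norm_nonneg _)).1 ?_
  change ‖(φ : WithLp 2 (L2R × L2R)).fst‖ ^ 2 ≤ ‖(φ : WithLp 2 (L2R × L2R))‖ ^ 2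
  rw [this]
  nlinarith [sq_nonneg ‖(φ : WithLp 2 (L2R × L2R)).snd‖]

theorem norm_h1Der_le (φ : H1R) : ‖h1Der φ‖ ≤ ‖φ‖ := by
  have := WithLp.prod_norm_sq_eq_of_L2 (φ : WithLp 2 (L2R × L2R))
  refine (sq_le_sq₀ (norm_nonneg _) (norm_nonneg _)).1 ?_
  change ‖(φ : WithLp 2 (L2R × L2R)).snd‖ ^ 2 ≤ ‖(φ : WithLp 2 (L2R × L2R))‖ ^ 2
  rw [this]
  nlinarith [sq_nonneg ‖(φ : WithLp 2 (L2R × L2R)).fst‖]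

theorem norm_h1_le (φ : H1R) : ‖φ‖ ≤ ‖h1Val φ‖ + ‖h1Der φ‖ := by
  have := WithLp.prod_norm_sq_eq_of_L2 (φ : WithLp 2 (L2R × L2R))
  refine (sq_le_sq₀ (norm_nonneg _) (by positivity)).1 ?_
  change ‖(φ : WithLp 2 (L2R × L2R))‖ ^ 2 ≤
    (‖(φ : WithLp 2 (L2R × L2R)).fst‖ + ‖(φ : WithLp 2 (L2R × L2R)).snd‖) ^ 2
  rw [this]
  nlinarith [norm_nonneg (φ : WithLp 2 (L2R × L2R)).fst,
    norm_nonneg (φ : WithLp 2 (L2R × L2R)).snd]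

/-- One-dimensional Sobolev embedding. Almost every value of `φ` is a limit of averages over
shrinking balls, and these are compared with the average over the unit ball. -/
theorem exists_ae_abs_h1Val_le : ∃ C : ℝ, ∀ φ : H1R, ∀ᵐ x, ‖h1Val φ x‖ ≤ C * ‖φ‖ := by
  -- a fixed average at unit scale, to compare with averages at small scales
  let θ : ContDiffBump (0 : ℝ) := ⟨1 / 2, 1, by norm_num, by norm_num⟩
  obtain ⟨M, hM⟩ : ∃ M, ∀ y, ‖θ.normed volume y‖ ≤ M :=
    θ.hasCompactSupport_normed.exists_bound_of_continuous θ.continuous_normed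
  refine ⟨2 * M + 4, fun φ => ?_⟩
  let ρ : ℕ → ContDiffBump (0 : ℝ) := fun n =>
    ⟨1 / (2 * (n + 1)), 1 / (n + 1), by positivity, by gcongr; linarith⟩
  have hρ : Filter.Tendsto (fun n => (ρ n).rOut) Filter.atTop (nhds 0) :=
    tendsto_one_div_add_atTop_nhds_zero_nat
  have hconv := ContDiffBump.ae_convolution_tendsto_right_of_locallyIntegrable
    (μ := (volume : Measure ℝ)) (K := 2) hρ
    (Filter.Eventually.of_forall fun n => by
      change (1 : ℝ) / (n + 1) ≤ 2 * (1 / (2 * (n + 1)))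
      apply le_of_eq
      field_simp)
    ((Lp.memLp (h1Val φ)).locallyIntegrable (by norm_num))
  filter_upwards [hconv] with x hx
  refine le_of_tendsto hx.norm (Filter.Eventually.of_forall fun n => ?_)
  have bump : ∀ (β : ContDiffBump (0 : ℝ)), β.rOut ≤ 1 →
      (ContDiff ℝ ∞ fun y => β.normed volume (x - y)) ∧ (∀ y, 0 ≤ β.normed volume (x - y)) ∧
      (∫ y, β.normed volume (x - y) = 1) ∧
      ∀ y, y ∉ Icc (x - 1) (x + 1) → β.normed volume (x - y) = 0 := by
    intro β hβ
    refine ⟨β.contDiff_normed.comp (contDiff_const.sub contDiff_id),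
      fun y => β.nonneg_normed _, ?_, fun y hy => ?_⟩
    · rw [integral_sub_left_eq_self (fun y => β.normed volume y)]
      exact β.integral_normed
    · have : x - y ∉ Function.support (β.normed volume) := by
        rw [β.support_normed_eq]
        intro h
        rw [Metric.mem_ball, dist_zero_right, Real.norm_eq_abs, abs_lt] at h
        exact hy ⟨by linarith, by linarith⟩
      simpa using this
  have hn1 : (ρ n).rOut ≤ 1 := by
    change (1 : ℝ) / (n + 1) ≤ 1
    rw [div_le_one (by positivity)]
    linarith [(Nat.cast_nonneg n : (0 : ℝ) ≤ n)]
  obtain ⟨a1, a2, a3, a4⟩ := bump (ρ n) hn1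
  obtain ⟨b1, b2, b3, b4⟩ := bump θ le_rfl
  have ca := HasCompactSupport.intro isCompact_Icc a4
  have cb := HasCompactSupport.intro isCompact_Icc b4
  have h1 := abs_average_sub_average_le φ a1 b1 a2 b2 a3 b3 a4 b4
  have h2 := abs_integral_mul_le (h1Val φ) (memLp_test b1 cb) (fun y => hM (x - y)) b4
  have e : (MeasureTheory.convolution ((ρ n).normed volume) (h1Val φ)
      (ContinuousLinearMap.lsmul ℝ ℝ) volume) x =
      (∫ y, h1Val φ y * ((ρ n).normed volume (x - y) - θ.normed volume (x - y))) +
        ∫ y, h1Val φ y * θ.normed volume (x - y) := by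
    rw [convolution_eq_swap, ← integral_add]
    · refine integral_congr_ae (Filter.Eventually.of_forall fun y => ?_)
      simp only [ContinuousLinearMap.lsmul_apply, smul_eq_mul]
      ring
    · exact (Lp.memLp (h1Val φ)).integrable_mul ((memLp_test a1 ca).sub (memLp_test b1 cb))
    · exact (Lp.memLp (h1Val φ)).integrable_mul (memLp_test b1 cb)
  rw [e, Real.norm_eq_abs]
  have hM0 : 0 ≤ M := (norm_nonneg _).trans (hM 0)
  calc _ ≤ _ := abs_add_le _ _
    _ ≤ 4 * ‖h1Der φ‖ + 2 * M * ‖h1Val φ‖ := add_le_add h1 h2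
    _ ≤ 4 * ‖φ‖ + 2 * M * ‖φ‖ := by
        gcongr
        · exact norm_h1Der_le φ
        · exact norm_h1Val_le φ
    _ = _ := by ring

section BoundedLift

variable {α X E : Type*} [MeasurableSpace α] {μ : Measure α} [NormedAddCommGroup X]
  [NormedSpace ℝ X] [NormedAddCommGroup E] [NormedSpace ℝ E]

/-- A bounded linear map into `L²` whose values are pointwise bounded by a multiple of the norm
takes values in `L^∞`, boundedly. -/
theorem exists_linfty_lift (T : X →L[ℝ] Lp E 2 μ) {C : ℝ}
    (hT : ∀ u, ∀ᵐ x ∂μ, ‖T u x‖ ≤ C * ‖u‖) :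
    ∃ S : X →L[ℝ] Lp E ∞ μ, ∀ u, S u =ᵐ[μ] T u := by
  have hmem : ∀ u, MemLp (T u) ∞ μ := fun u =>
    memLp_top_of_bound (Lp.aestronglyMeasurable _) (C * ‖u‖) (hT u)
  let S₀ : X →ₗ[ℝ] Lp E ∞ μ :=
    { toFun := fun u => (hmem u).toLp (T u)
      map_add' := by
        intro u v
        rw [← MemLp.toLp_add]
        refine MemLp.toLp_congr _ _ ?_
        rw [map_add]
        exact Lp.coeFn_add _ _
      map_smul' := by
        intro c u
        rw [RingHom.id_apply, ← MemLp.toLp_const_smul]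
        refine MemLp.toLp_congr _ _ ?_
        rw [map_smul]
        exact Lp.coeFn_smul _ _ }
  refine ⟨S₀.mkContinuous (max C 0) fun u => ?_, fun u => (hmem u).coeFn_toLp⟩
  change ‖(hmem u).toLp (T u)‖ ≤ _
  rw [Lp.norm_toLp, eLpNorm_exponent_top]
  refine ENNReal.toReal_le_of_le_ofReal (by positivity) ?_
  refine eLpNormEssSup_le_of_ae_bound ?_
  filter_upwards [hT u] with x hx
  exact hx.trans (by gcongr; exact le_max_left _ _)

end BoundedLift

/-- The Sobolev embedding `H¹(ℝ) → L^∞(ℝ)`. -/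
def h1Linf : H1R →L[ℝ] LinfR :=
  (exists_linfty_lift h1Val exists_ae_abs_h1Val_le.choose_spec).choose

theorem h1Linf_ae (φ : H1R) : h1Linf φ =ᵐ[volume] h1Val φ :=
  (exists_linfty_lift h1Val exists_ae_abs_h1Val_le.choose_spec).choose_spec φ

/-- Multiplication of `L²(ℝ)` functions by bounded functions. -/
def linfMul : LinfR →L[ℝ] L2R →L[ℝ] L2R :=
  (ContinuousLinearMap.mul ℝ ℝ).holderL volume ∞ 2 2

theorem linfMul_ae (V : LinfR) (u : L2R) : linfMul V u =ᵐ[volume] fun y => V y * u y :=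
  (ContinuousLinearMap.mul ℝ ℝ).coeFn_holder V u

theorem smul_eq_linfMul (V : LinfR) (u : L2R) : (V • u : L2R) = linfMul V u := by
  refine Lp.ext ?_
  filter_upwards [linfMul_ae V u, Lp.coeFn_lpSMul (r := 2) V u] with y h1 h2
  rw [h1, h2]
  rfl

/-- The pointwise product of an `H¹(ℝ)` and an `L²(ℝ)` function. -/
def h1Mul : H1R →L[ℝ] L2R →L[ℝ] L2R := linfMul.comp h1Linf

theorem h1Mul_ae (φ : H1R) (u : L2R) : h1Mul φ u =ᵐ[volume] fun y => h1Val φ y * u y := by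
  filter_upwards [linfMul_ae (h1Linf φ) u, h1Linf_ae φ] with y h1 h2
  rw [← h2]
  exact h1

theorem h1Mul_h1Val_comm (φ ψ : H1R) : h1Mul φ (h1Val ψ) = h1Mul ψ (h1Val φ) := by
  refine Lp.ext ?_
  filter_upwards [h1Mul_ae φ (h1Val ψ), h1Mul_ae ψ (h1Val φ)] with y h1 h2
  rw [h1, h2, mul_comm]

theorem h1Mul_left_comm (φ ψ : H1R) (u : L2R) : h1Mul φ (h1Mul ψ u) = h1Mul ψ (h1Mul φ u) := by
  refine Lp.ext ?_
  filter_upwards [h1Mul_ae φ (h1Mul ψ u), h1Mul_ae ψ (h1Mul φ u), h1Mul_ae φ u,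
    h1Mul_ae ψ u] with y h1 h2 h3 h4
  rw [h1, h2, h3, h4]
  ring

/-! ### Harmonics on the torus -/

theorem memLp_muT_of_continuous {E : Type*} [NormedAddCommGroup E] {f : ℝ → E} (hf : Continuous f)
    (p : ℝ≥0∞) : MemLp f p muT := by
  obtain ⟨C, hC⟩ := (isCompact_Icc (a := (0 : ℝ)) (b := 2 * Real.pi)).exists_bound_of_continuousOn
    hf.continuousOn
  refine MemLp.of_bound hf.aestronglyMeasurable C ?_
  unfold muT
  filter_upwards [ae_restrict_mem measurableSet_Ioc] with x hx
  exact hC x (Ioc_subset_Icc_self hx)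

theorem integrable_muT_of_continuous {E : Type*} [NormedAddCommGroup E] {f : ℝ → E}
    (hf : Continuous f) : Integrable f muT :=
  memLp_one_iff_integrable.1 (memLp_muT_of_continuous hf 1)

section Torus

variable {E : Type*} [NormedAddCommGroup E] [NormedSpace ℝ E]

theorem integral_muT_eq (f : ℝ → E) : ∫ x, f x ∂muT = ∫ x in (0)..(2 * Real.pi), f x := by
  rw [intervalIntegral.integral_of_le (by positivity), muT]

/-- The bounded operator `u ↦ ∫ g u` on `L²(𝕋; E)`. -/
def integralSmul [CompleteSpace E] (g : ℝ → ℝ) (hg : Continuous g) : L2T E →L[ℝ] E :=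
  (ContinuousLinearMap.lsmul ℝ ℝ).lpPairing muT 2 2 ((memLp_muT_of_continuous hg 2).toLp g)

theorem integralSmul_apply [CompleteSpace E] {g : ℝ → ℝ} (hg : Continuous g) (u : L2T E) :
    integralSmul g hg u = ∫ x, g x • u x ∂muT := by
  rw [integralSmul, ContinuousLinearMap.lpPairing_eq_integral]
  refine integral_congr_ae ?_
  filter_upwards [(memLp_muT_of_continuous hg 2).coeFn_toLp] with x hx
  rw [hx]
  rfl

/-- The function `x ↦ g(x) a`, as a bounded operator in `a`. -/
def waveMul (g : ℝ → ℝ) (hg : Continuous g) : E →L[ℝ] L2T E :=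
  ((ContinuousLinearMap.lsmul ℝ ℝ).holderL muT 2 ∞ 2
    ((memLp_muT_of_continuous hg 2).toLp g)).comp (Lp.constL ∞ muT ℝ)

theorem waveMul_ae {g : ℝ → ℝ} (hg : Continuous g) (a : E) :
    waveMul g hg a =ᵐ[muT] fun x => g x • a := by
  filter_upwards [(ContinuousLinearMap.lsmul ℝ ℝ).coeFn_holder (r := 2)
    ((memLp_muT_of_continuous hg 2).toLp g) (Lp.constL ∞ muT ℝ a),
    (memLp_muT_of_continuous hg 2).coeFn_toLp, Lp.coeFn_const ∞ muT a] with x h1 h2 h3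
  refine h1.trans ?_
  rw [h2, ContinuousLinearMap.lsmul_apply]
  congr 1

theorem integralSmul_waveMul [CompleteSpace E] {g h : ℝ → ℝ} (hg : Continuous g)
    (hh : Continuous h) (a : E) :
    integralSmul g hg (waveMul h hh a) = (∫ x, g x * h x ∂muT) • a := by
  rw [integralSmul_apply, ← integral_smul_const]
  refine integral_congr_ae ?_
  filter_upwards [waveMul_ae hh a] with x hx
  rw [hx, smul_smul]

theorem compLp_waveMul {F : Type*} [NormedAddCommGroup F] [NormedSpace ℝ F] (L : E →L[ℝ] F)
    {g : ℝ → ℝ} (hg : Continuous g) (a : E) :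
    L.compLpL 2 muT (waveMul g hg a) = waveMul g hg (L a) := by
  refine Lp.ext ?_
  filter_upwards [L.coeFn_compLpL (p := 2) (waveMul g hg a), waveMul_ae hg a,
    waveMul_ae hg (L a)] with x h1 h2 h3
  rw [h1, h2, h3, map_smul]

theorem continuous_sin_mul (r : ℝ) : Continuous fun x : ℝ => Real.sin (r * x) := by fun_prop

theorem continuous_cos_mul (r : ℝ) : Continuous fun x : ℝ => Real.cos (r * x) := by fun_prop

/-- The function `x ↦ sin(r x) a`. -/
def sinMul (r : ℝ) : E →L[ℝ] L2T E := waveMul _ (continuous_sin_mul r)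

/-- The function `x ↦ cos(r x) a`. -/
def cosMul (r : ℝ) : E →L[ℝ] L2T E := waveMul _ (continuous_cos_mul r)

theorem sinMul_ae (r : ℝ) (a : E) : sinMul r a =ᵐ[muT] fun x => Real.sin (r * x) • a :=
  waveMul_ae _ a

theorem cosMul_ae (r : ℝ) (a : E) : cosMul r a =ᵐ[muT] fun x => Real.cos (r * x) • a :=
  waveMul_ae _ a

theorem integral_cos_int (n : ℤ) :
    ∫ x, Real.cos (n * x) ∂muT = if n = 0 then 2 * Real.pi else 0 := by
  rw [integral_muT_eq]
  split_ifs with h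
  · simp [h]
  · have hn : (n : ℝ) ≠ 0 := by exact_mod_cast h
    rw [intervalIntegral.integral_comp_mul_left (fun x => Real.cos x) hn, integral_cos]
    have : Real.sin (n * (2 * Real.pi)) = 0 := by
      have := Real.sin_int_mul_pi (2 * n)
      push_cast at this
      rw [← this]
      ring_nf
    simp [this]

theorem integral_sin_mul_sin {j k : ℕ} (hj : 1 ≤ j) :
    ∫ x, Real.sin (j * x) * Real.sin (k * x) ∂muT = if j = k then Real.pi else 0 := by
  have e : ∀ x : ℝ, Real.sin (j * x) * Real.sin (k * x) =
      (1 / 2) * (Real.cos (((j - k : ℤ) : ℝ) * x) - Real.cos (((j + k : ℤ) : ℝ) * x)) := by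
    intro x
    push_cast
    rw [sub_mul, add_mul, Real.cos_sub, Real.cos_add]
    ring
  simp only [e]
  rw [integral_const_mul, integral_sub, integral_cos_int, integral_cos_int]
  · have h2 : ((j : ℤ) + k ≠ 0) := by omega
    by_cases h : j = k
    · subst h
      simp [h2]
    · have h1 : ((j : ℤ) - k ≠ 0) := by omega
      simp [h, h1, h2]
  · exact integrable_muT_of_continuous (continuous_cos_mul _)
  · exact integrable_muT_of_continuous (continuous_cos_mul _)

theorem integral_cos_mul_cos {j k : ℕ} (hj : 1 ≤ j) :
    ∫ x, Real.cos (j * x) * Real.cos (k * x) ∂muT = if j = k then Real.pi else 0 := by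
  have e : ∀ x : ℝ, Real.cos (j * x) * Real.cos (k * x) =
      (1 / 2) * (Real.cos (((j - k : ℤ) : ℝ) * x) + Real.cos (((j + k : ℤ) : ℝ) * x)) := by
    intro x
    push_cast
    rw [sub_mul, add_mul, Real.cos_sub, Real.cos_add]
    ring
  simp only [e]
  rw [integral_const_mul, integral_add, integral_cos_int, integral_cos_int]
  · have h2 : ((j : ℤ) + k ≠ 0) := by omega
    by_cases h : j = k
    · subst h
      simp [h2]
    · have h1 : ((j : ℤ) - k ≠ 0) := by omega
      simp [h, h1, h2]
  · exact integrable_muT_of_continuous (continuous_cos_mul _)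
  · exact integrable_muT_of_continuous (continuous_cos_mul _)

/-- Integration by parts on the torus. -/
theorem integral_deriv_smul_eq [CompleteSpace E] {η : ℝ → ℝ} (h1 : ContDiff ℝ ∞ η)
    (h2 : Function.Periodic η (2 * Real.pi)) {f f' : ℝ → E} (hf : ∀ x, HasDerivAt f (f' x) x)
    (hf' : Continuous f') (hp : Function.Periodic f (2 * Real.pi)) :
    ∫ x, deriv η x • f x ∂muT = -∫ x, η x • f' x ∂muT := by
  have hη' := h1.continuous_deriv (by simp)
  have hfc : Continuous f := continuous_iff_continuousAt.2 fun x => (hf x).continuousAt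
  rw [eq_neg_iff_add_eq_zero]
  refine (integral_add (integrable_muT_of_continuous (hη'.smul hfc))
    (integrable_muT_of_continuous (h1.continuous.smul hf'))).symm.trans ?_
  simp only [Pi.smul_apply']
  rw [integral_muT_eq]
  have hd : ∀ x, HasDerivAt (fun x => η x • f x) (deriv η x • f x + η x • f' x) x := by
    intro x
    rw [add_comm]
    exact ((h1.differentiable (by simp) x).hasDerivAt).smul (hf x)
  rw [intervalIntegral.integral_eq_sub_of_hasDerivAt (fun x _ => hd x)
    (Continuous.intervalIntegrable (by fun_prop) _ _)]
  have e1 := h2 0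
  have e2 := hp 0
  rw [zero_add] at e1 e2
  rw [e1, e2, sub_self]

theorem isWeakDerivT_of_hasDerivAt [CompleteSpace E] {u v : L2T E} {f f' : ℝ → E}
    (hu : u =ᵐ[muT] f) (hv : v =ᵐ[muT] f') (hf : ∀ x, HasDerivAt f (f' x) x)
    (hf' : Continuous f') (hp : Function.Periodic f (2 * Real.pi)) : IsWeakDerivT u v := by
  intro η h1 h2
  have := integral_deriv_smul_eq h1 h2 hf hf' hp
  rw [integral_congr_ae (g := fun x => deriv η x • f x), this,
    integral_congr_ae (g := fun x => η x • v x)]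
  · filter_upwards [hv] with x hx
    rw [hx]
  · filter_upwards [hu] with x hx
    rw [hx]

theorem isWeakDeriv2T_of_hasDerivAt [CompleteSpace E] {u w : L2T E} {f f' f'' : ℝ → E}
    (hu : u =ᵐ[muT] f) (hw : w =ᵐ[muT] f'') (hf : ∀ x, HasDerivAt f (f' x) x)
    (hf' : ∀ x, HasDerivAt f' (f'' x) x) (hf'' : Continuous f'')
    (hp : Function.Periodic f (2 * Real.pi)) (hp' : Function.Periodic f' (2 * Real.pi)) :
    IsWeakDeriv2T u w := by
  intro η h1 h2
  have h1' : ContDiff ℝ ∞ (deriv η) := (contDiff_infty_iff_deriv.1 h1).2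
  have h2' : Function.Periodic (deriv η) (2 * Real.pi) := by
    intro x
    rw [← deriv_comp_add_const]
    congr 1
    exact funext h2
  have hfc' : Continuous f' := continuous_iff_continuousAt.2 fun x => (hf' x).continuousAt
  have e1 := integral_deriv_smul_eq h1' h2' hf hfc' hp
  have e2 := integral_deriv_smul_eq h1 h2 hf' hf'' hp'
  rw [e2, neg_neg] at e1
  rw [integral_congr_ae (g := fun x => deriv (deriv η) x • f x), e1,
    integral_congr_ae (g := fun x => η x • w x)]
  · filter_upwards [hw] with x hx
    rw [hx]
  · filter_upwards [hu] with x hx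
    rw [hx, iteratedDeriv_succ, iteratedDeriv_one]

/-- The `k`-th sine coefficient `∫ sin(kx) f(x) dx`, without the normalizing factor `1/π`. -/
def sinCoeff [CompleteSpace E] (k : ℝ) : L2T E →L[ℝ] E := integralSmul _ (continuous_sin_mul k)

theorem sinCoeff_sinMul [CompleteSpace E] {j k : ℕ} (hj : 1 ≤ j) (a : E) :
    sinCoeff (j : ℝ) (sinMul (k : ℝ) a) = if j = k then Real.pi • a else 0 := by
  rw [sinCoeff, sinMul, integralSmul_waveMul, integral_sin_mul_sin hj]
  split_ifs <;> simp

theorem compLp_sinCoeff {F : Type*} [NormedAddCommGroup F] [NormedSpace ℝ F] [CompleteSpace E]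
    [CompleteSpace F] (L : E →L[ℝ] F) (k : ℝ) (u : L2T E) :
    sinCoeff k (L.compLpL 2 muT u) = L (sinCoeff k u) := by
  rw [sinCoeff, sinCoeff, integralSmul_apply, integralSmul_apply,
    ← L.integral_comp_comm (integrable_smul_of_continuous (continuous_sin_mul k) u)]
  refine integral_congr_ae ?_
  filter_upwards [L.coeFn_compLpL (p := 2) u] with x hx
  rw [hx, map_smul]

end Torus

section Orthogonality

variable {E : Type*} [NormedAddCommGroup E] [InnerProductSpace ℝ E] [CompleteSpace E]

theorem inner_waveMul (f : L2T E) {g : ℝ → ℝ} (hg : Continuous g) (a : E) :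
    ⟪f, waveMul g hg a⟫_ℝ = ⟪integralSmul g hg f, a⟫_ℝ := by
  rw [L2.inner_def, integralSmul_apply, real_inner_comm a,
    ← integral_inner (integrable_smul_of_continuous hg f)]
  refine integral_congr_ae ?_
  filter_upwards [waveMul_ae hg a] with x hx
  rw [hx, real_inner_smul_right, real_inner_smul_right, real_inner_comm]

theorem inner_sinMul_sinMul {j k : ℕ} (hj : 1 ≤ j) (a b : E) :
    ⟪sinMul (j : ℝ) a, sinMul (k : ℝ) b⟫_ℝ = if j = k then Real.pi * ⟪a, b⟫_ℝ else 0 := by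
  rw [sinMul, sinMul, inner_waveMul, integralSmul_waveMul, real_inner_smul_left]
  simp only [mul_comm (Real.sin (k * _))]
  rw [integral_sin_mul_sin hj]
  split_ifs <;> simp

theorem inner_cosMul_cosMul {j k : ℕ} (hj : 1 ≤ j) (a b : E) :
    ⟪cosMul (j : ℝ) a, cosMul (k : ℝ) b⟫_ℝ = if j = k then Real.pi * ⟪a, b⟫_ℝ else 0 := by
  rw [cosMul, cosMul, inner_waveMul, integralSmul_waveMul, real_inner_smul_left]
  simp only [mul_comm (Real.cos (k * _))]
  rw [integral_cos_mul_cos hj]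
  split_ifs <;> simp

theorem inner_sinMul (f : L2T E) (k : ℝ) (a : E) : ⟪f, sinMul k a⟫_ℝ = ⟪sinCoeff k f, a⟫_ℝ :=
  inner_waveMul _ _ _

end Orthogonality

section Orthogonal

variable {X : Type*} [NormedAddCommGroup X] [InnerProductSpace ℝ X]

theorem norm_sum_sq_of_inner_eq_zero {v : ℕ → X} (hv : ∀ i j, i ≠ j → ⟪v i, v j⟫_ℝ = 0)
    (s : Finset ℕ) : ‖∑ i ∈ s, v i‖ ^ 2 = ∑ i ∈ s, ‖v i‖ ^ 2 := by
  rw [← real_inner_self_eq_norm_sq, sum_inner]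
  refine Finset.sum_congr rfl fun i hi => ?_
  rw [inner_sum, Finset.sum_eq_single i (fun j _ hj => hv i j hj.symm) (fun h => absurd hi h),
    real_inner_self_eq_norm_sq]

theorem summable_of_inner_eq_zero [CompleteSpace X] {v : ℕ → X}
    (hv : ∀ i j, i ≠ j → ⟪v i, v j⟫_ℝ = 0) (hs : Summable fun i => ‖v i‖ ^ 2) : Summable v := by
  rw [summable_iff_vanishing_norm] at hs ⊢
  intro ε hε
  obtain ⟨s, hs⟩ := hs (ε ^ 2) (by positivity)
  refine ⟨s, fun t ht => ?_⟩
  have := hs t ht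
  rw [← norm_sum_sq_of_inner_eq_zero hv, Real.norm_eq_abs, abs_of_nonneg (by positivity)] at this
  exact lt_of_pow_lt_pow_left₀ 2 hε.le this

end Orthogonal

section Bessel

variable {E : Type*} [NormedAddCommGroup E] [InnerProductSpace ℝ E] [CompleteSpace E]

theorem norm_sinMul_sq {k : ℕ} (hk : 1 ≤ k) (a : E) :
    ‖sinMul (k : ℝ) a‖ ^ 2 = Real.pi * ‖a‖ ^ 2 := by
  rw [← real_inner_self_eq_norm_sq, inner_sinMul_sinMul hk, if_pos rfl, real_inner_self_eq_norm_sq]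

theorem norm_cosMul_sq {k : ℕ} (hk : 1 ≤ k) (a : E) :
    ‖cosMul (k : ℝ) a‖ ^ 2 = Real.pi * ‖a‖ ^ 2 := by
  rw [← real_inner_self_eq_norm_sq, inner_cosMul_cosMul hk, if_pos rfl, real_inner_self_eq_norm_sq]

theorem summable_sinMul {a : ℕ → E} (ha : Summable fun k => ‖a k‖ ^ 2) :
    Summable fun k : ℕ => sinMul ((k + 1 : ℕ) : ℝ) (a k) := by
  refine summable_of_inner_eq_zero (fun i j hij => ?_) ?_
  · rw [inner_sinMul_sinMul (by omega), if_neg (by omega)]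
  · simp only [norm_sinMul_sq (Nat.le_add_left 1 _)]
    exact ha.mul_left _

theorem summable_cosMul {a : ℕ → E} (ha : Summable fun k => ‖a k‖ ^ 2) :
    Summable fun k : ℕ => cosMul ((k + 1 : ℕ) : ℝ) (a k) := by
  refine summable_of_inner_eq_zero (fun i j hij => ?_) ?_
  · rw [inner_cosMul_cosMul (by omega), if_neg (by omega)]
  · simp only [norm_cosMul_sq (Nat.le_add_left 1 _)]
    exact ha.mul_left _

/-- Bessel's inequality, qualitatively. -/
theorem summable_norm_sinCoeff_sq (f : L2T E) :
    Summable fun k : ℕ => ‖sinCoeff ((k + 1 : ℕ) : ℝ) f‖ ^ 2 := by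
  refine summable_of_sum_le (c := Real.pi * ‖f‖ ^ 2) (fun k => by positivity) fun s => ?_
  set v : ℕ → L2T E := fun k => sinMul ((k + 1 : ℕ) : ℝ) (sinCoeff ((k + 1 : ℕ) : ℝ) f) with hv
  have h1 : ‖∑ k ∈ s, v k‖ ^ 2 = Real.pi * ∑ k ∈ s, ‖sinCoeff ((k + 1 : ℕ) : ℝ) f‖ ^ 2 := by
    rw [norm_sum_sq_of_inner_eq_zero, Finset.mul_sum]
    · exact Finset.sum_congr rfl fun k _ => norm_sinMul_sq (by omega) _
    · intro i j hij
      simp only [hv]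
      rw [inner_sinMul_sinMul (by omega), if_neg (by omega)]
  have h2 : ⟪f, ∑ k ∈ s, v k⟫_ℝ = ∑ k ∈ s, ‖sinCoeff ((k + 1 : ℕ) : ℝ) f‖ ^ 2 := by
    rw [inner_sum]
    refine Finset.sum_congr rfl fun k _ => ?_
    simp only [hv]
    rw [inner_sinMul, real_inner_self_eq_norm_sq]
  set S := ∑ k ∈ s, ‖sinCoeff ((k + 1 : ℕ) : ℝ) f‖ ^ 2
  have hS : 0 ≤ S := Finset.sum_nonneg fun _ _ => by positivity
  have h3 : S ^ 2 ≤ ‖f‖ ^ 2 * (Real.pi * S) := by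
    rw [← h1, ← mul_pow, ← h2]
    exact pow_le_pow_left₀ (h2 ▸ hS) (real_inner_le_norm _ _) 2
  by_contra! hcon
  have : 0 ≤ Real.pi * ‖f‖ ^ 2 := by positivity
  nlinarith

end Bessel

/-! ### Trigonometric polynomials -/

section TrigPoly

variable {E F G : Type*} [NormedAddCommGroup E] [NormedSpace ℝ E] [NormedAddCommGroup F]
  [NormedSpace ℝ F] [NormedAddCommGroup G] [NormedSpace ℝ G]

variable (E) in
/-- Finite sums `∑ sin(kx) a_k`. Negative frequencies are allowed, so that products need no case
distinction. -/
def sinPoly : Submodule ℝ (ℝ → E) :=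
  Submodule.span ℝ {f | ∃ (k : ℤ) (a : E), f = fun x => Real.sin (k * x) • a}

variable (E) in
/-- Finite sums `∑ cos(kx) a_k`. -/
def cosPoly : Submodule ℝ (ℝ → E) :=
  Submodule.span ℝ {f | ∃ (k : ℤ) (a : E), f = fun x => Real.cos (k * x) • a}

theorem sin_smul_mem (k : ℤ) (a : E) : (fun x : ℝ => Real.sin (k * x) • a) ∈ sinPoly E :=
  Submodule.subset_span ⟨k, a, rfl⟩

theorem cos_smul_mem (k : ℤ) (a : E) : (fun x : ℝ => Real.cos (k * x) • a) ∈ cosPoly E :=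
  Submodule.subset_span ⟨k, a, rfl⟩

theorem exists_hasDerivAt_of_mem_sinPoly {f : ℝ → E} (hf : f ∈ sinPoly E) :
    ∃ f' ∈ cosPoly E, ∀ x, HasDerivAt f (f' x) x := by
  induction hf using Submodule.span_induction with
  | mem f h =>
    obtain ⟨k, a, rfl⟩ := h
    refine ⟨_, cos_smul_mem k ((k : ℝ) • a), fun x => ?_⟩
    rw [smul_smul]
    refine HasDerivAt.smul_const ?_ a
    simpa using ((hasDerivAt_id x).const_mul (k : ℝ)).sin
  | zero => exact ⟨0, zero_mem _, fun x => hasDerivAt_const x 0⟩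
  | add f g _ _ hf hg =>
    obtain ⟨f', h1, h2⟩ := hf
    obtain ⟨g', h3, h4⟩ := hg
    exact ⟨f' + g', add_mem h1 h3, fun x => (h2 x).add (h4 x)⟩
  | smul c f _ hf =>
    obtain ⟨f', h1, h2⟩ := hf
    exact ⟨c • f', Submodule.smul_mem _ _ h1, fun x => (h2 x).const_smul c⟩

theorem continuous_of_mem_cosPoly {f : ℝ → E} (hf : f ∈ cosPoly E) : Continuous f := by
  induction hf using Submodule.span_induction with
  | mem f h =>
    obtain ⟨k, a, rfl⟩ := h
    fun_prop
  | zero => exact continuous_const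
  | add f g _ _ hf hg => exact hf.add hg
  | smul c f _ hf => exact hf.const_smul c

theorem continuous_of_mem_sinPoly {f : ℝ → E} (hf : f ∈ sinPoly E) : Continuous f := by
  obtain ⟨f', -, h⟩ := exists_hasDerivAt_of_mem_sinPoly hf
  exact continuous_iff_continuousAt.2 fun x => (h x).continuousAt

theorem periodic_of_mem_sinPoly {f : ℝ → E} (hf : f ∈ sinPoly E) :
    Function.Periodic f (2 * Real.pi) := by
  induction hf using Submodule.span_induction with
  | mem f h =>
    obtain ⟨k, a, rfl⟩ := h
    intro x
    simp only [mul_add, Real.sin_add_int_mul_two_pi]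
  | zero => intro x; rfl
  | add f g _ _ hf hg => exact hf.add hg
  | smul c f _ hf => exact fun x => congrArg (c • ·) (hf x)

theorem periodic_of_mem_cosPoly {f : ℝ → E} (hf : f ∈ cosPoly E) :
    Function.Periodic f (2 * Real.pi) := by
  induction hf using Submodule.span_induction with
  | mem f h =>
    obtain ⟨k, a, rfl⟩ := h
    intro x
    simp only [mul_add, Real.cos_add_int_mul_two_pi]
  | zero => intro x; rfl
  | add f g _ _ hf hg => exact hf.add hg
  | smul c f _ hf => exact fun x => congrArg (c • ·) (hf x)

theorem comp_mem_sinPoly (L : E →L[ℝ] F) {f : ℝ → E} (hf : f ∈ sinPoly E) :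
    (fun x => L (f x)) ∈ sinPoly F := by
  induction hf using Submodule.span_induction with
  | mem f h =>
    obtain ⟨k, a, rfl⟩ := h
    simpa using sin_smul_mem k (L a)
  | zero => simp only [Pi.zero_apply, map_zero]; exact zero_mem (sinPoly F)
  | add f g _ _ hf hg => simp only [Pi.add_apply, map_add]; exact add_mem hf hg
  | smul c f _ hf => simp only [Pi.smul_apply, map_smul]; exact Submodule.smul_mem _ c hf

theorem comp_mem_cosPoly (L : E →L[ℝ] F) {f : ℝ → E} (hf : f ∈ cosPoly E) :
    (fun x => L (f x)) ∈ cosPoly F := by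
  induction hf using Submodule.span_induction with
  | mem f h =>
    obtain ⟨k, a, rfl⟩ := h
    simpa using cos_smul_mem k (L a)
  | zero => simp only [Pi.zero_apply, map_zero]; exact zero_mem (cosPoly F)
  | add f g _ _ hf hg => simp only [Pi.add_apply, map_add]; exact add_mem hf hg
  | smul c f _ hf => simp only [Pi.smul_apply, map_smul]; exact Submodule.smul_mem _ c hf

/-- To check that a bilinear expression lands in a submodule, it suffices to check generators. -/
theorem bilin_mem_of_span {s : Set (ℝ → E)} {t : Set (ℝ → F)} {P : Submodule ℝ (ℝ → G)}
    (B : E →L[ℝ] F →L[ℝ] G) (h : ∀ f ∈ s, ∀ g ∈ t, (fun x => B (f x) (g x)) ∈ P)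
    {f : ℝ → E} {g : ℝ → F} (hf : f ∈ Submodule.span ℝ s) (hg : g ∈ Submodule.span ℝ t) :
    (fun x => B (f x) (g x)) ∈ P := by
  induction hf using Submodule.span_induction with
  | mem f hf =>
    induction hg using Submodule.span_induction with
    | mem g hg => exact h f hf g hg
    | zero => simp only [Pi.zero_apply, map_zero]; exact zero_mem P
    | add f g _ _ hf hg => simp only [Pi.add_apply, map_add]; exact add_mem hf hg
    | smul c f _ hf => simp only [Pi.smul_apply, map_smul]; exact Submodule.smul_mem _ c hf
  | zero => simp only [Pi.zero_apply, map_zero, zero_apply]; exact zero_mem P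
  | add f g _ _ hf hg => simp only [Pi.add_apply, map_add, add_apply]; exact add_mem hf hg
  | smul c f _ hf => simp only [Pi.smul_apply, map_smul, smul_apply]; exact Submodule.smul_mem _ c hf

theorem bilin_sin_sin (B : E →L[ℝ] F →L[ℝ] G) {f : ℝ → E} {g : ℝ → F} (hf : f ∈ sinPoly E)
    (hg : g ∈ sinPoly F) : (fun x => B (f x) (g x)) ∈ cosPoly G := by
  refine bilin_mem_of_span B ?_ hf hg
  rintro _ ⟨j, a, rfl⟩ _ ⟨k, b, rfl⟩
  have := sub_mem (cos_smul_mem (j - k) ((1 / 2 : ℝ) • B a b))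
    (cos_smul_mem (j + k) ((1 / 2 : ℝ) • B a b))
  convert this using 1
  funext x
  simp only [map_smul, smul_apply, Pi.sub_apply, smul_smul, ← sub_smul]
  congr 1
  push_cast
  rw [sub_mul, add_mul, Real.cos_sub, Real.cos_add]
  ring

theorem bilin_cos_cos (B : E →L[ℝ] F →L[ℝ] G) {f : ℝ → E} {g : ℝ → F} (hf : f ∈ cosPoly E)
    (hg : g ∈ cosPoly F) : (fun x => B (f x) (g x)) ∈ cosPoly G := by
  refine bilin_mem_of_span B ?_ hf hg
  rintro _ ⟨j, a, rfl⟩ _ ⟨k, b, rfl⟩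
  have := add_mem (cos_smul_mem (j - k) ((1 / 2 : ℝ) • B a b))
    (cos_smul_mem (j + k) ((1 / 2 : ℝ) • B a b))
  convert this using 1
  funext x
  simp only [map_smul, smul_apply, Pi.add_apply, smul_smul, ← add_smul]
  congr 1
  push_cast
  rw [sub_mul, add_mul, Real.cos_sub, Real.cos_add]
  ring

theorem bilin_sin_cos (B : E →L[ℝ] F →L[ℝ] G) {f : ℝ → E} {g : ℝ → F} (hf : f ∈ sinPoly E)
    (hg : g ∈ cosPoly F) : (fun x => B (f x) (g x)) ∈ sinPoly G := by
  refine bilin_mem_of_span B ?_ hf hg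
  rintro _ ⟨j, a, rfl⟩ _ ⟨k, b, rfl⟩
  have := add_mem (sin_smul_mem (j + k) ((1 / 2 : ℝ) • B a b))
    (sin_smul_mem (j - k) ((1 / 2 : ℝ) • B a b))
  convert this using 1
  funext x
  simp only [map_smul, smul_apply, Pi.add_apply, smul_smul, ← add_smul]
  congr 1
  push_cast
  rw [sub_mul, add_mul, Real.sin_sub, Real.sin_add]
  ring

variable (E) in
/-- The closed span in `L²(𝕋; E)` of the functions `sin(kx) a`, `k ≥ 1`. -/
def sinL2 : Submodule ℝ (L2T E) :=
  (Submodule.span ℝ {u | ∃ (k : ℕ) (a : E), u = sinMul ((k + 1 : ℕ) : ℝ) a}).topologicalClosure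

theorem sinMul_mem_sinL2 (k : ℤ) (a : E) : sinMul (k : ℝ) a ∈ sinL2 E := by
  have hpos : ∀ (n : ℕ) (a : E), sinMul ((n + 1 : ℕ) : ℝ) a ∈ sinL2 E := fun n a =>
    Submodule.le_topologicalClosure _ (Submodule.subset_span ⟨n, a, rfl⟩)
  rcases lt_trichotomy k 0 with h | h | h
  · obtain ⟨n, rfl⟩ : ∃ n : ℕ, k = -((n + 1 : ℕ) : ℤ) := ⟨(-k - 1).toNat, by omega⟩
    have e : sinMul ((-((n + 1 : ℕ) : ℤ) : ℤ) : ℝ) a = -sinMul ((n + 1 : ℕ) : ℝ) a := by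
      refine Lp.ext ?_
      filter_upwards [sinMul_ae ((-((n + 1 : ℕ) : ℤ) : ℤ) : ℝ) a, sinMul_ae ((n + 1 : ℕ) : ℝ) a,
        Lp.coeFn_neg (sinMul ((n + 1 : ℕ) : ℝ) a)] with x h1 h2 h3
      rw [h1, h3, Pi.neg_apply, h2, ← neg_smul, ← Real.sin_neg]
      push_cast
      ring_nf
    rw [e]
    exact neg_mem (hpos n a)
  · have e : sinMul (k : ℝ) a = 0 := by
      refine Lp.ext ?_
      filter_upwards [sinMul_ae (k : ℝ) a, Lp.coeFn_zero E 2 muT] with x h1 h3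
      rw [h1, h3, h]
      simp
    rw [e]
    exact zero_mem _
  · obtain ⟨n, rfl⟩ : ∃ n : ℕ, k = ((n + 1 : ℕ) : ℤ) := ⟨(k - 1).toNat, by omega⟩
    exact hpos n a

theorem mem_sinL2_of_ae_eq {u : L2T E} {f : ℝ → E} (hf : f ∈ sinPoly E) (hu : u =ᵐ[muT] f) :
    u ∈ sinL2 E := by
  suffices h : ∃ v ∈ sinL2 E, v =ᵐ[muT] f by
    obtain ⟨v, hv, hvf⟩ := h
    rwa [Lp.ext (hu.trans hvf.symm)]
  clear hu
  induction hf using Submodule.span_induction with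
  | mem f h =>
    obtain ⟨k, a, rfl⟩ := h
    exact ⟨_, sinMul_mem_sinL2 k a, sinMul_ae _ _⟩
  | zero => exact ⟨0, zero_mem _, Lp.coeFn_zero _ _ _⟩
  | add f g _ _ hf hg =>
    obtain ⟨v, h1, h2⟩ := hf
    obtain ⟨w, h3, h4⟩ := hg
    exact ⟨v + w, add_mem h1 h3, (Lp.coeFn_add v w).trans (h2.add h4)⟩
  | smul c f _ hf =>
    obtain ⟨v, h1, h2⟩ := hf
    exact ⟨c • v, Submodule.smul_mem _ _ h1, (Lp.coeFn_smul c v).trans (h2.const_smul c)⟩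

theorem isClosed_sinL2 : IsClosed (sinL2 E : Set (L2T E)) :=
  Submodule.isClosed_topologicalClosure _

/-- Continuous linear conditions on `sinL2` need only be checked on single harmonics. -/
theorem sinL2_eqOn {S T : L2T E →L[ℝ] F} (h : ∀ (k : ℕ) (a : E),
    S (sinMul ((k + 1 : ℕ) : ℝ) a) = T (sinMul ((k + 1 : ℕ) : ℝ) a)) {u : L2T E}
    (hu : u ∈ sinL2 E) : S u = T u := by
  have hle : sinL2 E ≤ LinearMap.eqLocus (S : L2T E →ₗ[ℝ] F) (T : L2T E →ₗ[ℝ] F) := by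
    refine Submodule.topologicalClosure_minimal _ (Submodule.span_le.2 ?_) ?_
    · rintro _ ⟨k, a, rfl⟩
      exact h k a
    · exact isClosed_eq S.continuous T.continuous
  exact hle hu

theorem compLp_mem_sinL2 (L : E →L[ℝ] F) {u : L2T E} (hu : u ∈ sinL2 E) :
    L.compLpL 2 muT u ∈ sinL2 F := by
  have hle : sinL2 E ≤ (sinL2 F).comap (L.compLpL 2 muT : L2T E →ₗ[ℝ] L2T F) := by
    refine Submodule.topologicalClosure_minimal _ (Submodule.span_le.2 ?_) ?_
    · rintro _ ⟨k, a, rfl⟩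
      change L.compLpL 2 muT (sinMul _ a) ∈ sinL2 F
      rw [sinMul, compLp_waveMul]
      exact_mod_cast sinMul_mem_sinL2 ((k + 1 : ℕ) : ℤ) (L a)
    · exact isClosed_sinL2.preimage (L.compLpL 2 muT).continuous
  exact hle hu

end TrigPoly

/-! ### Sine waves in the solution space -/

section SupBound

variable {E : Type*} [NormedAddCommGroup E]

theorem integral_norm_le (u : L2T E) : ∫ x, ‖u x‖ ∂muT ≤ √(2 * Real.pi) * ‖u‖ := by
  have h1 : ∫ x, ‖u x‖ ∂muT = (eLpNorm u 1 muT).toReal := by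
    rw [eLpNorm_one_eq_lintegral_enorm,
      integral_norm_eq_lintegral_enorm (Lp.aestronglyMeasurable u)]
  have h2 := eLpNorm_le_eLpNorm_mul_rpow_measure_univ (μ := muT) (p := 1) (q := 2) (by norm_num)
    (Lp.aestronglyMeasurable u)
  have h3 : muT univ = ENNReal.ofReal (2 * Real.pi) := by
    simp [muT]
  rw [h1, Lp.norm_def, Real.sqrt_eq_rpow]
  refine (ENNReal.toReal_mono (ENNReal.mul_ne_top (Lp.eLpNorm_ne_top u)
    (ENNReal.rpow_ne_top_of_nonneg (by norm_num) (measure_ne_top _ _))) h2).trans_eq ?_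
  rw [ENNReal.toReal_mul, h3, mul_comm, ← ENNReal.toReal_rpow,
    ENNReal.toReal_ofReal (by positivity)]
  norm_num

theorem ae_norm_le_of_tendsto {u : ℕ → L2T E} {v : L2T E} {c : ℕ → ℝ} {d : ℝ}
    (hu : Filter.Tendsto u Filter.atTop (nhds v)) (hc : Filter.Tendsto c Filter.atTop (nhds d))
    (h : ∀ n, ∀ᵐ x ∂muT, ‖u n x‖ ≤ c n) : ∀ᵐ x ∂muT, ‖v x‖ ≤ d := by
  obtain ⟨ns, hns, hlim⟩ := (tendstoInMeasure_of_tendsto_Lp hu).exists_seq_tendsto_ae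
  filter_upwards [hlim, ae_all_iff.2 h] with x h1 h2
  exact le_of_tendsto_of_tendsto' h1.norm (hc.comp hns.tendsto_atTop) fun n => h2 (ns n)

variable [NormedSpace ℝ E]

/-- One-dimensional Sobolev inequality on the torus, for functions of class `C¹`. -/
theorem ae_norm_le_of_hasDerivAt [CompleteSpace E] {u v : L2T E} {f f' : ℝ → E}
    (hu : u =ᵐ[muT] f) (hv : v =ᵐ[muT] f') (hf : ∀ x, HasDerivAt f (f' x) x)
    (hf' : Continuous f') :
    ∀ᵐ x ∂muT, ‖u x‖ ≤ √(2 * Real.pi) * ‖u‖ + √(2 * Real.pi) * ‖v‖ := by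
  have hfc : Continuous f := continuous_iff_continuousAt.2 fun x => (hf x).continuousAt
  have hm : ∀ᵐ x ∂muT, x ∈ Ioc 0 (2 * Real.pi) := ae_restrict_mem measurableSet_Ioc
  have e1 : ∫ x, ‖f x‖ ∂muT ≤ √(2 * Real.pi) * ‖u‖ := by
    refine (integral_congr_ae ?_).trans_le (integral_norm_le u)
    filter_upwards [hu] with x hx
    rw [hx]
  have e2 : ∫ x, ‖f' x‖ ∂muT ≤ √(2 * Real.pi) * ‖v‖ := by
    refine (integral_congr_ae ?_).trans_le (integral_norm_le v)
    filter_upwards [hv] with x hx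
    rw [hx]
  have hi' : Integrable f' muT := integrable_muT_of_continuous hf'
  have key : ∀ x ∈ Ioc 0 (2 * Real.pi), ∀ y ∈ Ioc 0 (2 * Real.pi),
      ‖f x‖ ≤ ‖f y‖ + √(2 * Real.pi) * ‖v‖ := by
    intro x hx y hy
    have h1 : f x - f y = ∫ t in y..x, f' t :=
      (intervalIntegral.integral_eq_sub_of_hasDerivAt (fun t _ => hf t)
        (hf'.intervalIntegrable _ _)).symm
    have h2 : ‖f x - f y‖ ≤ ∫ t, ‖f' t‖ ∂muT := by
      rw [h1]
      refine (intervalIntegral.norm_integral_le_integral_norm_uIoc).trans ?_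
      refine setIntegral_mono_set hi'.norm (Filter.Eventually.of_forall fun t => norm_nonneg _) ?_
      refine LE.le.eventuallyLE fun t ht => ?_
      rw [uIoc, mem_Ioc] at ht
      exact ⟨(le_min hy.1.le hx.1.le).trans_lt ht.1, ht.2.trans (max_le hy.2 hx.2)⟩
    have h3 := norm_add_le (f x - f y) (f y)
    rw [sub_add_cancel] at h3
    linarith
  filter_upwards [hu, hm] with x hx hxm
  rw [hx]
  have hmass : muT.real univ = 2 * Real.pi := by
    simp [muT, Measure.real, Real.pi_pos.le]
  have h4 : ∫ _, ‖f x‖ ∂muT ≤ ∫ y, (‖f y‖ + √(2 * Real.pi) * ‖v‖) ∂muT := by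
    refine integral_mono_ae (integrable_const _)
      ((integrable_muT_of_continuous hfc).norm.add (integrable_const _)) ?_
    filter_upwards [hm] with y hy
    exact key x hxm y hy
  rw [integral_add (integrable_muT_of_continuous hfc).norm (integrable_const _), integral_const,
    integral_const, hmass, smul_eq_mul, smul_eq_mul] at h4
  have hπ : 1 ≤ 2 * Real.pi := by linarith [Real.pi_gt_three]
  have h5 : 0 ≤ √(2 * Real.pi) * ‖u‖ := by positivity
  by_contra! hcon
  nlinarith

end SupBound

section Closed

variable {E : Type*} [NormedAddCommGroup E] [NormedSpace ℝ E] [CompleteSpace E]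

theorem isWeakDerivT_iff (u v : L2T E) : IsWeakDerivT u v ↔
    ∀ (η : ℝ → ℝ) (h1 : ContDiff ℝ ∞ η), Function.Periodic η (2 * Real.pi) →
      integralSmul (deriv η) (h1.continuous_deriv (by simp)) u =
        -integralSmul η h1.continuous v := by
  simp only [integralSmul_apply]
  rfl

theorem isClosed_isWeakDerivT : IsClosed {p : L2T E × L2T E | IsWeakDerivT p.1 p.2} := by
  simp only [isWeakDerivT_iff, ofPred_forall]
  refine isClosed_iInter fun η => isClosed_iInter fun h1 => isClosed_iInter fun _ =>
    isClosed_eq ?_ ?_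
  · exact (integralSmul _ _).continuous.comp continuous_fst
  · exact ((integralSmul _ _).continuous.comp continuous_snd).neg

theorem isClosed_isWeakDeriv2T : IsClosed {p : L2T E × L2T E | IsWeakDeriv2T p.1 p.2} := by
  have : ∀ u w : L2T E, IsWeakDeriv2T u w ↔
    ∀ (η : ℝ → ℝ) (h1 : ContDiff ℝ ∞ η), Function.Periodic η (2 * Real.pi) →
      integralSmul (iteratedDeriv 2 η) ((contDiff_infty.1 h1 2).continuous_iteratedDeriv 2 le_rfl) u =
        integralSmul η h1.continuous w := by
    intro u w
    simp only [integralSmul_apply]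
    rfl
  simp only [this, ofPred_forall]
  refine isClosed_iInter fun η => isClosed_iInter fun h1 => isClosed_iInter fun _ =>
    isClosed_eq ?_ ?_
  · exact (integralSmul _ _).continuous.comp continuous_fst
  · exact (integralSmul _ _).continuous.comp continuous_snd

end Closed

theorem isClosed_waveSpace : IsClosed (WaveSpace : Set (L2T H1R × L2T H1R × L2T L2R)) := by
  refine IsClosed.inter (s₁ := {p : L2T H1R × L2T H1R × L2T L2R | IsWeakDerivT p.1 p.2.1})
    (s₂ := {p | IsWeakDerivT (l2tVal p.2.1) p.2.2}) ?_ ?_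
  · exact isClosed_isWeakDerivT.preimage
      (f := fun p : L2T H1R × L2T H1R × L2T L2R => (p.1, p.2.1)) (by fun_prop)
  · exact isClosed_isWeakDerivT.preimage
      (f := fun p : L2T H1R × L2T H1R × L2T L2R => (l2tVal p.2.1, p.2.2)) (by fun_prop)

instance : CompleteSpace WaveSpace := isClosed_waveSpace.completeSpace_coe

/-- `Φ ↦ Φ` as a bounded operator. -/
def valL : WaveSpace →L[ℝ] L2T H1R := (ContinuousLinearMap.fst ℝ _ _).comp WaveSpace.subtypeL

/-- `Φ ↦ Φ_x` as a bounded operator. -/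
def dxL : WaveSpace →L[ℝ] L2T H1R :=
  ((ContinuousLinearMap.fst ℝ _ _).comp (ContinuousLinearMap.snd ℝ _ _)).comp WaveSpace.subtypeL

/-- `Φ ↦ Φ_xx` as a bounded operator. -/
def dxxL : WaveSpace →L[ℝ] L2T L2R :=
  ((ContinuousLinearMap.snd ℝ _ _).comp (ContinuousLinearMap.snd ℝ _ _)).comp WaveSpace.subtypeL

theorem waveVal_eq (Φ : WaveSpace) : waveVal Φ = valL Φ := rfl

theorem norm_valL_le (Φ : WaveSpace) : ‖valL Φ‖ ≤ ‖Φ‖ := norm_fst_le _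

theorem norm_dxL_le (Φ : WaveSpace) : ‖dxL Φ‖ ≤ ‖Φ‖ :=
  (norm_fst_le (Φ : L2T H1R × L2T H1R × L2T L2R).2).trans (norm_snd_le _)

theorem norm_dxxL_le (Φ : WaveSpace) : ‖dxxL Φ‖ ≤ ‖Φ‖ :=
  (norm_snd_le (Φ : L2T H1R × L2T H1R × L2T L2R).2).trans (norm_snd_le _)

theorem l2tVal_ae (u : L2T H1R) : l2tVal u =ᵐ[muT] fun x => h1Val (u x) :=
  h1Val.coeFn_compLpL (p := 2) u

theorem sin_nat_smul_mem {E : Type*} [NormedAddCommGroup E] [NormedSpace ℝ E] (k : ℕ) (a : E) :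
    (fun x : ℝ => Real.sin (k * x) • a) ∈ sinPoly E := by
  exact_mod_cast sin_smul_mem (k : ℤ) a

theorem cos_nat_smul_mem {E : Type*} [NormedAddCommGroup E] [NormedSpace ℝ E] (k : ℕ) (a : E) :
    (fun x : ℝ => Real.cos (k * x) • a) ∈ cosPoly E := by
  exact_mod_cast cos_smul_mem (k : ℤ) a

theorem hasDerivAt_sin_smul {E : Type*} [NormedAddCommGroup E] [NormedSpace ℝ E] (k : ℝ) (a : E)
    (x : ℝ) : HasDerivAt (fun x : ℝ => Real.sin (k * x) • a) (Real.cos (k * x) • k • a) x := by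
  rw [smul_smul]
  refine HasDerivAt.smul_const ?_ a
  simpa using ((hasDerivAt_id x).const_mul k).sin

theorem hasDerivAt_cos_smul {E : Type*} [NormedAddCommGroup E] [NormedSpace ℝ E] (k : ℝ) (a : E)
    (x : ℝ) : HasDerivAt (fun x : ℝ => Real.cos (k * x) • a) (Real.sin (k * x) • -k • a) x := by
  rw [smul_smul]
  refine HasDerivAt.smul_const ?_ a
  simpa using ((hasDerivAt_id x).const_mul k).cos

theorem mode_mem (k : ℕ) (a : H1R) :
    ((sinMul (k : ℝ) a, cosMul (k : ℝ) ((k : ℝ) • a),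
      sinMul (k : ℝ) (-((k : ℝ) ^ 2) • h1Val a)) : L2T H1R × L2T H1R × L2T L2R) ∈ WaveSpace := by
  refine ⟨?_, ?_⟩
  · exact isWeakDerivT_of_hasDerivAt (sinMul_ae _ _) (cosMul_ae _ _)
      (fun x => hasDerivAt_sin_smul _ _ x) (by fun_prop)
      (periodic_of_mem_sinPoly (sin_nat_smul_mem k a))
  · refine isWeakDerivT_of_hasDerivAt (f := fun x => Real.cos (k * x) • ((k : ℝ) • h1Val a))
      ?_ (sinMul_ae _ _) (fun x => ?_) (by fun_prop)
      (periodic_of_mem_cosPoly (cos_nat_smul_mem k _))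
    · filter_upwards [l2tVal_ae (cosMul (k : ℝ) ((k : ℝ) • a)),
        cosMul_ae (k : ℝ) ((k : ℝ) • a)] with x h1 h2
      rw [h1, h2, map_smul, map_smul]
    · convert hasDerivAt_cos_smul (k : ℝ) ((k : ℝ) • h1Val a) x using 2
      rw [smul_smul]
      congr 1
      ring

/-- The wave `sin(kx) a(y)`, as a bounded operator in `a ∈ H¹(ℝ)`. -/
def mode (k : ℕ) : H1R →L[ℝ] WaveSpace :=
  ContinuousLinearMap.codRestrict
    ((sinMul (k : ℝ)).prod (((cosMul (k : ℝ)).comp ((k : ℝ) • ContinuousLinearMap.id ℝ H1R)).prod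
      ((sinMul (k : ℝ)).comp (-((k : ℝ) ^ 2) • h1Val)))) WaveSpace (mode_mem k)

theorem valL_mode (k : ℕ) (a : H1R) : valL (mode k a) = sinMul (k : ℝ) a := rfl

theorem dxL_mode (k : ℕ) (a : H1R) : dxL (mode k a) = cosMul (k : ℝ) ((k : ℝ) • a) := rfl

theorem dxxL_mode (k : ℕ) (a : H1R) :
    dxxL (mode k a) = sinMul (k : ℝ) (-((k : ℝ) ^ 2) • h1Val a) := rfl

theorem isSineMode_mode (k : ℕ) (a : H1R) : IsSineMode k (h1Val a) (mode k a) := by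
  unfold IsSineMode
  rw [waveVal_eq, valL_mode]
  filter_upwards [sinMul_ae (k : ℝ) a] with x hx
  rw [hx, map_smul]

/-- Finite sums of modes. -/
def modeSpan : Submodule ℝ WaveSpace :=
  Submodule.span ℝ {Φ | ∃ (k : ℕ) (a : H1R), Φ = mode (k + 1) a}

/-- The closed span of the modes `sin(kx) a(y)`, `k ≥ 1`, in the solution space. -/
def SineWaves : Submodule ℝ WaveSpace := modeSpan.topologicalClosure

instance : CompleteSpace SineWaves :=
  (Submodule.isClosed_topologicalClosure modeSpan).completeSpace_coe

theorem mode_mem_sineWaves {k : ℕ} (hk : 1 ≤ k) (a : H1R) : mode k a ∈ SineWaves := by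
  obtain ⟨n, rfl⟩ : ∃ n, k = n + 1 := ⟨k - 1, by omega⟩
  exact Submodule.le_topologicalClosure _ (Submodule.subset_span ⟨n, a, rfl⟩)

/-- Closed conditions on sine waves need only be checked on finite sums of modes. -/
theorem sineWaves_induction {P : SineWaves → Prop} (hP : IsClosed {Φ | P Φ})
    (h : ∀ Φ : SineWaves, (Φ : WaveSpace) ∈ modeSpan → P Φ) (Φ : SineWaves) : P Φ := by
  obtain ⟨s, hs, hlim⟩ := mem_closure_iff_seq_limit.1
    (show (Φ : WaveSpace) ∈ closure (modeSpan : Set WaveSpace) from Φ.2)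
  let t : ℕ → SineWaves := fun n => ⟨s n, Submodule.le_topologicalClosure _ (hs n)⟩
  have ht : Filter.Tendsto t Filter.atTop (nhds Φ) := tendsto_subtype_rng.2 hlim
  exact hP.mem_of_tendsto ht (Filter.Eventually.of_forall fun n => h (t n) (hs n))

/-- Finite sums of modes have smooth representatives `f`, with `x`-derivatives `f'` and `f''`. -/
theorem exists_smooth_of_mem_modeSpan {Φ : WaveSpace} (hΦ : Φ ∈ modeSpan) :
    ∃ f ∈ sinPoly H1R, ∃ f' ∈ cosPoly H1R, ∃ f'' ∈ sinPoly H1R,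
      (∀ x, HasDerivAt f (f' x) x) ∧ (∀ x, HasDerivAt f' (f'' x) x) ∧
      valL Φ =ᵐ[muT] f ∧ dxL Φ =ᵐ[muT] f' ∧ dxxL Φ =ᵐ[muT] fun x => h1Val (f'' x) := by
  induction hΦ using Submodule.span_induction with
  | mem Φ h =>
    obtain ⟨k, a, rfl⟩ := h
    refine ⟨_, sin_nat_smul_mem (k + 1) a, _,
      cos_nat_smul_mem (k + 1) (((k + 1 : ℕ) : ℝ) • a), _,
      sin_nat_smul_mem (k + 1) (-((k + 1 : ℕ) : ℝ) • ((k + 1 : ℕ) : ℝ) • a),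
      hasDerivAt_sin_smul _ _, hasDerivAt_cos_smul _ _, sinMul_ae _ _, cosMul_ae _ _, ?_⟩
    rw [dxxL_mode]
    filter_upwards [sinMul_ae ((k + 1 : ℕ) : ℝ) (-(((k + 1 : ℕ) : ℝ) ^ 2) • h1Val a)] with x hx
    rw [hx, map_smul, map_smul, map_smul]
    module
  | zero =>
    refine ⟨0, zero_mem _, 0, zero_mem _, 0, zero_mem _, fun x => hasDerivAt_const x 0,
      fun x => hasDerivAt_const x 0, ?_, ?_, ?_⟩
    · rw [map_zero]; exact Lp.coeFn_zero _ _ _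
    · rw [map_zero]; exact Lp.coeFn_zero _ _ _
    · rw [map_zero]
      filter_upwards [Lp.coeFn_zero L2R 2 muT] with x hx
      rw [hx]
      simp
  | add Φ Ψ _ _ hΦ hΨ =>
    obtain ⟨f, hf, f1, hf1, f2, hf2, d1, d2, e1, e2, e3⟩ := hΦ
    obtain ⟨g, hg, g1, hg1, g2, hg2, d1', d2', e1', e2', e3'⟩ := hΨ
    refine ⟨f + g, add_mem hf hg, f1 + g1, add_mem hf1 hg1, f2 + g2, add_mem hf2 hg2,
      fun x => (d1 x).add (d1' x), fun x => (d2 x).add (d2' x), ?_, ?_, ?_⟩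
    · rw [map_add]; exact (Lp.coeFn_add _ _).trans (e1.add e1')
    · rw [map_add]; exact (Lp.coeFn_add _ _).trans (e2.add e2')
    · rw [map_add]
      filter_upwards [Lp.coeFn_add (dxxL Φ) (dxxL Ψ), e3, e3'] with x h1 h2 h3
      rw [h1, Pi.add_apply, h2, h3, Pi.add_apply, map_add]
  | smul c Φ _ hΦ =>
    obtain ⟨f, hf, f1, hf1, f2, hf2, d1, d2, e1, e2, e3⟩ := hΦ
    refine ⟨c • f, Submodule.smul_mem _ _ hf, c • f1, Submodule.smul_mem _ _ hf1, c • f2,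
      Submodule.smul_mem _ _ hf2, fun x => (d1 x).const_smul c, fun x => (d2 x).const_smul c,
      ?_, ?_, ?_⟩
    · rw [map_smul]; exact (Lp.coeFn_smul _ _).trans (e1.const_smul c)
    · rw [map_smul]; exact (Lp.coeFn_smul _ _).trans (e2.const_smul c)
    · rw [map_smul]
      filter_upwards [Lp.coeFn_smul c (dxxL Φ), e3] with x h1 h2
      rw [h1, Pi.smul_apply, h2, Pi.smul_apply, map_smul]

/-- Sine waves are bounded functions of `x` with values in `H¹(ℝ)`. -/
theorem ae_norm_valL_le (Φ : SineWaves) :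
    ∀ᵐ x ∂muT, ‖valL (Φ : WaveSpace) x‖ ≤ 2 * √(2 * Real.pi) * ‖Φ‖ := by
  obtain ⟨s, hs, hlim⟩ := mem_closure_iff_seq_limit.1
    (show (Φ : WaveSpace) ∈ closure (modeSpan : Set WaveSpace) from Φ.2)
  refine ae_norm_le_of_tendsto ((valL.continuous.tendsto _).comp hlim)
    (hlim.norm.const_mul (2 * √(2 * Real.pi))) fun n => ?_
  obtain ⟨f, hf, f1, hf1, f2, hf2, d1, d2, e1, e2, e3⟩ := exists_smooth_of_mem_modeSpan (hs n)
  filter_upwards [ae_norm_le_of_hasDerivAt e1 e2 d1 (continuous_of_mem_cosPoly hf1)] with x hx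
  refine hx.trans ?_
  have h1 := mul_le_mul_of_nonneg_left (norm_valL_le (s n)) (Real.sqrt_nonneg (2 * Real.pi))
  have h2 := mul_le_mul_of_nonneg_left (norm_dxL_le (s n)) (Real.sqrt_nonneg (2 * Real.pi))
  linarith

/-- The `x`-derivatives of sine waves are bounded functions of `x` with values in `L²(ℝ)`. -/
theorem ae_norm_l2tVal_dxL_le (Φ : SineWaves) :
    ∀ᵐ x ∂muT, ‖l2tVal (dxL (Φ : WaveSpace)) x‖ ≤ 2 * √(2 * Real.pi) * ‖Φ‖ := by
  obtain ⟨s, hs, hlim⟩ := mem_closure_iff_seq_limit.1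
    (show (Φ : WaveSpace) ∈ closure (modeSpan : Set WaveSpace) from Φ.2)
  refine ae_norm_le_of_tendsto (((l2tVal.comp dxL).continuous.tendsto _).comp hlim)
    (hlim.norm.const_mul (2 * √(2 * Real.pi))) fun n => ?_
  obtain ⟨f, hf, f1, hf1, f2, hf2, d1, d2, e1, e2, e3⟩ := exists_smooth_of_mem_modeSpan (hs n)
  have e2' : l2tVal (dxL (s n)) =ᵐ[muT] fun x => h1Val (f1 x) := by
    filter_upwards [l2tVal_ae (dxL (s n)), e2] with x h1 h2
    rw [h1, h2]
  have hc := h1Val.continuous.comp (continuous_of_mem_sinPoly hf2)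
  filter_upwards [ae_norm_le_of_hasDerivAt e2' e3
    (fun x => h1Val.hasFDerivAt.comp_hasDerivAt x (d2 x)) hc] with x hx
  refine hx.trans ?_
  have hle : ‖l2tVal (dxL (s n))‖ ≤ ‖s n‖ := by
    refine le_trans ?_ (norm_dxL_le (s n))
    refine Lp.norm_le_norm_of_ae_le ?_
    filter_upwards [l2tVal_ae (dxL (s n))] with x hx
    rw [hx]
    exact norm_h1Val_le _
  have h1 := mul_le_mul_of_nonneg_left hle (Real.sqrt_nonneg (2 * Real.pi))
  have h2 := mul_le_mul_of_nonneg_left (norm_dxxL_le (s n)) (Real.sqrt_nonneg (2 * Real.pi))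
  linarith

/-! ### The cubic nonlinearity -/

/-- `Φ ↦ Φ` as a bounded operator on sine waves. -/
def valS : SineWaves →L[ℝ] L2T H1R := valL.comp SineWaves.subtypeL

/-- `Φ ↦ Φ_x` as a bounded operator on sine waves. -/
def dxS : SineWaves →L[ℝ] L2T H1R := dxL.comp SineWaves.subtypeL

/-- `Φ ↦ Φ_xx` as a bounded operator on sine waves. -/
def dxxS : SineWaves →L[ℝ] L2T L2R := dxxL.comp SineWaves.subtypeL

theorem valS_apply (Φ : SineWaves) : valS Φ = valL (Φ : WaveSpace) := rfl

theorem dxS_apply (Φ : SineWaves) : dxS Φ = dxL (Φ : WaveSpace) := rfl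

theorem dxxS_apply (Φ : SineWaves) : dxxS Φ = dxxL (Φ : WaveSpace) := rfl

theorem exists_valInf :
    ∃ S : SineWaves →L[ℝ] Lp H1R ∞ muT, ∀ Φ, S Φ =ᵐ[muT] valS Φ := by
  have h := exists_linfty_lift (E := H1R) (X := SineWaves) (μ := muT) valS
    (C := 2 * √(2 * Real.pi)) (fun Φ => by rw [valS_apply]; exact ae_norm_valL_le Φ)
  obtain ⟨S, hS⟩ := h
  exact ⟨S, fun Φ => hS Φ⟩

theorem exists_dxInf :
    ∃ S : SineWaves →L[ℝ] Lp L2R ∞ muT, ∀ Φ, S Φ =ᵐ[muT] l2tVal (dxS Φ) := by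
  have h := exists_linfty_lift (E := L2R) (X := SineWaves) (μ := muT) (l2tVal.comp dxS)
    (C := 2 * √(2 * Real.pi)) (fun Φ => ae_norm_l2tVal_dxL_le Φ)
  obtain ⟨S, hS⟩ := h
  exact ⟨S, fun Φ => hS Φ⟩

/-- `Φ ↦ Φ` as a bounded operator from sine waves to `L^∞(𝕋; H¹(ℝ))`. -/
def valInf : SineWaves →L[ℝ] Lp H1R ∞ muT := exists_valInf.choose

theorem valInf_ae (Φ : SineWaves) : valInf Φ =ᵐ[muT] valS Φ := exists_valInf.choose_spec Φ

/-- `Φ ↦ Φ_x` as a bounded operator from sine waves to `L^∞(𝕋; L²(ℝ))`. -/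
def dxInf : SineWaves →L[ℝ] Lp L2R ∞ muT := exists_dxInf.choose

theorem dxInf_ae (Φ : SineWaves) : dxInf Φ =ᵐ[muT] fun x => h1Val (dxS Φ x) :=
  (exists_dxInf.choose_spec Φ).trans (l2tVal_ae _)

/-- The product `L^∞(𝕋; H¹(ℝ)) × L²(𝕋; L²(ℝ)) → L²(𝕋; L²(ℝ))`. -/
def mulInfTwo : Lp H1R ∞ muT →L[ℝ] L2T L2R →L[ℝ] L2T L2R := h1Mul.holderL muT ∞ 2 2

/-- The product `L²(𝕋; H¹(ℝ)) × L^∞(𝕋; L²(ℝ)) → L²(𝕋; L²(ℝ))`. -/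
def mulTwoInf : L2T H1R →L[ℝ] Lp L2R ∞ muT →L[ℝ] L2T L2R := h1Mul.holderL muT 2 ∞ 2

section

variable {α H L X : Type*} [MeasurableSpace α] {μ : Measure α} [NormedAddCommGroup H]
  [NormedSpace ℝ H] [NormedAddCommGroup L] [NormedSpace ℝ L] [NormedAddCommGroup X]
  [NormedSpace ℝ X] (m : H →L[ℝ] L →L[ℝ] L) (ι : H →L[ℝ] L)

theorem holder_cube_ae {u : Lp H ∞ μ} {v : Lp H 2 μ} (h : u =ᵐ[μ] v) :
    m.holderL μ ∞ 2 2 u (m.holderL μ ∞ 2 2 u (ι.compLpL 2 μ v)) =ᵐ[μ]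
      fun x => m (v x) (m (v x) (ι (v x))) := by
  filter_upwards [m.coeFn_holder (r := 2) u (m.holder 2 u (ι.compLpL 2 μ v)),
    m.coeFn_holder (r := 2) u (ι.compLpL 2 μ v), ι.coeFn_compLpL (p := 2) v, h] with x h1 h2 h3 h4
  rw [← h4, h4, ← h3, ← h4, ← h2]
  exact h1

theorem holder_cubeDxx_ae {u : Lp H ∞ μ} {v v₁ : Lp H 2 μ} {v₂ : Lp L 2 μ} {u₁ : Lp L ∞ μ}
    (h : u =ᵐ[μ] v) (h' : u₁ =ᵐ[μ] fun x => ι (v₁ x)) (c d : ℝ) :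
    (c • m.holderL μ ∞ 2 2 u (m.holderL μ ∞ 2 2 u v₂) +
      d • m.holderL μ ∞ 2 2 u (m.holderL μ 2 ∞ 2 v₁ u₁) : Lp L 2 μ) =ᵐ[μ]
      fun x => c • m (v x) (m (v x) (v₂ x)) + d • m (v x) (m (v₁ x) (ι (v₁ x))) := by
  filter_upwards [Lp.coeFn_add (c • m.holderL μ ∞ 2 2 u (m.holderL μ ∞ 2 2 u v₂))
      (d • m.holderL μ ∞ 2 2 u (m.holderL μ 2 ∞ 2 v₁ u₁)),
    Lp.coeFn_smul c (m.holderL μ ∞ 2 2 u (m.holderL μ ∞ 2 2 u v₂)),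
    Lp.coeFn_smul d (m.holderL μ ∞ 2 2 u (m.holderL μ 2 ∞ 2 v₁ u₁)),
    m.coeFn_holder (r := 2) u (m.holder 2 u v₂), m.coeFn_holder (r := 2) u v₂,
    m.coeFn_holder (r := 2) u (m.holder 2 v₁ u₁), m.coeFn_holder (r := 2) v₁ u₁, h, h']
    with x h1 h2 h3 h4 h5 h6 h7 h8 h9
  rw [h1, Pi.add_apply, h2, h3, Pi.smul_apply, Pi.smul_apply, ← h8, ← h9, ← h5, ← h7]
  exact congrArg₂ (fun a b => c • a + d • b) h4 h6

theorem contDiff_holder_cube (u : X →L[ℝ] Lp H ∞ μ) (v : X →L[ℝ] Lp L 2 μ) :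
    ContDiff ℝ ω fun Φ => m.holderL μ ∞ 2 2 (u Φ) (m.holderL μ ∞ 2 2 (u Φ) (v Φ)) := by
  fun_prop

theorem contDiff_holder_cubeDxx (u : X →L[ℝ] Lp H ∞ μ) (v₁ : X →L[ℝ] Lp H 2 μ)
    (v₂ : X →L[ℝ] Lp L 2 μ) (u₁ : X →L[ℝ] Lp L ∞ μ) (c d : ℝ) :
    ContDiff ℝ ω fun Φ => c • m.holderL μ ∞ 2 2 (u Φ) (m.holderL μ ∞ 2 2 (u Φ) (v₂ Φ)) +
      d • m.holderL μ ∞ 2 2 (u Φ) (m.holderL μ 2 ∞ 2 (v₁ Φ) (u₁ Φ)) := by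
  fun_prop

end

/-- `Φ³`. -/
def cube (Φ : SineWaves) : L2T L2R :=
  mulInfTwo (valInf Φ) (mulInfTwo (valInf Φ) (l2tVal (valS Φ)))

/-- `(Φ³)_xx = 3 Φ² Φ_xx + 6 Φ Φ_x²`. In the second term one factor `Φ_x` is taken in
`L²(𝕋; H¹(ℝ))` and the other one in `L^∞(𝕋; L²(ℝ))`. -/
def cubeDxx (Φ : SineWaves) : L2T L2R :=
  (3 : ℝ) • mulInfTwo (valInf Φ) (mulInfTwo (valInf Φ) (dxxS Φ)) +
    (6 : ℝ) • mulInfTwo (valInf Φ) (mulTwoInf (dxS Φ) (dxInf Φ))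

theorem cube_ae (Φ : SineWaves) : cube Φ =ᵐ[muT] fun x =>
    h1Mul (valS Φ x) (h1Mul (valS Φ x) (h1Val (valS Φ x))) :=
  holder_cube_ae (H := H1R) (L := L2R) (μ := muT) h1Mul h1Val (valInf_ae Φ)

theorem cubeDxx_ae (Φ : SineWaves) : cubeDxx Φ =ᵐ[muT] fun x =>
    (3 : ℝ) • h1Mul (valS Φ x) (h1Mul (valS Φ x) (dxxS Φ x)) +
    (6 : ℝ) • h1Mul (valS Φ x) (h1Mul (dxS Φ x) (h1Val (dxS Φ x))) :=
  holder_cubeDxx_ae (H := H1R) (L := L2R) (μ := muT) h1Mul h1Val (valInf_ae Φ) (dxInf_ae Φ) 3 6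

theorem contDiff_cube : ContDiff ℝ ω cube := by
  have h := contDiff_holder_cube (X := SineWaves) (H := H1R) (L := L2R) (μ := muT) h1Mul valInf
    (l2tVal.comp valS)
  exact h

theorem contDiff_cubeDxx : ContDiff ℝ ω cubeDxx := by
  have h := contDiff_holder_cubeDxx (X := SineWaves) (H := H1R) (L := L2R) (μ := muT) h1Mul valInf
    dxS dxxS dxInf 3 6
  exact h

theorem cubeDxx_smul (c : ℝ) (Φ : SineWaves) : cubeDxx (c • Φ) = c ^ 3 • cubeDxx Φ := by
  simp only [cubeDxx, map_smul, smul_apply, smul_add, smul_smul]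
  congr 2 <;> ring

/-- Congruence for the right-hand side of `cubeDxx_ae` at a point. -/
theorem second_deriv_congr {a a' b b' : H1R} {c c' : L2R} (ha : a = a') (hb : b = b')
    (hc : c = c') :
    (3 : ℝ) • h1Mul a (h1Mul a c) + (6 : ℝ) • h1Mul a (h1Mul b (h1Val b)) =
      (3 : ℝ) • h1Mul a' (h1Mul a' c') + (6 : ℝ) • h1Mul a' (h1Mul b' (h1Val b')) := by
  subst ha hb hc
  rfl

/-- For trigonometric polynomials the formula for `(Φ³)_xx` is the classical product rule, and
parity in `x` is preserved by the products. -/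
theorem cube_of_mem_modeSpan {Φ : SineWaves} (hΦ : (Φ : WaveSpace) ∈ modeSpan) :
    IsWeakDeriv2T (cube Φ) (cubeDxx Φ) ∧ cubeDxx Φ ∈ sinL2 L2R := by
  obtain ⟨f, hf, f1, hf1, f2, hf2, d1, d2, e1, e2, e3⟩ := exists_smooth_of_mem_modeSpan hΦ
  rw [← valS_apply] at e1
  rw [← dxS_apply] at e2
  rw [← dxxS_apply] at e3
  have c0 : cube Φ =ᵐ[muT] fun x => h1Mul (f x) (h1Mul (f x) (h1Val (f x))) := by
    filter_upwards [cube_ae Φ, e1] with x h1 h2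
    exact h1.trans (congrArg (fun a => h1Mul a (h1Mul a (h1Val a))) h2)
  have c2 : cubeDxx Φ =ᵐ[muT] fun x => (3 : ℝ) • h1Mul (f x) (h1Mul (f x) (h1Val (f2 x))) +
      (6 : ℝ) • h1Mul (f x) (h1Mul (f1 x) (h1Val (f1 x))) := by
    filter_upwards [cubeDxx_ae Φ, e1, e2, e3] with x h1 h2 h3 h4
    exact h1.trans (second_deriv_congr h2 h3 h4)
  have v0 : ∀ x, HasDerivAt (fun x => h1Val (f x)) (h1Val (f1 x)) x := fun x =>
    h1Val.hasFDerivAt.comp_hasDerivAt x (d1 x)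
  have v1 : ∀ x, HasDerivAt (fun x => h1Val (f1 x)) (h1Val (f2 x)) x := fun x =>
    h1Val.hasFDerivAt.comp_hasDerivAt x (d2 x)
  have m0 : ∀ x, HasDerivAt (fun x => h1Mul (f x)) (h1Mul (f1 x)) x := fun x =>
    h1Mul.hasFDerivAt.comp_hasDerivAt x (d1 x)
  have D1 : ∀ x, HasDerivAt (fun x => h1Mul (f x) (h1Mul (f x) (h1Val (f x))))
      ((3 : ℝ) • h1Mul (f x) (h1Mul (f x) (h1Val (f1 x)))) x := by
    intro x
    refine ((m0 x).clm_apply ((m0 x).clm_apply (v0 x))).congr_deriv ?_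
    rw [h1Mul_left_comm (f1 x), h1Mul_h1Val_comm (f1 x), map_add]
    module
  have D2 : ∀ x, HasDerivAt (fun x => (3 : ℝ) • h1Mul (f x) (h1Mul (f x) (h1Val (f1 x))))
      ((3 : ℝ) • h1Mul (f x) (h1Mul (f x) (h1Val (f2 x))) +
        (6 : ℝ) • h1Mul (f x) (h1Mul (f1 x) (h1Val (f1 x)))) x := by
    intro x
    refine (((m0 x).clm_apply ((m0 x).clm_apply (v1 x))).const_smul (3 : ℝ)).congr_deriv ?_
    rw [h1Mul_left_comm (f1 x), map_add]
    module
  have pf := periodic_of_mem_sinPoly hf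
  have pf1 := periodic_of_mem_cosPoly hf1
  have mem : (fun x => (3 : ℝ) • h1Mul (f x) (h1Mul (f x) (h1Val (f2 x))) +
      (6 : ℝ) • h1Mul (f x) (h1Mul (f1 x) (h1Val (f1 x)))) ∈ sinPoly L2R := by
    refine add_mem (Submodule.smul_mem _ (3 : ℝ) ?_) (Submodule.smul_mem _ (6 : ℝ) ?_)
    · exact bilin_sin_cos h1Mul hf (bilin_sin_sin h1Mul hf (comp_mem_sinPoly h1Val hf2))
    · exact bilin_sin_cos h1Mul hf (bilin_cos_cos h1Mul hf1 (comp_mem_cosPoly h1Val hf1))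
  refine ⟨isWeakDeriv2T_of_hasDerivAt c0 c2 D1 D2 (continuous_of_mem_sinPoly mem) ?_ ?_,
    mem_sinL2_of_ae_eq mem c2⟩
  · intro x
    simp only [pf x]
  · intro x
    simp only [pf x, pf1 x]

theorem isWeakDeriv2T_cube (Φ : SineWaves) : IsWeakDeriv2T (cube Φ) (cubeDxx Φ) :=
  sineWaves_induction (P := fun Φ => IsWeakDeriv2T (cube Φ) (cubeDxx Φ))
    (isClosed_isWeakDeriv2T.preimage (f := fun Φ => (cube Φ, cubeDxx Φ))
      (contDiff_cube.continuous.prodMk contDiff_cubeDxx.continuous))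
    (fun _ h => (cube_of_mem_modeSpan h).1) Φ

theorem cubeDxx_mem_sinL2 (Φ : SineWaves) : cubeDxx Φ ∈ sinL2 L2R :=
  sineWaves_induction (P := fun Φ => cubeDxx Φ ∈ sinL2 L2R)
    (isClosed_sinL2.preimage contDiff_cubeDxx.continuous)
    (fun _ h => (cube_of_mem_modeSpan h).2) Φ

theorem dxxS_mem_sinL2 (Φ : SineWaves) : dxxS Φ ∈ sinL2 L2R := by
  refine sineWaves_induction (P := fun Φ => dxxS Φ ∈ sinL2 L2R)
    (isClosed_sinL2.preimage dxxS.continuous) (fun Φ h => ?_) Φ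
  obtain ⟨f, hf, f1, hf1, f2, hf2, d1, d2, e1, e2, e3⟩ := exists_smooth_of_mem_modeSpan h
  exact mem_sinL2_of_ae_eq (comp_mem_sinPoly h1Val hf2) e3

/-- Multiplication by a bounded function of `y`. -/
def potMul (V : LinfR) : L2T L2R →L[ℝ] L2T L2R := (linfMul V).compLpL 2 muT

theorem potMul_ae (V : LinfR) (u : L2T L2R) : potMul V u =ᵐ[muT] fun x => (V • u x : L2R) := by
  filter_upwards [(linfMul V).coeFn_compLpL (p := 2) u] with x hx
  rw [smul_eq_linfMul]
  exact hx

/-! ### Solving the linearized equation mode by mode -/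

theorem h1Val_injective : Function.Injective h1Val := by
  rw [injective_iff_map_eq_zero]
  intro φ h
  have hd : h1Der φ = 0 := by
    refine eq_zero_of_forall_test _ fun η k1 k2 => ?_
    have h' := h1_integral_mul_deriv φ k1 k2
    rw [integral_mul_eq_inner (memLp_deriv_test k1 k2), h, inner_zero_right] at h'
    linarith
  apply Subtype.ext
  apply WithLp.ofLp_injective
  exact Prod.ext h hd

section ClosedGraph

variable {X Y : Type*} [NormedAddCommGroup X] [NormedSpace ℝ X] [CompleteSpace X]
  [NormedAddCommGroup Y] [NormedSpace ℝ Y] [CompleteSpace Y]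

/-- A closed linear relation which is everywhere defined and single-valued is a bounded
operator. -/
theorem exists_clm_of_isClosed (G : Submodule ℝ (X × Y)) (hG : IsClosed (G : Set (X × Y)))
    (h : ∀ x, ∃ y, (x, y) ∈ G) (h0 : ∀ y, ((0 : X), y) ∈ G → y = 0) :
    ∃ R : X →L[ℝ] Y, ∀ x, (x, R x) ∈ G := by
  choose r hr using h
  have uniq : ∀ x y, (x, y) ∈ G → y = r x := by
    intro x y hy
    have := h0 (y - r x) (by simpa using sub_mem hy (hr x))
    exact sub_eq_zero.1 this
  let R : X →ₗ[ℝ] Y :=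
    { toFun := r
      map_add' := fun x y => (uniq _ _ (add_mem (hr x) (hr y))).symm
      map_smul' := fun c x => (uniq _ _ (G.smul_mem c (hr x))).symm }
  have hgr : (R.graph : Set (X × Y)) = G := by
    ext ⟨x, y⟩
    simp only [SetLike.mem_coe, LinearMap.mem_graph_iff]
    constructor
    · rintro rfl
      exact hr x
    · exact uniq x y
  exact ⟨⟨R, R.continuous_of_isClosed_graph (hgr ▸ hG)⟩, hr⟩

end ClosedGraph

/-- A pointwise convergent series of bounded operators defines a bounded operator. -/
theorem exists_clm_hasSum {X F : Type*} [NormedAddCommGroup X] [NormedSpace ℝ X] [CompleteSpace X]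
    [NormedAddCommGroup F] [NormedSpace ℝ F] (T : ℕ → X →L[ℝ] F)
    (hT : ∀ f, Summable fun k => T k f) : ∃ S : X →L[ℝ] F, ∀ f, HasSum (fun k => T k f) (S f) := by
  have hlim : Filter.Tendsto (fun (s : Finset ℕ) (f : X) => (∑ k ∈ s, T k) f) Filter.atTop
      (nhds fun f => ∑' k, T k f) := by
    rw [tendsto_pi_nhds]
    intro f
    have := (hT f).hasSum
    simp only [sum_apply]
    exact this
  exact ⟨continuousLinearMapOfTendsto (fun s => ∑ k ∈ s, T k) hlim, fun f => (hT f).hasSum⟩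

variable (V0 : LinfR) (V1 : H1R →L[ℝ] Hm1R) (k : ℕ) (lam : ℝ)

theorem schrodingerForm_add (φ φ' ψ : H1R) : schrodingerForm V0 V1 k lam (φ + φ') ψ =
    schrodingerForm V0 V1 k lam φ ψ + schrodingerForm V0 V1 k lam φ' ψ := by
  simp only [schrodingerForm, smul_eq_linfMul, map_add, inner_add_left, add_apply]
  ring

theorem schrodingerForm_smul (c : ℝ) (φ ψ : H1R) : schrodingerForm V0 V1 k lam (c • φ) ψ =
    c * schrodingerForm V0 V1 k lam φ ψ := by
  simp only [schrodingerForm, smul_eq_linfMul, map_smul, real_inner_smul_left, smul_apply,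
    smul_eq_mul]
  ring

theorem schrodingerForm_zero (ψ : H1R) : schrodingerForm V0 V1 k lam 0 ψ = 0 := by
  simpa using schrodingerForm_smul V0 V1 k lam 0 0 ψ

theorem continuous_schrodingerForm (ψ : H1R) :
    Continuous fun φ => schrodingerForm V0 V1 k lam φ ψ := by
  simp only [schrodingerForm, smul_eq_linfMul]
  have h1 : Continuous fun φ => h1Val φ := h1Val.continuous
  have h2 : Continuous fun φ => h1Der φ := h1Der.continuous
  have h3 : Continuous fun φ => linfMul V0 (h1Val φ) := (linfMul V0).continuous.comp h1
  have h4 : Continuous fun φ => V1 φ ψ := (V1.flip ψ).continuous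
  exact (h2.inner continuous_const).add (continuous_const.mul
    (((h1.inner continuous_const).sub (continuous_const.mul (h3.inner continuous_const))).sub h4))

theorem mem_graph_schrodinger_iff (u f : L2R) : (u, f) ∈ (schrodinger V0 V1 k lam).graph ↔
    ∃ φ : H1R, h1Val φ = u ∧ ∀ ψ, schrodingerForm V0 V1 k lam φ ψ = ⟪f, h1Val ψ⟫_ℝ := by
  rw [graph_schrodinger]
  rfl

/-- The solutions `(f, φ)` of `L^k_λ φ = T f`, normalized by `φ ⊥ χ`. -/
def solutionRelation (T : L2R →L[ℝ] L2R) (χ : L2R) : Submodule ℝ (L2R × H1R) where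
  carrier := {p | (∀ ψ, schrodingerForm V0 V1 k lam p.2 ψ = ⟪T p.1, h1Val ψ⟫_ℝ) ∧
    ⟪χ, h1Val p.2⟫_ℝ = 0}
  zero_mem' := ⟨fun ψ => by simp [schrodingerForm_zero], by simp⟩
  add_mem' := by
    rintro p q ⟨h1, h2⟩ ⟨h3, h4⟩
    refine ⟨fun ψ => ?_, ?_⟩
    · rw [Prod.snd_add, schrodingerForm_add, h1, h3, Prod.fst_add, map_add, inner_add_left]
    · rw [Prod.snd_add, map_add, inner_add_right, h2, h4, add_zero]
  smul_mem' := by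
    rintro c p ⟨h1, h2⟩
    refine ⟨fun ψ => ?_, ?_⟩
    · rw [Prod.smul_snd, schrodingerForm_smul, h1, Prod.smul_fst, map_smul, real_inner_smul_left]
    · rw [Prod.smul_snd, map_smul, real_inner_smul_right, h2, mul_zero]

theorem isClosed_solutionRelation (T : L2R →L[ℝ] L2R) (χ : L2R) :
    IsClosed (solutionRelation V0 V1 k lam T χ : Set (L2R × H1R)) := by
  have : (solutionRelation V0 V1 k lam T χ : Set (L2R × H1R)) =
      (⋂ ψ, {p | schrodingerForm V0 V1 k lam p.2 ψ = ⟪T p.1, h1Val ψ⟫_ℝ}) ∩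
        {p | ⟪χ, h1Val p.2⟫_ℝ = 0} := by
    ext p
    simp only [mem_inter_iff, mem_iInter, mem_ofPred_eq]
    rfl
  rw [this]
  refine (isClosed_iInter fun ψ => isClosed_eq ?_ ?_).inter (isClosed_eq ?_ continuous_const)
  · exact (continuous_schrodingerForm V0 V1 k lam ψ).comp continuous_snd
  · exact (T.continuous.comp continuous_fst).inner continuous_const
  · exact continuous_const.inner (h1Val.continuous.comp continuous_snd)

variable {V0 V1 k lam}

/-- A bounded inverse of `L^k_λ` on `L²(ℝ)` maps into the domain, which is contained in `H¹(ℝ)`, and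
is bounded there by the closed graph theorem. -/
theorem exists_inverse_of_memResolventSet (h : MemResolventSet (schrodinger V0 V1 k lam) 0) :
    ∃ R : L2R →L[ℝ] H1R, ∀ f ψ, schrodingerForm V0 V1 k lam (R f) ψ = ⟪f, h1Val ψ⟫_ℝ := by
  obtain ⟨Q, hQ1, hQ2⟩ := h
  obtain ⟨R, hR⟩ := exists_clm_of_isClosed (X := L2R) (Y := H1R)
    (solutionRelation V0 V1 k lam (ContinuousLinearMap.id ℝ L2R) 0)
    (isClosed_solutionRelation V0 V1 k lam _ _) (fun f => by
      obtain ⟨hd, hf⟩ := hQ1 (-f)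
      rw [zero_smul, zero_sub, neg_inj] at hf
      have hm : (Q (-f), f) ∈ (schrodinger V0 V1 k lam).graph :=
        (LinearPMap.mem_graph_iff _).2 ⟨⟨_, hd⟩, rfl, hf⟩
      obtain ⟨φ, -, hφ⟩ := (mem_graph_schrodinger_iff _ _ _ _ _ _).1 hm
      exact ⟨φ, hφ, inner_zero_left _⟩) (fun φ hφ => by
      have hm : (h1Val φ, (0 : L2R)) ∈ (schrodinger V0 V1 k lam).graph :=
        (mem_graph_schrodinger_iff _ _ _ _ _ _).2 ⟨φ, rfl, fun ψ => by simpa using hφ.1 ψ⟩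
      obtain ⟨y, hy1, hy2⟩ := (LinearPMap.mem_graph_iff _).1 hm
      simp only at hy1 hy2
      have := hQ2 y
      rw [hy2, zero_smul, sub_zero, map_zero, hy1] at this
      exact h1Val_injective (by rw [← this, map_zero]))
  exact ⟨R, fun f ψ => (hR f).1 ψ⟩

theorem exists_h1_of_mem_kernel {φ : L2R} (hφ : φ ∈ kernel (schrodinger V0 V1 k lam)) :
    ∃ χ : H1R, h1Val χ = φ ∧ ∀ ψ, schrodingerForm V0 V1 k lam χ ψ = 0 := by
  obtain ⟨u, hu, rfl⟩ := hφ
  have hm : ((u : L2R), (0 : L2R)) ∈ (schrodinger V0 V1 k lam).graph :=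
    (LinearPMap.mem_graph_iff _).2 ⟨u, rfl, hu⟩
  obtain ⟨χ, h1, h2⟩ := (mem_graph_schrodinger_iff _ _ _ _ _ _).1 hm
  exact ⟨χ, h1, fun ψ => by rw [h2, inner_zero_left]⟩

/-- At an isolated simple eigenvalue zero, the equation `L φ = f` is solvable up to the component
of `f` along the kernel. -/
theorem exists_reduced_inverse (hsa : IsSelfAdjoint (schrodinger V0 V1 k lam))
    (hiso : ZeroIsIsolatedSimpleEigenvalue (schrodinger V0 V1 k lam)) {φ : L2R}
    (hφ : kernel (schrodinger V0 V1 k lam) = Submodule.span ℝ {φ}) :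
    φ ≠ 0 ∧ ∃ R : L2R →L[ℝ] H1R, ∀ f ψ, schrodingerForm V0 V1 k lam (R f) ψ =
      ⟪f - (⟪φ, f⟫_ℝ / ⟪φ, φ⟫_ℝ) • φ, h1Val ψ⟫_ℝ := by
  obtain ⟨hrank, δ, hδ, hres⟩ := hiso
  have hφ0 : φ ≠ 0 := by
    rintro rfl
    rw [hφ, Submodule.span_zero_singleton, finrank_bot] at hrank
    exact zero_ne_one hrank
  refine ⟨hφ0, ?_⟩
  have hφφ : ⟪φ, φ⟫_ℝ ≠ 0 := inner_self_ne_zero.2 hφ0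
  have hmem : φ ∈ kernel (schrodinger V0 V1 k lam) := hφ ▸ Submodule.mem_span_singleton_self φ
  obtain ⟨φd, hφd, hφe⟩ := hmem
  have hker : ∀ u : (schrodinger V0 V1 k lam).domain, schrodinger V0 V1 k lam u = 0 →
      ∃ c : ℝ, (u : L2R) = c • φ := by
    intro u hu
    have : (u : L2R) ∈ kernel (schrodinger V0 V1 k lam) := ⟨u, hu, rfl⟩
    rw [hφ] at this
    obtain ⟨c, hc⟩ := Submodule.mem_span_singleton.1 this
    exact ⟨c, hc.symm⟩
  let T : L2R →L[ℝ] L2R := ContinuousLinearMap.id ℝ L2R -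
    ((⟪φ, φ⟫_ℝ)⁻¹ • innerSL ℝ φ).smulRight φ
  have hT : ∀ f, T f = f - (⟪φ, f⟫_ℝ / ⟪φ, φ⟫_ℝ) • φ := by
    intro f
    simp [T, div_eq_inv_mul]
  have hTorth : ∀ f, ⟪φ, T f⟫_ℝ = 0 := by
    intro f
    rw [hT, inner_sub_right, real_inner_smul_right, div_mul_cancel₀ _ hφφ, sub_self]
  obtain ⟨R, hR⟩ := exists_clm_of_isClosed (X := L2R) (Y := H1R)
    (solutionRelation V0 V1 k lam T φ) (isClosed_solutionRelation V0 V1 k lam _ _) (fun f => by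
      obtain ⟨u, hu1, hu2⟩ := exists_apply_eq_of_isolated (H := L2R) hsa hδ hres φd hφd
        (fun u hu => by
          obtain ⟨c, hc⟩ := hker u hu
          exact ⟨c, hc.trans (congrArg (c • ·) hφe.symm)⟩)
        (f := T f) ((congrArg (fun z : L2R => ⟪z, T f⟫_ℝ) hφe).trans (hTorth f))
      have hm : ((u : L2R), T f) ∈ (schrodinger V0 V1 k lam).graph :=
        (LinearPMap.mem_graph_iff _).2 ⟨u, rfl, hu1⟩
      obtain ⟨χ, h1, h2⟩ := (mem_graph_schrodinger_iff _ _ _ _ _ _).1 hm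
      refine ⟨χ, h2, ?_⟩
      change ⟪φ, h1Val χ⟫_ℝ = 0
      rw [h1, ← hu2]
      exact congrArg (fun z : L2R => ⟪z, (u : L2R)⟫_ℝ) hφe.symm) (fun χ hχ => by
      have hm : (h1Val χ, (0 : L2R)) ∈ (schrodinger V0 V1 k lam).graph :=
        (mem_graph_schrodinger_iff _ _ _ _ _ _).2 ⟨χ, rfl, fun ψ => by simpa using hχ.1 ψ⟩
      obtain ⟨y, hy1, hy2⟩ := (LinearPMap.mem_graph_iff _).1 hm
      simp only at hy1 hy2
      obtain ⟨c, hc⟩ := hker y hy2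
      have h0 : ⟪φ, h1Val χ⟫_ℝ = 0 := hχ.2
      rw [← hy1, hc, real_inner_smul_right, mul_eq_zero, or_iff_left hφφ] at h0
      refine h1Val_injective ?_
      rw [← hy1, hc, h0, zero_smul, map_zero])
  refine ⟨R, fun f ψ => ?_⟩
  rw [← hT]
  exact (hR f).1 ψ

/-! ### The solution operator on sine series -/

/-- Summability in the solution space is summability of `Φ`, `Φ_x` and `Φ_xx`. -/
theorem summable_of_components {m : ℕ → SineWaves}
    (h0 : Summable fun k => valL (m k : WaveSpace)) (h1 : Summable fun k => dxL (m k : WaveSpace))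
    (h2 : Summable fun k => dxxL (m k : WaveSpace)) : Summable m := by
  rw [summable_iff_vanishing_norm] at h0 h1 h2
  refine (summable_iff_vanishing_norm (E := SineWaves)).2 fun ε hε => ?_
  obtain ⟨s0, h0⟩ := h0 ε hε
  obtain ⟨s1, h1⟩ := h1 ε hε
  obtain ⟨s2, h2⟩ := h2 ε hε
  refine ⟨s0 ∪ s1 ∪ s2, fun t ht => ?_⟩
  rw [Finset.disjoint_union_right, Finset.disjoint_union_right] at ht
  have h0 := h0 t ht.1.1
  have h1 := h1 t ht.1.2
  have h2 := h2 t ht.2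
  rw [← map_sum] at h0 h1 h2
  have e : ‖∑ k ∈ t, m k‖ = ‖∑ k ∈ t, (m k : WaveSpace)‖ := by
    rw [← Submodule.coe_sum]
    rfl
  rw [e]
  exact max_lt h0 (max_lt h1 h2)

/-- The wave `sin(kx) a(y)`, as a bounded operator in `a` with values in the sine waves. -/
def modeS (k : ℕ) : H1R →L[ℝ] SineWaves :=
  (mode (k + 1)).codRestrict SineWaves (mode_mem_sineWaves (Nat.le_add_left 1 k))

theorem coe_modeS (k : ℕ) (a : H1R) : (modeS k a : WaveSpace) = mode (k + 1) a := rfl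

theorem summable_modeS (R : ℕ → L2R →L[ℝ] H1R) {C : ℝ} {K : ℕ}
    (hR : ∀ k ≥ K, ∀ f, ((k + 1 : ℕ) : ℝ) * ‖R k f‖ ≤ C * ‖f‖ ∧
      ((k + 1 : ℕ) : ℝ) ^ 2 * ‖h1Val (R k f)‖ ≤ C * ‖f‖)
    {c : ℕ → L2R} (hb : Summable fun k => ‖c k‖ ^ 2) :
    Summable fun k => modeS k (Real.pi⁻¹ • R k (c k)) := by
  set a : ℕ → H1R := fun k => Real.pi⁻¹ • R k (c k) with ha
  have hπ : 0 ≤ Real.pi⁻¹ := by positivity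
  have b1 : ∀ k ≥ K, ‖((k + 1 : ℕ) : ℝ) • a k‖ ≤ Real.pi⁻¹ * (C * ‖c k‖) := by
    intro k hk
    rw [ha, norm_smul, norm_smul, Real.norm_of_nonneg hπ, Real.norm_of_nonneg (by positivity)]
    have := mul_le_mul_of_nonneg_left (hR k hk (c k)).1 hπ
    linarith
  have b0 : ∀ k ≥ K, ‖a k‖ ≤ Real.pi⁻¹ * (C * ‖c k‖) := by
    intro k hk
    refine le_trans ?_ (b1 k hk)
    have e := norm_smul ((k + 1 : ℕ) : ℝ) (a k)
    rw [Real.norm_of_nonneg (by positivity)] at e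
    rw [e]
    have : (1 : ℝ) ≤ ((k + 1 : ℕ) : ℝ) := by exact_mod_cast Nat.le_add_left 1 k
    nlinarith [norm_nonneg (a k)]
  have b2 : ∀ k ≥ K, ‖-(((k + 1 : ℕ) : ℝ) ^ 2) • h1Val (a k)‖ ≤ Real.pi⁻¹ * (C * ‖c k‖) := by
    intro k hk
    rw [ha, map_smul, norm_smul, norm_smul, norm_neg, Real.norm_of_nonneg hπ,
      Real.norm_of_nonneg (by positivity)]
    have := mul_le_mul_of_nonneg_left (hR k hk (c k)).2 hπ
    linarith
  have gen : ∀ d : ℕ → ℝ, (∀ k, 0 ≤ d k) → (∀ k ≥ K, d k ≤ Real.pi⁻¹ * (C * ‖c k‖)) →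
      Summable fun k => d k ^ 2 := by
    intro d hd0 hd
    refine Summable.of_norm_bounded_eventually_nat (hb.mul_left ((Real.pi⁻¹ * C) ^ 2)) ?_
    filter_upwards [Filter.eventually_ge_atTop K] with k hk
    rw [Real.norm_of_nonneg (by positivity)]
    calc d k ^ 2 ≤ (Real.pi⁻¹ * (C * ‖c k‖)) ^ 2 := pow_le_pow_left₀ (hd0 k) (hd k hk) 2
      _ = _ := by ring
  refine summable_of_components ?_ ?_ ?_
  · exact summable_sinMul (E := H1R) (gen (fun k => ‖a k‖) (fun _ => norm_nonneg _) b0)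
  · exact summable_cosMul (E := H1R)
      (gen (fun k => ‖((k + 1 : ℕ) : ℝ) • a k‖) (fun _ => norm_nonneg _) b1)
  · exact summable_sinMul (E := L2R)
      (gen (fun k => ‖-(((k + 1 : ℕ) : ℝ) ^ 2) • h1Val (a k)‖) (fun _ => norm_nonneg _) b2)

/-- Inverting the modes one by one is bounded from `L²` to the solution space, provided that the
inverses gain two `x`-derivatives in `L²(ℝ)` and one in `H¹(ℝ)`. -/
theorem exists_series_operator (R : ℕ → L2R →L[ℝ] H1R) {C : ℝ} {K : ℕ}
    (hR : ∀ k ≥ K, ∀ f, ((k + 1 : ℕ) : ℝ) * ‖R k f‖ ≤ C * ‖f‖ ∧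
      ((k + 1 : ℕ) : ℝ) ^ 2 * ‖h1Val (R k f)‖ ≤ C * ‖f‖) :
    ∃ S : L2T L2R →L[ℝ] SineWaves, ∀ f, HasSum
      (fun k => modeS k (Real.pi⁻¹ • R k (sinCoeff ((k + 1 : ℕ) : ℝ) f))) (S f) := by
  have hT : ∀ f : L2T L2R, Summable fun k =>
      ((modeS k).comp ((Real.pi⁻¹ • R k).comp (sinCoeff ((k + 1 : ℕ) : ℝ)))) f := fun f =>
    summable_modeS R hR (summable_norm_sinCoeff_sq f)
  have h := exists_clm_hasSum (X := L2T L2R) (F := SineWaves) _ hT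
  obtain ⟨S, hS⟩ := h
  exact ⟨S, fun f => hS f⟩

/-! ### The weak form of the linearized equation -/

/-- The linear part of the weak formulation, for a fixed test function `(Ψ, Ψ_x)`. -/
def weakForm (V0 : LinfR) (V1 : H1R →L[ℝ] Hm1R) (lam : ℝ) (Ψ Ψx : L2T H1R) : WaveSpace →L[ℝ] ℝ :=
  (innerSL ℝ (h1Der.compLpL 2 muT Ψ)).comp ((h1Der.compLpL 2 muT).comp valL) -
    (innerSL ℝ (l2tVal Ψ)).comp (dxxL - lam • (potMul V0).comp dxxL) -
    ((V1.lpPairing muT 2 2).flip Ψx).comp dxL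

theorem weakForm_apply (V0 : LinfR) (V1 : H1R →L[ℝ] Hm1R) (lam : ℝ) (Ψ Ψx : L2T H1R)
    (Φ : WaveSpace) : weakForm V0 V1 lam Ψ Ψx Φ =
      ⟪h1Der.compLpL 2 muT Ψ, h1Der.compLpL 2 muT (valL Φ)⟫_ℝ -
        (⟪l2tVal Ψ, dxxL Φ⟫_ℝ - lam * ⟪l2tVal Ψ, potMul V0 (dxxL Φ)⟫_ℝ) -
        V1.lpPairing muT 2 2 (dxL Φ) Ψx := by
  rw [← real_inner_smul_right, ← inner_sub_right]
  rfl

theorem inner_l2tVal_eq (f : L2T L2R) (Ψ : L2T H1R) :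
    ⟪l2tVal Ψ, f⟫_ℝ = ∫ x, ⟪f x, h1Val (Ψ x)⟫_ℝ ∂muT := by
  rw [L2.inner_def]
  refine integral_congr_ae ?_
  filter_upwards [l2tVal_ae Ψ] with x h1
  rw [h1, real_inner_comm]

theorem inner_compLp_h1Der_eq (u Ψ : L2T H1R) :
    ⟪h1Der.compLpL 2 muT Ψ, h1Der.compLpL 2 muT u⟫_ℝ =
      ∫ x, ⟪h1Der (u x), h1Der (Ψ x)⟫_ℝ ∂muT := by
  rw [L2.inner_def]
  refine integral_congr_ae ?_
  filter_upwards [h1Der.coeFn_compLpL (p := 2) Ψ, h1Der.coeFn_compLpL (p := 2) u] with x h1 h2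
  rw [h1, h2, real_inner_comm]

theorem integrable_inner_l2tVal (f : L2T L2R) (Ψ : L2T H1R) :
    Integrable (fun x => ⟪f x, h1Val (Ψ x)⟫_ℝ) muT := by
  refine (L2.integrable_inner (𝕜 := ℝ) f (l2tVal Ψ)).congr ?_
  filter_upwards [l2tVal_ae Ψ] with x h1
  rw [h1]

theorem integrable_inner_h1Der (u Ψ : L2T H1R) :
    Integrable (fun x => ⟪h1Der (u x), h1Der (Ψ x)⟫_ℝ) muT := by
  refine (L2.integrable_inner (𝕜 := ℝ) (h1Der.compLpL 2 muT u) (h1Der.compLpL 2 muT Ψ)).congr ?_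
  filter_upwards [h1Der.coeFn_compLpL (p := 2) Ψ, h1Der.coeFn_compLpL (p := 2) u] with x h1 h2
  rw [h1, h2]

theorem inner_potMul_eq (V : LinfR) (f : L2T L2R) (Ψ : L2T H1R) :
    ⟪l2tVal Ψ, potMul V f⟫_ℝ = ∫ x, ⟪(V • f x : L2R), h1Val (Ψ x)⟫_ℝ ∂muT := by
  rw [inner_l2tVal_eq]
  refine integral_congr_ae ?_
  filter_upwards [potMul_ae V f] with x h1
  rw [h1]

theorem integrable_inner_potMul (V : LinfR) (f : L2T L2R) (Ψ : L2T H1R) :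
    Integrable (fun x => ⟪(V • f x : L2R), h1Val (Ψ x)⟫_ℝ) muT := by
  refine (integrable_inner_l2tVal (potMul V f) Ψ).congr ?_
  filter_upwards [potMul_ae V f] with x h1
  rw [h1]

theorem integral_sub_sub_mul {α : Type*} [MeasurableSpace α] {μ : Measure α} {F G H : α → ℝ}
    (hF : Integrable F μ) (hG : Integrable G μ) (hH : Integrable H μ) (c : ℝ) :
    (∫ x, F x ∂μ) - ((∫ x, G x ∂μ) - c * ∫ x, H x ∂μ) = ∫ x, (F x - (G x - c * H x)) ∂μ := by
  rw [← integral_const_mul, ← integral_sub hG (hH.const_mul c),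
    ← integral_sub hF (g := fun x => G x - c * H x) (hG.sub (hH.const_mul c))]

theorem weakForm_eq_integral (V0 : LinfR) (V1 : H1R →L[ℝ] Hm1R) (lam : ℝ) (Ψ Ψx : L2T H1R)
    (Φ : WaveSpace) : weakForm V0 V1 lam Ψ Ψx Φ =
      (∫ x, (⟪h1Der (waveVal Φ x), h1Der (Ψ x)⟫_ℝ
          - ⟪waveDxx Φ x - lam • (V0 • waveDxx Φ x : L2R), h1Val (Ψ x)⟫_ℝ) ∂muT)
        - ∫ x, V1 (waveDx Φ x) (Ψx x) ∂muT := by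
  rw [weakForm_apply, inner_compLp_h1Der_eq, inner_l2tVal_eq, inner_potMul_eq,
    integral_sub_sub_mul (integrable_inner_h1Der _ _) (integrable_inner_l2tVal _ _)
      (integrable_inner_potMul _ _ _)]
  simp only [inner_sub_left, real_inner_smul_left]
  exact congrArg _ (ContinuousLinearMap.lpPairing_eq_integral V1 (dxL Φ) Ψx)

/-- The `k`-th cosine coefficient of `Ψ_x` is `k` times the `k`-th sine coefficient of `Ψ`. -/
theorem integral_cos_smul_testSpace {Ψ Ψx : L2T H1R} (h : (Ψ, Ψx) ∈ TestSpace) (k : ℕ) :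
    ∫ x, Real.cos (k * x) • Ψx x ∂muT = (k : ℝ) • sinCoeff (k : ℝ) Ψ := by
  have h' : IsWeakDerivT Ψ Ψx := h
  have hd : deriv (fun x : ℝ => Real.cos (k * x)) = fun x => -((k : ℝ) * Real.sin (k * x)) := by
    funext x
    have := ((hasDerivAt_id x).const_mul (k : ℝ)).cos.deriv
    simp only [id, mul_one] at this
    rw [this]
    ring
  have e := h' (fun x : ℝ => Real.cos (k * x)) (by fun_prop) (fun x => by
    have := Real.cos_add_nat_mul_two_pi (k * x) k
    refine Eq.trans ?_ this
    simp only
    ring_nf)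
  rw [hd] at e
  simp only [neg_smul, mul_smul] at e
  rw [integral_neg, neg_inj, integral_smul] at e
  rw [← e, sinCoeff, integralSmul_apply]

theorem lpPairing_cosMul (V1 : H1R →L[ℝ] Hm1R) (k : ℝ) (a : H1R) (Ψ : L2T H1R) :
    V1.lpPairing muT 2 2 (cosMul k a) Ψ = V1 a (∫ x, Real.cos (k * x) • Ψ x ∂muT) := by
  rw [ContinuousLinearMap.lpPairing_eq_integral,
    ← ContinuousLinearMap.integral_comp_comm _
      (integrable_smul_of_continuous (continuous_cos_mul k) Ψ)]
  refine integral_congr_ae ?_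
  filter_upwards [cosMul_ae k a] with x hx
  rw [hx, map_smul, map_smul]
  rfl

/-- On a single mode, the linear part of the equation is `L^k_λ`. -/
theorem weakForm_mode (V0 : LinfR) (V1 : H1R →L[ℝ] Hm1R) (lam : ℝ) {Ψ Ψx : L2T H1R}
    (h : (Ψ, Ψx) ∈ TestSpace) (k : ℕ) (a : H1R) : weakForm V0 V1 lam Ψ Ψx (mode k a) =
      schrodingerForm V0 V1 k lam a (sinCoeff (k : ℝ) Ψ) := by
  have e1 : h1Der.compLpL 2 muT (sinMul (k : ℝ) a) = sinMul (k : ℝ) (h1Der a) :=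
    compLp_waveMul _ _ _
  have e2 : ∀ b : L2R, potMul V0 (sinMul (k : ℝ) b) = sinMul (k : ℝ) (linfMul V0 b) := fun b =>
    compLp_waveMul _ _ _
  have e3 : sinCoeff (k : ℝ) (l2tVal Ψ) = h1Val (sinCoeff (k : ℝ) Ψ) := compLp_sinCoeff _ _ _
  have e4 : sinCoeff (k : ℝ) (h1Der.compLpL 2 muT Ψ) = h1Der (sinCoeff (k : ℝ) Ψ) :=
    compLp_sinCoeff _ _ _
  have i1 : ⟪h1Der.compLpL 2 muT Ψ, h1Der.compLpL 2 muT (valL (mode k a))⟫_ℝ =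
      ⟪h1Der a, h1Der (sinCoeff (k : ℝ) Ψ)⟫_ℝ := by
    rw [valL_mode, e1, inner_sinMul (E := L2R), e4, real_inner_comm]
  have i2 : ∀ b : L2R, ⟪l2tVal Ψ, sinMul (k : ℝ) b⟫_ℝ = ⟪b, h1Val (sinCoeff (k : ℝ) Ψ)⟫_ℝ := by
    intro b
    rw [inner_sinMul (E := L2R), e3, real_inner_comm]
  have i3 : V1.lpPairing muT 2 2 (dxL (mode k a)) Ψx =
      (k : ℝ) ^ 2 * V1 a (sinCoeff (k : ℝ) Ψ) := by
    rw [dxL_mode, lpPairing_cosMul, integral_cos_smul_testSpace h, map_smul, map_smul, smul_apply,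
      smul_eq_mul, smul_eq_mul]
    ring
  rw [weakForm_apply, i1, i3, dxxL_mode, e2, i2, i2, map_smul, real_inner_smul_left,
    real_inner_smul_left, schrodingerForm, smul_eq_linfMul]
  ring

/-! ### The solution operator of the linearized equation -/

/-- The inverses of `L^{k+1}_λ`, `k ≥ 0`, modulo the kernel function at the index `k_*`. -/
theorem exists_mode_inverses {V0 : LinfR} {V1 : H1R →L[ℝ] Hm1R} {ks : ℕ} {lam : ℝ} {φ : L2R}
    (hsa : IsSelfAdjoint (schrodinger V0 V1 ks lam))
    (hiso : ZeroIsIsolatedSimpleEigenvalue (schrodinger V0 V1 ks lam))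
    (hres : ∀ k : ℕ, 1 ≤ k → k ≠ ks → MemResolventSet (schrodinger V0 V1 k lam) 0)
    (hφ : kernel (schrodinger V0 V1 ks lam) = Submodule.span ℝ {φ}) :
    ∃ R : ℕ → L2R →L[ℝ] H1R,
      (∀ k, k + 1 ≠ ks → ∀ f ψ, schrodingerForm V0 V1 (k + 1) lam (R k f) ψ = ⟪f, h1Val ψ⟫_ℝ) ∧
      ∀ k, k + 1 = ks → ∀ f ψ, schrodingerForm V0 V1 (k + 1) lam (R k f) ψ =
        ⟪f - (⟪φ, f⟫_ℝ / ⟪φ, φ⟫_ℝ) • φ, h1Val ψ⟫_ℝ := by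
  obtain ⟨-, R₀, hR₀⟩ := exists_reduced_inverse hsa hiso hφ
  have h : ∀ k : ℕ, ∃ R : L2R →L[ℝ] H1R, k + 1 ≠ ks →
      ∀ f ψ, schrodingerForm V0 V1 (k + 1) lam (R f) ψ = ⟪f, h1Val ψ⟫_ℝ := by
    intro k
    by_cases hk : k + 1 = ks
    · exact ⟨R₀, fun h => absurd hk h⟩
    · obtain ⟨R, hR⟩ := exists_inverse_of_memResolventSet (hres (k + 1) (Nat.le_add_left 1 k) hk)
      exact ⟨R, fun _ => hR⟩
  choose R hR using h
  refine ⟨fun k => if k + 1 = ks then R₀ else R k, fun k hk => ?_, fun k hk => ?_⟩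
  · simp only [hk, if_false]
    exact hR k hk
  · simp only [hk, if_true]
    exact hR₀

/-- The resolvent estimates, as gains of powers of `k`. -/
theorem gain_of_bound {k : ℕ} (hk : 1 ≤ k) {C : ℝ} {χ : H1R} {f : L2R}
    (h1 : ‖h1Val χ‖ ≤ C / (k : ℝ) ^ 2 * ‖f‖) (h2 : ‖h1Der χ‖ ≤ C / (k : ℝ) * ‖f‖) :
    (k : ℝ) * ‖χ‖ ≤ 2 * |C| * ‖f‖ ∧ (k : ℝ) ^ 2 * ‖h1Val χ‖ ≤ 2 * |C| * ‖f‖ := by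
  have hk1 : (1 : ℝ) ≤ k := by exact_mod_cast hk
  have hk0 : (0 : ℝ) < k := by linarith
  have hC : C * ‖f‖ ≤ |C| * ‖f‖ := mul_le_mul_of_nonneg_right (le_abs_self C) (norm_nonneg f)
  have hC0 : 0 ≤ |C| * ‖f‖ := by positivity
  have a1 : (k : ℝ) ^ 2 * ‖h1Val χ‖ ≤ |C| * ‖f‖ := by
    refine le_trans ?_ hC
    calc (k : ℝ) ^ 2 * ‖h1Val χ‖ ≤ (k : ℝ) ^ 2 * (C / (k : ℝ) ^ 2 * ‖f‖) := by gcongr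
      _ = C * ‖f‖ := by field_simp
  have a2 : (k : ℝ) * ‖h1Der χ‖ ≤ |C| * ‖f‖ := by
    refine le_trans ?_ hC
    calc (k : ℝ) * ‖h1Der χ‖ ≤ (k : ℝ) * (C / (k : ℝ) * ‖f‖) := by gcongr
      _ = C * ‖f‖ := by field_simp
  have a3 : (k : ℝ) * ‖h1Val χ‖ ≤ (k : ℝ) ^ 2 * ‖h1Val χ‖ := by
    gcongr
    nlinarith
  have a4 : (k : ℝ) * ‖χ‖ ≤ (k : ℝ) * (‖h1Val χ‖ + ‖h1Der χ‖) := by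
    gcongr
    exact norm_h1_le χ
  constructor <;> linarith

/-- The operator which applies the inverses `R k` mode by mode, and its values on single modes. -/
theorem exists_modewise_operator (R : ℕ → L2R →L[ℝ] H1R) {C : ℝ} {K : ℕ}
    (hR : ∀ k ≥ K, ∀ f, ((k + 1 : ℕ) : ℝ) * ‖R k f‖ ≤ C * ‖f‖ ∧
      ((k + 1 : ℕ) : ℝ) ^ 2 * ‖h1Val (R k f)‖ ≤ C * ‖f‖) :
    ∃ S : L2T L2R →L[ℝ] SineWaves,
      (∀ f, ∃ a : ℕ → H1R, HasSum (fun k => modeS k (a k)) (S f)) ∧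
      ∀ (k : ℕ) (b : L2R), S (sinMul ((k + 1 : ℕ) : ℝ) b) = modeS k (R k b) := by
  obtain ⟨S, hS⟩ := exists_series_operator R hR
  refine ⟨S, fun f => ⟨_, hS f⟩, fun k b => ?_⟩
  have h0 : ∀ j, j ≠ k → Real.pi⁻¹ •
      R j (sinCoeff ((j + 1 : ℕ) : ℝ) (sinMul ((k + 1 : ℕ) : ℝ) b)) = 0 := by
    intro j hj
    rw [sinCoeff_sinMul (Nat.le_add_left 1 j), if_neg (by omega), map_zero, smul_zero]
  have h1 : Real.pi⁻¹ •
      R k (sinCoeff ((k + 1 : ℕ) : ℝ) (sinMul ((k + 1 : ℕ) : ℝ) b)) = R k b := by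
    rw [sinCoeff_sinMul (Nat.le_add_left 1 k), if_pos rfl, map_smul,
      inv_smul_smul₀ Real.pi_ne_zero]
  have h2 := hasSum_single (f := fun j => modeS j (Real.pi⁻¹ •
      R j (sinCoeff ((j + 1 : ℕ) : ℝ) (sinMul ((k + 1 : ℕ) : ℝ) b)))) k
    (fun j hj => (congrArg (modeS j) (h0 j hj)).trans (map_zero (modeS j)))
  exact ((hS _).unique h2).trans (congrArg (modeS k) h1)

/-- The defect of the mode-by-mode inverse is a multiple, independent of the right-hand side, of the
pairing of the right-hand side with `sin(k_* x) φ(y)`. -/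
theorem weakForm_modewise_eq {V0 : LinfR} {V1 : H1R →L[ℝ] Hm1R} {ks : ℕ} {lam : ℝ} {φ : L2R}
    {R : ℕ → L2R →L[ℝ] H1R}
    (hR1 : ∀ k, k + 1 ≠ ks → ∀ f ψ,
      schrodingerForm V0 V1 (k + 1) lam (R k f) ψ = ⟪f, h1Val ψ⟫_ℝ)
    (hR2 : ∀ k, k + 1 = ks → ∀ f ψ, schrodingerForm V0 V1 (k + 1) lam (R k f) ψ =
        ⟪f - (⟪φ, f⟫_ℝ / ⟪φ, φ⟫_ℝ) • φ, h1Val ψ⟫_ℝ) {Ψ Ψx : L2T H1R}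
    (hΨ : (Ψ, Ψx) ∈ TestSpace) (k : ℕ) (b : L2R) :
    weakForm V0 V1 lam Ψ Ψx (mode (k + 1) (R k b)) =
      ⟪l2tVal Ψ, sinMul ((k + 1 : ℕ) : ℝ) b⟫_ℝ -
        ⟪φ, h1Val (sinCoeff (ks : ℝ) Ψ)⟫_ℝ / (Real.pi * ⟪φ, φ⟫_ℝ) *
          ⟪sinMul (ks : ℝ) φ, sinMul ((k + 1 : ℕ) : ℝ) b⟫_ℝ := by
  have e3 : ∀ r : ℝ, sinCoeff r (l2tVal Ψ) = h1Val (sinCoeff r Ψ) := fun r => compLp_sinCoeff _ _ _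
  have r : ⟪l2tVal Ψ, sinMul ((k + 1 : ℕ) : ℝ) b⟫_ℝ =
      ⟪b, h1Val (sinCoeff ((k + 1 : ℕ) : ℝ) Ψ)⟫_ℝ := by
    rw [inner_sinMul (E := L2R), e3, real_inner_comm]
  have r' : ⟪sinMul (ks : ℝ) φ, sinMul ((k + 1 : ℕ) : ℝ) b⟫_ℝ =
      if k + 1 = ks then Real.pi * ⟪b, φ⟫_ℝ else 0 := by
    rw [real_inner_comm]
    exact inner_sinMul_sinMul (E := L2R) (Nat.le_add_left 1 k) b φ
  rw [weakForm_mode _ _ _ hΨ, r, r']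
  by_cases hk : k + 1 = ks
  · rw [hR2 k hk, if_pos hk, inner_sub_left, real_inner_smul_left, ← hk, real_inner_comm φ b]
    have := Real.pi_ne_zero
    by_cases h0 : ⟪φ, φ⟫_ℝ = 0
    · rw [h0]
      simp
    · field_simp
  · rw [hR1 k hk, if_neg hk, mul_zero, sub_zero]

/-- Passage from single harmonics to sine series which are orthogonal to the kernel function. -/
theorem weakForm_solution_eq {V0 : LinfR} {V1 : H1R →L[ℝ] Hm1R} {ks : ℕ} {lam : ℝ} {φ : L2R}
    {Ψ Ψx : L2T H1R} {S : L2T L2R →L[ℝ] SineWaves} {c : ℝ}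
    (hS : ∀ (k : ℕ) (b : L2R), weakForm V0 V1 lam Ψ Ψx (S (sinMul ((k + 1 : ℕ) : ℝ) b)) =
      ⟪l2tVal Ψ, sinMul ((k + 1 : ℕ) : ℝ) b⟫_ℝ -
        c * ⟪sinMul (ks : ℝ) φ, sinMul ((k + 1 : ℕ) : ℝ) b⟫_ℝ)
    {f : L2T L2R} (hf : f ∈ sinL2 L2R) (hf0 : ⟪sinMul (ks : ℝ) φ, f⟫_ℝ = 0) :
    weakForm V0 V1 lam Ψ Ψx (S f) = ⟪l2tVal Ψ, f⟫_ℝ := by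
  have key := sinL2_eqOn (E := L2R) (F := ℝ)
    (S := (weakForm V0 V1 lam Ψ Ψx).comp (SineWaves.subtypeL.comp S))
    (T := innerSL ℝ (l2tVal Ψ) - c • innerSL ℝ (sinMul (ks : ℝ) φ)) hS hf
  refine key.trans ?_
  change ⟪l2tVal Ψ, f⟫_ℝ - c * ⟪sinMul (ks : ℝ) φ, f⟫_ℝ = _
  rw [hf0, mul_zero, sub_zero]

/-- The linearized equation is solvable for odd right-hand sides which are orthogonal to the kernel
function `sin(k_* x) φ(y)`. -/
theorem exists_solution_operator {V0 : LinfR} {V1 : H1R →L[ℝ] Hm1R} {ks : ℕ} {lam : ℝ} {φ : L2R}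
    (hsa : IsSelfAdjoint (schrodinger V0 V1 ks lam))
    (hiso : ZeroIsIsolatedSimpleEigenvalue (schrodinger V0 V1 ks lam))
    (hres : ∀ k : ℕ, 1 ≤ k → k ≠ ks → MemResolventSet (schrodinger V0 V1 k lam) 0)
    (hφ : kernel (schrodinger V0 V1 ks lam) = Submodule.span ℝ {φ}) {C : ℝ} {K : ℕ}
    (hbd : ∀ k : ℕ, 1 ≤ k → K ≤ k → ∀ (χ : H1R) (f : L2R),
      (h1Val χ, f) ∈ (schrodinger V0 V1 k lam).graph →
        ‖h1Val χ‖ ≤ C / (k : ℝ) ^ 2 * ‖f‖ ∧ ‖h1Der χ‖ ≤ C / (k : ℝ) * ‖f‖) :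
    ∃ S : L2T L2R →L[ℝ] SineWaves,
      (∀ f, ∃ a : ℕ → H1R, HasSum (fun k => modeS k (a k)) (S f)) ∧
      ∀ f ∈ sinL2 L2R, ⟪sinMul (ks : ℝ) φ, f⟫_ℝ = 0 → ∀ Ψ Ψx, (Ψ, Ψx) ∈ TestSpace →
        weakForm V0 V1 lam Ψ Ψx (S f) = ⟪l2tVal Ψ, f⟫_ℝ := by
  obtain ⟨R, hR1, hR2⟩ := exists_mode_inverses hsa hiso hres hφ
  have hop := exists_modewise_operator R (C := 2 * |C|) (K := K + ks) (fun k hk f => by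
    have hm : (h1Val (R k f), f) ∈ (schrodinger V0 V1 (k + 1) lam).graph :=
      (mem_graph_schrodinger_iff _ _ _ _ _ _).2 ⟨R k f, rfl, hR1 k (by omega) f⟩
    obtain ⟨b1, b2⟩ := hbd (k + 1) (Nat.le_add_left 1 k) (by omega) _ _ hm
    exact gain_of_bound (Nat.le_add_left 1 k) b1 b2)
  refine hop.imp fun S hS => ⟨hS.1, fun f hf hf0 Ψ Ψx hΨ => ?_⟩
  exact weakForm_solution_eq (fun k b =>
    (congrArg (weakForm V0 V1 lam Ψ Ψx) (congrArg Subtype.val (hS.2 k b))).trans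
      (weakForm_modewise_eq hR1 hR2 hΨ k b)) hf hf0

end TravelingWave
end

/-! ### Bifurcation from a simple kernel -/

/-- The Lyapunov–Schmidt step. The unknown `u = e + w` is normalized by its leading term `e`; the
scalar `q` is determined by the requirement that the right-hand side be orthogonal to `e₀`, and the
remaining equation for `w` is a fixed point problem with the small factor `τ`. -/
theorem exists_lyapunov_schmidt_curve {X Y : Type*} [NormedAddCommGroup X] [NormedSpace ℝ X]
    [CompleteSpace X] [NormedAddCommGroup Y] [InnerProductSpace ℝ Y] (D : X →L[ℝ] Y) {g : X → Y}
    (hg : ContDiff ℝ ω g) (V G : Y →L[ℝ] Y) (S : Y →L[ℝ] X) (e : X) (e₀ : Y)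
    (hA : ⟪e₀, V (D e)⟫_ℝ ≠ 0) :
    ∃ (δ : ℝ) (w : ℝ → X) (q : ℝ → ℝ), 0 < δ ∧ ContDiffOn ℝ ω w (Ioo (-δ) δ) ∧
      ContDiffOn ℝ ω q (Ioo (-δ) δ) ∧ w 0 = 0 ∧
      q 0 = ⟪e₀, G (g e)⟫_ℝ / ⟪e₀, V (D e)⟫_ℝ ∧
      ∀ τ ∈ Ioo (-δ) δ, e + w τ ≠ 0 ∧
        ⟪e₀, q τ • V (D (e + w τ)) - G (g (e + w τ))⟫_ℝ = 0 ∧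
        w τ = τ • S (q τ • V (D (e + w τ)) - G (g (e + w τ))) := by
  set A : X → ℝ := fun w => ⟪e₀, V (D (e + w))⟫_ℝ with hAdef
  set Q : X → ℝ := fun w => ⟪e₀, G (g (e + w))⟫_ℝ / A w with hQ
  have hA0 : A 0 ≠ 0 := by simpa [hAdef] using hA
  have hVD : ContDiff ℝ ω fun w => V (D (e + w)) :=
    V.contDiff.comp (D.contDiff.comp (contDiff_const.add contDiff_id))
  have hGg : ContDiff ℝ ω fun w => G (g (e + w)) :=
    G.contDiff.comp (hg.comp (contDiff_const.add contDiff_id))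
  have hAc : ContDiff ℝ ω A := (innerSL ℝ e₀).contDiff.comp hVD
  have hBc : ContDiff ℝ ω fun w => ⟪e₀, G (g (e + w))⟫_ℝ := (innerSL ℝ e₀).contDiff.comp hGg
  have hQc : ∀ w, A w ≠ 0 → ContDiffAt ℝ ω Q w := fun w hw => hBc.contDiffAt.div hAc.contDiffAt hw
  obtain ⟨δ, w, hδ, hw, hw0, hfix⟩ := exists_analytic_fixedPoint_curve
    (N := fun w => S (Q w • V (D (e + w)) - G (g (e + w))))
    (S.contDiff.contDiffAt.comp _
      (((hQc 0 hA0).smul hVD.contDiffAt).sub hGg.contDiffAt))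
  have hwc : ContinuousAt w 0 :=
    hw.continuousOn.continuousAt (Ioo_mem_nhds (neg_lt_zero.2 hδ) hδ)
  have hev : ∀ᶠ τ in nhds (0 : ℝ), A (w τ) ≠ 0 :=
    (hAc.continuous.continuousAt.comp hwc).eventually_ne
      (by simpa only [Function.comp_apply, hw0] using hA0)
  obtain ⟨δ₁, hδ₁, hball⟩ := Metric.eventually_nhds_iff.1 hev
  have hsub : Ioo (-min δ δ₁) (min δ δ₁) ⊆ Ioo (-δ) δ :=
    Ioo_subset_Ioo (neg_le_neg (min_le_left _ _)) (min_le_left _ _)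
  have hne : ∀ τ ∈ Ioo (-min δ δ₁) (min δ δ₁), A (w τ) ≠ 0 := by
    intro τ hτ
    refine hball ?_
    rw [Real.dist_eq, sub_zero]
    exact (abs_lt.2 hτ).trans_le (min_le_right _ _)
  refine ⟨min δ δ₁, w, fun τ => Q (w τ), lt_min hδ hδ₁, hw.mono hsub, fun τ hτ => ?_, hw0, ?_,
    fun τ hτ => ⟨fun h0 => ?_, ?_, ?_⟩⟩
  · exact (hQc _ (hne τ hτ)).comp_contDiffWithinAt τ (hw.mono hsub τ hτ)
  · simp only [hQ, hAdef, hw0, add_zero]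
  · refine hne τ hτ ?_
    simp only [hAdef, h0, map_zero, inner_zero_right]
  · rw [inner_sub_right, real_inner_smul_right]
    simp only [hQ]
    rw [div_mul_cancel₀ _ (hne τ hτ), sub_self]
  · exact hfix τ (hsub hτ)

theorem hasDerivAt_const_sub_sq_mul {r : ℝ → ℝ} (hr : ContDiffAt ℝ 2 r 0) (c : ℝ) :
    HasDerivAt (fun ε => c - ε ^ 2 * r ε) 0 0 ∧
      HasDerivAt (deriv fun ε => c - ε ^ 2 * r ε) (-2 * r 0) 0 := by
  have hd : ∀ ε, DifferentiableAt ℝ r ε →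
      HasDerivAt (fun ε => c - ε ^ 2 * r ε) (-(ε * (2 * r ε + ε * deriv r ε))) ε := by
    intro ε h
    have := (((hasDerivAt_id ε).pow 2).mul h.hasDerivAt).const_sub c
    refine this.congr_deriv ?_
    simp
    ring
  have hr0 : DifferentiableAt ℝ r 0 := hr.differentiableAt (by norm_num)
  refine ⟨by simpa using hd 0 hr0, ?_⟩
  have hr' : DifferentiableAt ℝ (deriv r) 0 := by
    have h1 : ContDiffAt ℝ 1 (fderiv ℝ r) 0 := hr.fderiv_right (by norm_num)
    exact ((h1.differentiableAt (by norm_num)).clm_apply (differentiableAt_const (1 : ℝ)))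
  have hev : (deriv fun ε => c - ε ^ 2 * r ε) =ᶠ[nhds 0]
      fun ε => -(ε * (2 * r ε + ε * deriv r ε)) := by
    filter_upwards [hr.eventually (by simp)] with ε hε
    exact (hd ε (hε.differentiableAt (by norm_num))).deriv
  refine HasDerivAt.congr_of_eventuallyEq ?_ hev
  have h2 := ((hasDerivAt_id (0 : ℝ)).mul
    ((hr0.hasDerivAt.const_mul 2).add ((hasDerivAt_id (0 : ℝ)).mul hr'.hasDerivAt))).neg
  refine h2.congr_deriv ?_
  simp

noncomputable section
namespace TravelingWave

/-! ### The bifurcation coefficient -/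

theorem inner_linfMul_self (V : LinfR) (φ : L2R) : ⟪φ, linfMul V φ⟫_ℝ = ∫ y, V y * φ y ^ 2 := by
  rw [L2.inner_def]
  refine integral_congr_ae ?_
  filter_upwards [linfMul_ae V φ] with y h
  rw [h]
  simp only [RCLike.inner_apply, conj_trivial]
  ring

theorem inner_linfMul_h1Mul_sq (V : LinfR) (χ : H1R) :
    ⟪h1Val χ, linfMul V (h1Mul χ (h1Mul χ (h1Val χ)))⟫_ℝ = ∫ y, V y * h1Val χ y ^ 4 := by
  rw [L2.inner_def]
  refine integral_congr_ae ?_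
  filter_upwards [linfMul_ae V (h1Mul χ (h1Mul χ (h1Val χ))), h1Mul_ae χ (h1Mul χ (h1Val χ)),
    h1Mul_ae χ (h1Val χ)] with y h1 h2 h3
  rw [h1, h2, h3]
  simp only [RCLike.inner_apply, conj_trivial]
  ring

theorem inner_potMul_dxxL_mode (V : LinfR) {k : ℕ} (hk : 1 ≤ k) (χ : H1R) :
    ⟪sinMul (k : ℝ) (h1Val χ), potMul V (dxxL (mode k χ))⟫_ℝ =
      -((k : ℝ) ^ 2 * Real.pi) * ∫ y, V y * h1Val χ y ^ 2 := by
  have e2 : ∀ b : L2R, potMul V (sinMul (k : ℝ) b) = sinMul (k : ℝ) (linfMul V b) := fun b =>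
    compLp_waveMul _ _ _
  rw [dxxL_mode, e2, inner_sinMul_sinMul (E := L2R) hk, if_pos rfl, map_smul,
    real_inner_smul_right, inner_linfMul_self]
  ring

/-- The second `x`-derivative of `sin(kx)³ χ(y)³`, from `4 sin³ θ = 3 sin θ - sin 3θ`. -/
theorem cubeDxx_mode {k : ℕ} {χ : H1R} {Φ : SineWaves} (hΦ : (Φ : WaveSpace) = mode k χ) :
    cubeDxx Φ = sinMul (k : ℝ) ((-(3 / 4) * (k : ℝ) ^ 2) • h1Mul χ (h1Mul χ (h1Val χ))) +
      sinMul ((3 * k : ℕ) : ℝ) ((9 / 4 * (k : ℝ) ^ 2) • h1Mul χ (h1Mul χ (h1Val χ))) := by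
  have e1 : valS Φ =ᵐ[muT] fun x => Real.sin (k * x) • χ := by
    rw [valS_apply, hΦ, valL_mode]
    exact sinMul_ae _ _
  have e2 : dxS Φ =ᵐ[muT] fun x => Real.cos (k * x) • (k : ℝ) • χ := by
    rw [dxS_apply, hΦ, dxL_mode]
    exact cosMul_ae _ _
  have e3 : dxxS Φ =ᵐ[muT] fun x => Real.sin (k * x) • (-((k : ℝ) ^ 2) • h1Val χ) := by
    rw [dxxS_apply, hΦ, dxxL_mode]
    exact sinMul_ae _ _
  refine Lp.ext ?_
  filter_upwards [cubeDxx_ae Φ, e1, e2, e3,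
    Lp.coeFn_add (sinMul (k : ℝ) ((-(3 / 4) * (k : ℝ) ^ 2) • h1Mul χ (h1Mul χ (h1Val χ))))
      (sinMul ((3 * k : ℕ) : ℝ) ((9 / 4 * (k : ℝ) ^ 2) • h1Mul χ (h1Mul χ (h1Val χ)))),
    sinMul_ae (k : ℝ) ((-(3 / 4) * (k : ℝ) ^ 2) • h1Mul χ (h1Mul χ (h1Val χ))),
    sinMul_ae ((3 * k : ℕ) : ℝ) ((9 / 4 * (k : ℝ) ^ 2) • h1Mul χ (h1Mul χ (h1Val χ)))]
    with x h0 h1 h2 h3 h4 h5 h6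
  refine (h0.trans (second_deriv_congr h1 h2 h3)).trans
    (Eq.trans ?_ (h4.trans (congrArg₂ (· + ·) h5 h6)).symm)
  have hs : Real.sin (((3 * k : ℕ) : ℝ) * x) =
      3 * Real.sin (k * x) - 4 * Real.sin (k * x) ^ 3 := by
    rw [← Real.sin_three_mul]
    push_cast
    ring_nf
  have hc : Real.cos (k * x) ^ 2 = 1 - Real.sin (k * x) ^ 2 := Real.cos_sq' _
  simp only [map_smul, smul_apply, smul_smul, ← add_smul]
  congr 1
  rw [hs]
  linear_combination (6 * Real.sin (k * x) * (k : ℝ) ^ 2) * hc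

theorem inner_potMul_cubeDxx_mode (V : LinfR) {k : ℕ} (hk : 1 ≤ k) {χ : H1R} {Φ : SineWaves}
    (hΦ : (Φ : WaveSpace) = mode k χ) :
    ⟪sinMul (k : ℝ) (h1Val χ), potMul V (cubeDxx Φ)⟫_ℝ =
      -(3 / 4 * (k : ℝ) ^ 2 * Real.pi) * ∫ y, V y * h1Val χ y ^ 4 := by
  have e2 : ∀ (r : ℝ) (b : L2R), potMul V (sinMul r b) = sinMul r (linfMul V b) := fun r b =>
    compLp_waveMul _ _ _
  rw [cubeDxx_mode hΦ, map_add, e2, e2, inner_add_right, inner_sinMul_sinMul (E := L2R) hk,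
    inner_sinMul_sinMul (E := L2R) hk, if_pos rfl, if_neg (by omega), map_smul,
    real_inner_smul_right, inner_linfMul_h1Mul_sq]
  ring

end TravelingWave
end

/-! ### The branch of travelling waves -/

/-- The substitution `τ = ε²` turns the Lyapunov–Schmidt curve into the bifurcating branch. -/
theorem exists_branch {X Z : Type*} [NormedAddCommGroup X] [NormedSpace ℝ X]
    [NormedAddCommGroup Z] [NormedSpace ℝ Z] (L : X →L[ℝ] Z) (e : X) {δ : ℝ} (hδ : 0 < δ)
    {w : ℝ → X} {q : ℝ → ℝ} (hw : ContDiffOn ℝ ω w (Ioo (-δ) δ))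
    (hq : ContDiffOn ℝ ω q (Ioo (-δ) δ)) (hw0 : w 0 = 0) {I : Set ℝ} (hI : IsOpen I) {c : ℝ}
    (hc : c ∈ I) :
    ∃ ε₀ > 0, ContDiffOn ℝ ∞ (fun ε => L (ε • (e + w (ε ^ 2)))) (Ioo (-ε₀) ε₀) ∧
      ContDiffOn ℝ ∞ (fun ε => c - ε ^ 2 * q (ε ^ 2)) (Ioo (-ε₀) ε₀) ∧
      (∀ ε ∈ Ioo (-ε₀) ε₀, ε ^ 2 ∈ Ioo (-δ) δ ∧ c - ε ^ 2 * q (ε ^ 2) ∈ I) ∧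
      HasDerivAt (fun ε => L (ε • (e + w (ε ^ 2)))) (L e) 0 ∧
      HasDerivAt (fun ε => c - ε ^ 2 * q (ε ^ 2)) 0 0 ∧
      HasDerivAt (deriv fun ε => c - ε ^ 2 * q (ε ^ 2)) (-2 * q 0) 0 := by
  have hnhds : Ioo (-δ) δ ∈ nhds ((fun ε : ℝ => ε ^ 2) 0) := by
    simp only [zero_pow two_ne_zero]
    exact Ioo_mem_nhds (neg_lt_zero.2 hδ) hδ
  have hsq : ContDiff ℝ ω fun ε : ℝ => ε ^ 2 := contDiff_id.pow 2
  have hw0' : ContDiffAt ℝ ω (fun ε : ℝ => w (ε ^ 2)) 0 :=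
    ContDiffAt.comp (g := w) (f := fun ε : ℝ => ε ^ 2) 0 (hw.contDiffAt hnhds) hsq.contDiffAt
  have hq0 : ContDiffAt ℝ ω (fun ε : ℝ => q (ε ^ 2)) 0 :=
    ContDiffAt.comp (g := q) (f := fun ε : ℝ => ε ^ 2) 0 (hq.contDiffAt hnhds) hsq.contDiffAt
  obtain ⟨l1, l2⟩ := hasDerivAt_const_sub_sq_mul (hq0.of_le le_top) c
  have ev1 : ∀ᶠ ε in nhds (0 : ℝ), ε ^ 2 ∈ Ioo (-δ) δ := hsq.continuous.continuousAt hnhds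
  have ev2 : ∀ᶠ ε in nhds (0 : ℝ), c - ε ^ 2 * q (ε ^ 2) ∈ I :=
    l1.continuousAt (hI.mem_nhds (by simpa using hc))
  obtain ⟨ε₀, hε₀, hball⟩ := Metric.eventually_nhds_iff.1 (ev1.and ev2)
  have hmem : ∀ ε ∈ Ioo (-ε₀) ε₀, ε ^ 2 ∈ Ioo (-δ) δ ∧ c - ε ^ 2 * q (ε ^ 2) ∈ I := by
    intro ε hε
    refine hball ?_
    rw [Real.dist_eq, sub_zero]
    exact abs_lt.2 hε
  refine ⟨ε₀, hε₀, ?_, ?_, hmem, ?_, l1, ?_⟩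
  · have h : ContDiffOn ℝ ω (fun ε : ℝ => w (ε ^ 2)) (Ioo (-ε₀) ε₀) :=
      hw.comp hsq.contDiffOn fun ε hε => (hmem ε hε).1
    exact (L.contDiff.comp_contDiffOn
      (contDiff_id.contDiffOn.smul (contDiffOn_const.add h))).of_le le_top
  · have h : ContDiffOn ℝ ω (fun ε : ℝ => q (ε ^ 2)) (Ioo (-ε₀) ε₀) :=
      hq.comp hsq.contDiffOn fun ε hε => (hmem ε hε).1
    exact (contDiffOn_const.sub (hsq.contDiffOn.mul h)).of_le le_top
  · have h := (hasDerivAt_id (0 : ℝ)).smul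
      ((hw0'.differentiableAt (by simp)).hasDerivAt.const_add e)
    refine (L.hasFDerivAt.comp_hasDerivAt (0 : ℝ) h).congr_deriv ?_
    simp [hw0]
  · rwa [zero_pow two_ne_zero] at l2

theorem HasSum.single_add_smul {H X : Type*} [AddCommGroup H] [Module ℝ H] [TopologicalSpace H]
    [NormedAddCommGroup X] [NormedSpace ℝ X] {T : ℕ → H →L[ℝ] X} {a : ℕ → H} {z : X}
    (h : HasSum (fun k => T k (a k)) z) (j : ℕ) (χ : H) (c d : ℝ) :
    HasSum (fun k => T k (c • ((if k = j then χ else 0) + d • a k))) (c • (T j χ + d • z)) := by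
  have h1 : HasSum (fun k => T k (if k = j then χ else 0)) (T j χ) := by
    have := hasSum_single (f := fun k => T k (if k = j then χ else 0)) j (fun k hk => by simp [hk])
    simpa using this
  simpa only [map_smul, map_add] using (h1.add (h.const_smul d)).const_smul c

noncomputable section
namespace TravelingWave

theorem hasSum_coe_sineWaves {m : ℕ → SineWaves} {z : SineWaves} (h : HasSum m z) :
    HasSum (fun k => (m k : WaveSpace)) (z : WaveSpace) := by
  unfold HasSum at *
  refine (((continuous_subtype_val (p := fun x => x ∈ SineWaves)).tendsto z).comp h).congr ?_
  intro s
  exact Submodule.coe_sum (p := SineWaves) _ _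

theorem isSineSeries_of_hasSum {a : ℕ → H1R} {z : SineWaves}
    (h : HasSum (fun k => modeS k (a k)) z) (j : ℕ) (χ : H1R) (c d : ℝ) :
    IsSineSeries ((c • (modeS j χ + d • z) : SineWaves) : WaveSpace) := by
  have h1 := hasSum_coe_sineWaves h
  simp only [coe_modeS] at h1
  have h2 := HasSum.single_add_smul (H := H1R) (X := WaveSpace) (T := fun k => mode (k + 1)) h1
    j χ c d
  have e : ((c • (modeS j χ + d • z) : SineWaves) : WaveSpace) =
      c • (mode (j + 1) χ + d • (z : WaveSpace)) := rfl
  rw [e]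
  exact ⟨fun k => h1Val (c • ((if k = j then χ else 0) + d • a k)), _,
    fun k => isSineMode_mode (k + 1) _, h2⟩

theorem isWeakSolution_of_weakForm {Γ V0 : LinfR} {V1 : H1R →L[ℝ] Hm1R} {lam : ℝ} {Φ : SineWaves}
    (h : ∀ Ψ Ψx, (Ψ, Ψx) ∈ TestSpace →
      weakForm V0 V1 lam Ψ Ψx Φ + ⟪l2tVal Ψ, potMul Γ (cubeDxx Φ)⟫_ℝ = 0) :
    IsWeakSolution Γ V0 V1 lam Φ := by
  refine ⟨cube Φ, cubeDxx Φ, ?_, isWeakDeriv2T_cube Φ, fun Ψ Ψx hΨ => ?_⟩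
  · filter_upwards [cube_ae Φ] with x hx
    rw [hx]
    change ∀ᵐ y, _ = h1Val (valS Φ x) y ^ 3
    filter_upwards [h1Mul_ae (valS Φ x) (h1Mul (valS Φ x) (h1Val (valS Φ x))),
      h1Mul_ae (valS Φ x) (h1Val (valS Φ x))] with y h1 h2
    rw [h1, h2]
    ring
  · rw [← weakForm_eq_integral, ← inner_potMul_eq]
    exact h Ψ Ψx hΨ

/-- Shifting the parameter `λ` adds a multiple of `V₀ Φ_xx`. -/
theorem weakForm_sub (V0 : LinfR) (V1 : H1R →L[ℝ] Hm1R) (lam s : ℝ) (Ψ Ψx : L2T H1R)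
    (Φ : WaveSpace) : weakForm V0 V1 (lam - s) Ψ Ψx Φ =
      weakForm V0 V1 lam Ψ Ψx Φ - s * ⟪l2tVal Ψ, potMul V0 (dxxL Φ)⟫_ℝ := by
  rw [weakForm_apply, weakForm_apply]
  ring

/-- The rescaling `Φ = ε u`, `λ = λ_* - ε² q`: by homogeneity of the cubic term, it suffices to
solve the linearized equation for `u` with right-hand side `ε² (q V₀ u_xx - Γ (u³)_xx)`. -/
theorem isWeakSolution_smul {Γ V0 : LinfR} {V1 : H1R →L[ℝ] Hm1R} {lam ε q : ℝ} {u : SineWaves}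
    (h : ∀ Ψ Ψx, (Ψ, Ψx) ∈ TestSpace → weakForm V0 V1 lam Ψ Ψx u =
      ε ^ 2 * ⟪l2tVal Ψ, q • potMul V0 (dxxS u) - potMul Γ (cubeDxx u)⟫_ℝ) :
    IsWeakSolution Γ V0 V1 (lam - ε ^ 2 * q) ((ε • u : SineWaves) : WaveSpace) := by
  refine isWeakSolution_of_weakForm fun Ψ Ψx hΨ => ?_
  have h1 := h Ψ Ψx hΨ
  rw [inner_sub_right, real_inner_smul_right] at h1
  have h2 : weakForm V0 V1 (lam - ε ^ 2 * q) Ψ Ψx ((ε • u : SineWaves) : WaveSpace) =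
      ε * weakForm V0 V1 (lam - ε ^ 2 * q) Ψ Ψx u :=
    (weakForm V0 V1 (lam - ε ^ 2 * q) Ψ Ψx).map_smul ε (u : WaveSpace)
  have h3 : potMul Γ (cubeDxx (ε • u)) = ε ^ 3 • potMul Γ (cubeDxx u) := by
    rw [cubeDxx_smul, map_smul]
  rw [h2, h3, weakForm_sub, h1, real_inner_smul_right, dxxS_apply]
  ring

/-- The value `q(0)`; the expansion of `λ` at zero is `λ_* - q(0) ε² + …`. -/
theorem bifurcation_coefficient (Γ V0 : LinfR) {k : ℕ} (hk : 1 ≤ k) {χ : H1R} {Φ : SineWaves}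
    (hΦ : (Φ : WaveSpace) = mode k χ) :
    ⟪sinMul (k : ℝ) (h1Val χ), potMul Γ (cubeDxx Φ)⟫_ℝ /
      ⟪sinMul (k : ℝ) (h1Val χ), potMul V0 (dxxS Φ)⟫_ℝ =
      3 / 4 * ((∫ y, Γ y * h1Val χ y ^ 4) / ∫ y, V0 y * h1Val χ y ^ 2) := by
  have hk0 : (k : ℝ) ≠ 0 := by exact_mod_cast (by omega : k ≠ 0)
  have hπ := Real.pi_ne_zero
  rw [inner_potMul_cubeDxx_mode Γ hk hΦ, dxxS_apply, hΦ, inner_potMul_dxxL_mode V0 hk]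
  have hne : -((k : ℝ) ^ 2 * Real.pi) ≠ 0 := neg_ne_zero.2 (mul_ne_zero (pow_ne_zero 2 hk0) hπ)
  rw [show -(3 / 4 * (k : ℝ) ^ 2 * Real.pi) * ∫ y, Γ y * h1Val χ y ^ 4 =
    -((k : ℝ) ^ 2 * Real.pi) * (3 / 4 * ∫ y, Γ y * h1Val χ y ^ 4) by ring,
    mul_div_mul_left _ _ hne, mul_div_assoc]

theorem isSineSeries_smul_add {S : L2T L2R →L[ℝ] SineWaves}
    (hS : ∀ f, ∃ a : ℕ → H1R, HasSum (fun k => modeS k (a k)) (S f)) {τ : ℝ} {w : SineWaves}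
    (hw : ∃ f, w = τ • S f) (j : ℕ) (χ : H1R) (c : ℝ) :
    IsSineSeries ((c • (modeS j χ + w) : SineWaves) : WaveSpace) :=
  hw.elim fun f hf => (hS f).elim fun _ ha => hf ▸ isSineSeries_of_hasSum ha j χ c τ

theorem coe_smul_ne_zero {c : ℝ} (hc : c ≠ 0) {u : SineWaves} (hu : u ≠ 0) :
    ((c • u : SineWaves) : WaveSpace) ≠ 0 := by
  intro h
  have h1 : c • (u : WaveSpace) = 0 := h
  exact hu (Subtype.ext ((smul_eq_zero_iff_right hc).1 h1))

theorem weakForm_add_smul {V0 : LinfR} {V1 : H1R →L[ℝ] Hm1R} {lam : ℝ} {Ψ Ψx : L2T H1R}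
    {u v w : SineWaves} {τ : ℝ} (hu : weakForm V0 V1 lam Ψ Ψx u = 0) (hw : w = τ • v) :
    weakForm V0 V1 lam Ψ Ψx (u + w : SineWaves) = τ * weakForm V0 V1 lam Ψ Ψx v := by
  subst hw
  have h1 : weakForm V0 V1 lam Ψ Ψx (u + τ • v : SineWaves) =
      weakForm V0 V1 lam Ψ Ψx u + weakForm V0 V1 lam Ψ Ψx (τ • v : SineWaves) :=
    (weakForm V0 V1 lam Ψ Ψx).map_add u ((τ • v : SineWaves) : WaveSpace)
  have h2 : weakForm V0 V1 lam Ψ Ψx (τ • v : SineWaves) = τ * weakForm V0 V1 lam Ψ Ψx v :=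
    (weakForm V0 V1 lam Ψ Ψx).map_smul τ (v : WaveSpace)
  rw [h1, hu, h2, zero_add]

theorem residual_mem_sinL2 (Γ V0 : LinfR) (q : ℝ) (u : SineWaves) :
    q • potMul V0 (dxxS u) - potMul Γ (cubeDxx u) ∈ sinL2 L2R :=
  Submodule.sub_mem _ (Submodule.smul_mem _ _ (compLp_mem_sinL2 (linfMul V0) (dxxS_mem_sinL2 u)))
    (compLp_mem_sinL2 (linfMul Γ) (cubeDxx_mem_sinL2 u))

/-- The Lyapunov–Schmidt curve of sine waves at the eigenvalue `λ_*`. -/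
theorem exists_wave_curve (Γ V0 : LinfR) {V1 : H1R →L[ℝ] Hm1R} {j : ℕ} {lam : ℝ} {χ : H1R}
    (hχ : ∀ ψ, schrodingerForm V0 V1 (j + 1) lam χ ψ = 0)
    (hV : (∫ y, V0 y * h1Val χ y ^ 2) ≠ 0) {S : L2T L2R →L[ℝ] SineWaves}
    (hS : ∀ f ∈ sinL2 L2R, ⟪sinMul ((j + 1 : ℕ) : ℝ) (h1Val χ), f⟫_ℝ = 0 → ∀ Ψ Ψx,
      (Ψ, Ψx) ∈ TestSpace → weakForm V0 V1 lam Ψ Ψx (S f) = ⟪l2tVal Ψ, f⟫_ℝ) :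
    ∃ (δ : ℝ) (w : ℝ → SineWaves) (q : ℝ → ℝ), 0 < δ ∧ ContDiffOn ℝ ω w (Ioo (-δ) δ) ∧
      ContDiffOn ℝ ω q (Ioo (-δ) δ) ∧ w 0 = 0 ∧
      q 0 = 3 / 4 * ((∫ y, Γ y * h1Val χ y ^ 4) / ∫ y, V0 y * h1Val χ y ^ 2) ∧
      ∀ τ ∈ Ioo (-δ) δ, modeS j χ + w τ ≠ 0 ∧ (∃ f, w τ = τ • S f) ∧
        ∀ Ψ Ψx, (Ψ, Ψx) ∈ TestSpace → weakForm V0 V1 lam Ψ Ψx (modeS j χ + w τ : SineWaves) =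
          τ * ⟪l2tVal Ψ, q τ • potMul V0 (dxxS (modeS j χ + w τ)) -
            potMul Γ (cubeDxx (modeS j χ + w τ))⟫_ℝ := by
  have hj : 1 ≤ j + 1 := Nat.le_add_left 1 j
  have hA : ⟪sinMul ((j + 1 : ℕ) : ℝ) (h1Val χ), potMul V0 (dxxS (modeS j χ))⟫_ℝ ≠ 0 := by
    rw [dxxS_apply, coe_modeS, inner_potMul_dxxL_mode V0 hj]
    refine mul_ne_zero (neg_ne_zero.2 (mul_ne_zero (pow_ne_zero 2 ?_) Real.pi_ne_zero)) hV
    exact_mod_cast (by omega : j + 1 ≠ 0)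
  have h := exists_lyapunov_schmidt_curve (X := SineWaves) (Y := L2T L2R) dxxS contDiff_cubeDxx
    (potMul V0) (potMul Γ) S (modeS j χ) (sinMul ((j + 1 : ℕ) : ℝ) (h1Val χ)) hA
  refine h.imp fun δ h => h.imp fun w h => h.imp fun q h => ?_
  refine ⟨h.1, h.2.1, h.2.2.1, h.2.2.2.1,
    h.2.2.2.2.1.trans (bifurcation_coefficient Γ V0 hj (coe_modeS j χ)), fun τ hτ => ?_⟩
  have hτ' := h.2.2.2.2.2 τ hτ
  refine ⟨hτ'.1, ⟨_, hτ'.2.2⟩, fun Ψ Ψx hΨ => ?_⟩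
  have h0 : weakForm V0 V1 lam Ψ Ψx (modeS j χ) = 0 := by
    rw [coe_modeS, weakForm_mode V0 V1 lam hΨ, hχ]
  exact (weakForm_add_smul h0 hτ'.2.2).trans (congrArg (τ * ·)
    (hS _ (residual_mem_sinL2 Γ V0 (q τ) (modeS j χ + w τ)) hτ'.2.1 Ψ Ψx hΨ))

end TravelingWave
end

theorem theorem2p3
    (Γ V0 : TravelingWave.LinfR) (V1 : TravelingWave.H1R →L[ℝ] TravelingWave.Hm1R)
    (hL1 : ∀ k : ℕ, 1 ≤ k → ∀ lam : ℝ,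
      IsSelfAdjoint (TravelingWave.schrodinger V0 V1 k lam))
    (ks : ℕ) (hks : 1 ≤ ks) (lams : ℝ) (I : Set ℝ) (hIo : IsOpen I) (hIc : I.OrdConnected)
    (hlams : lams ∈ I)
    (hL2 : TravelingWave.ZeroIsIsolatedSimpleEigenvalue (TravelingWave.schrodinger V0 V1 ks lams))
    (hL2' : ∀ k : ℕ, 1 ≤ k → ∀ lam ∈ I, (k, lam) ≠ (ks, lams) →
      TravelingWave.MemResolventSet (TravelingWave.schrodinger V0 V1 k lam) 0)
    (hL3 : ∃ (C : ℝ) (K : ℕ), ∀ k : ℕ, 1 ≤ k → K ≤ k → ∀ lam ∈ I,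
      ∀ (φ : TravelingWave.H1R) (f : TravelingWave.L2R),
        (TravelingWave.h1Val φ, f) ∈ (TravelingWave.schrodinger V0 V1 k lam).graph →
          ‖TravelingWave.h1Val φ‖ ≤ C / (k : ℝ) ^ 2 * ‖f‖ ∧
          ‖TravelingWave.h1Der φ‖ ≤ C / (k : ℝ) * ‖f‖)
    (φs : TravelingWave.L2R)
    (hφs : TravelingWave.kernel (TravelingWave.schrodinger V0 V1 ks lams) =
      Submodule.span ℝ {φs})
    (htrans : (∫ y, V0 y * φs y ^ 2) ≠ 0) :
    ∃ (ε₀ : ℝ) (Φ : ℝ → TravelingWave.WaveSpace) (lam : ℝ → ℝ), 0 < ε₀ ∧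
      ContDiffOn ℝ ∞ Φ (Ioo (-ε₀) ε₀) ∧
      ContDiffOn ℝ ∞ lam (Ioo (-ε₀) ε₀) ∧
      (∀ ε ∈ Ioo (-ε₀) ε₀,
        lam ε ∈ I ∧
        TravelingWave.IsWeakSolution Γ V0 V1 (lam ε) (Φ ε) ∧
        TravelingWave.IsSineSeries (Φ ε) ∧
        (ε ≠ 0 → Φ ε ≠ 0)) ∧
      Φ 0 = 0 ∧
      (∃ Φ' : TravelingWave.WaveSpace,
        HasDerivAt Φ Φ' 0 ∧ TravelingWave.IsSineMode ks φs Φ') ∧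
      lam 0 = lams ∧
      HasDerivAt lam 0 0 ∧
      HasDerivAt (deriv lam)
        (-(3 / 2) * ((∫ y, Γ y * φs y ^ 4) / (∫ y, V0 y * φs y ^ 2))) 0 := by
  open TravelingWave in
  obtain ⟨C, K, hbd⟩ := hL3
  obtain ⟨j, rfl⟩ : ∃ j, ks = j + 1 := ⟨ks - 1, by omega⟩
  have hmem : φs ∈ kernel (schrodinger V0 V1 (j + 1) lams) :=
    hφs ▸ Submodule.mem_span_singleton_self φs
  obtain ⟨χ, rfl, hχ⟩ := exists_h1_of_mem_kernel hmem
  obtain ⟨S, hS1, hS2⟩ := exists_solution_operator (hL1 (j + 1) hks lams) hL2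
    (fun k hk hne => hL2' k hk lams hlams fun h => hne (congrArg Prod.fst h)) hφs
    (fun k hk hK χ f h => hbd k hk hK lams hlams χ f h)
  obtain ⟨δ, w, q, hδ, hw, hq, hw0, hq0, hcurve⟩ := exists_wave_curve Γ V0 hχ htrans hS2
  have hbranch := exists_branch (X := SineWaves) (Z := WaveSpace) SineWaves.subtypeL (modeS j χ)
    hδ hw hq hw0 hIo hlams
  refine hbranch.elim fun ε₀ h => ?_
  refine ⟨ε₀, fun ε => SineWaves.subtypeL (ε • (modeS j χ + w (ε ^ 2))),
    fun ε => lams - ε ^ 2 * q (ε ^ 2), h.1, h.2.1, h.2.2.1, fun ε hε => ?_, ?_,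
    ⟨SineWaves.subtypeL (modeS j χ), h.2.2.2.2.1, isSineMode_mode (j + 1) χ⟩, ?_,
    h.2.2.2.2.2.1, ?_⟩
  · have hc := hcurve _ (h.2.2.2.1 ε hε).1
    exact ⟨(h.2.2.2.1 ε hε).2, isWeakSolution_smul hc.2.2,
      isSineSeries_smul_add hS1 hc.2.1 j χ ε, fun h0 => coe_smul_ne_zero h0 hc.1⟩
  · exact (congrArg SineWaves.subtypeL (zero_smul ℝ _)).trans (map_zero SineWaves.subtypeL)
  · simp
  · refine h.2.2.2.2.2.2.congr_deriv ?_
    rw [hq0]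
    ring
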